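/- Let $T>0$, $\sigma\ge 0$, $\psi(t)=\sigma^2 t$, and let $B=C([-T,0])$ with the supremum norm. Elements of $B$ are extended to $\mathbb R$ by their boundary values. Let $X=(X_t)_{t\in[0,T]}$ be a real continuous process on a probability space $(\Omega,\mathcal F,\mathbb P)$, prolonged by $X_t=X_0$ for $t\le 0$ and $X_t=X_T$ for $t\ge T$, with window $X_t(\cdot)\in B$, $X_t(x)=X_{t+x}$, $x\in[-T,0]$. Suppose that almost surely $$\lim_{\varepsilon\to0+}\frac1\varepsilon\int_0^t (X_{s+\varepsilon}-X_s)^2\,ds=\sigma^2 t\qquad\text{for all } t\in[0,T].$$ *Notation.* For $t\in[0,T]$ let $V_{2,\psi}(t)$ be the set of those $\eta\in B$ whose deterministic quadratic variation on $[-t,0]$ exists and equals $\psi$: $\lim_{\varepsilon\to0+}\frac1\varepsilon\int_0^x(\eta(r+\varepsilon)-\eta(r))^2dr=\sigma^2x$ for all $x\in[-t,0]$. For a functional $u$, $D u(t,\eta)$ and $D^2u(t,\eta)$ are the Fréchet derivatives in $\eta$; $Du(t,\eta)\in B^*$ is identified with a finite signed measure on $[-T,0]$, and $D^{\delta_0}u(t,\eta)=Du(t,\eta)(\{0\})$,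 $D^\perp u(t,\eta)=Du(t,\eta)-D^{\delta_0}u(t,\eta)\,\delta_0$. Put $$I(t,\eta,\varepsilon)=\int_{]-t,0]}D^\perp_{dx}u(t,\eta)\,\frac{\eta(x+\varepsilon)-\eta(x)}{\varepsilon},\qquad I(u)(t,\eta)=\int_{]-t,0]}D^\perp_{dx}u(t,\eta)\,d^-\eta(x)=\lim_{\varepsilon\to0+}I(t,\eta,\varepsilon).$$ Let $\chi_0$ be the Banach space (direct sum of its five components) of signed measures on $[-T,0]^2$ of the form $$\lambda\,\delta_0(dx)\delta_0(dy)+a(x)dx\,\delta_0(dy)+\delta_0(dx)\,b(y)dy+k(x,y)\,dx\,dy+g(x)\,\delta_y(dx)\,dy,$$ with $\lambda\in\mathbb R$, $a,b\in L^2([-T,0])$, $k\in L^2([-T,0]^2)$, $g\in L^\infty([-T,0])$, and let $D_t=\{(x,y)\in[-t,0]^2: x=y\}$. A measure $\mu\in\chi_0$ is identified with the bilinear form $(f,h)\mapsto\int f(x)h(y)\,\mu(dx,dy)$ on $B$. *Assumptions.* Let $G:B\to\mathbb R$ and let $u:[0,T]\times B\to\mathbb R$ be of class $C^{1,2}([0,T[\times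 B)\cap C^0([0,T]\times B)$, such that the following hold. 1. (Condition (C).) For all $t\in[0,T[$ and $\eta\in V_{2,\psi}(t)$ the integral $I(u)(t,\eta)$ exists; and there is a function $J\ge 0$ of $(t,\eta)$ with $|I(t,\eta,\varepsilon)|\le J(t,\eta)$ for all $\varepsilon>0$, $t\in[0,T[$, $\eta\in V_{2,\psi}(t)$, such that $\int_0^T\sup_{\eta:(s,\eta)\in K}J(s,\eta)\,ds<\infty$ for every compact $K\subset[0,T]\times B$ with $\eta\in V_{2,\psi}(s)$ for all $(s,\eta)\in K$. 2. For all $t\in[0,T[$ and $\eta\in V_{2,\psi}(t)$, $D^2u(t,\eta)\in\chi_0$, and $(t,\eta)\mapsto D^2u(t,\eta)$ is continuous on the set of these $(t,\eta)$, with the topology of $[0,T[\times B$, into $\chi_0$. 3. $u$ solves $$\partial_tu(t,\eta)+I(u)(t,\eta)+\frac{\sigma^2}{2}\langle D^2u(t,\eta),1_{D_t}\rangle=0\quad (t\in[0,T[,\ \eta\in V_{2,\psi}(t)),\qquad u(T,\cdot)=G.$$ *Conclusion.* The process $\xi_s=D^{\delta_0}u(s,X_s(\cdot))$, $s\in[0,T[$,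 is adapted to the canonical filtration of $X$, the improper forward integral $\int_0^T\xi_s\,d^-X_s$ exists, and almost surely $$G(X_T(\cdot))=u(0,X_0(\cdot))+\int_0^T D^{\delta_0}u(s,X_s(\cdot))\,d^-X_s .$$ Here existence means: for every $t\in[0,T[$ the path $\xi$ is a.s. integrable on $[0,t]$, the limit in probability $\int_0^t\xi_s\,d^-X_s=\lim_{\varepsilon\to0+}\int_0^t\xi_s\frac{X_{s+\varepsilon}-X_s}{\varepsilon}ds$ exists, with a version continuous in $t\in[0,T[$, and $\int_0^T\xi_s\,d^-X_s$ is its limit in probability as $t\uparrow T$. -/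

import Mathlib

open MeasureTheory Set Filter Topology
open scoped NNReal ENNReal CompactlySupported Pointwise

namespace WindowCalculus

section Riesz

variable {X : Type*} [TopologicalSpace X]

/-- A nonnegative continuous function seen as a real one. -/
def realOf (g : C_c(X, ℝ≥0)) : C(X, ℝ) := ⟨fun x => (g x : ℝ), by fun_prop⟩

lemma realOf_add (f g : C_c(X, ℝ≥0)) : realOf (f + g) = realOf f + realOf g := by
  ext x; simp [realOf]

lemma realOf_smul (a : ℝ≥0) (f : C_c(X, ℝ≥0)) : realOf (a • f) = (a : ℝ) • realOf f := by
  ext x; simp [realOf]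

/-- The values `L g`, `0 ≤ g ≤ f`. -/
def valuesBelow (L : C(X, ℝ) →L[ℝ] ℝ) (f : C_c(X, ℝ≥0)) : Set ℝ :=
  {r | ∃ g : C_c(X, ℝ≥0), (∀ x, g x ≤ f x) ∧ L (realOf g) = r}

lemma zero_mem_valuesBelow (L : C(X, ℝ) →L[ℝ] ℝ) (f : C_c(X, ℝ≥0)) : 0 ∈ valuesBelow L f := by
  refine ⟨0, fun x => by simp, ?_⟩
  have : realOf (0 : C_c(X, ℝ≥0)) = 0 := by ext x; simp [realOf]
  simp [this]

lemma bddAbove_valuesBelow [CompactSpace X] (L : C(X, ℝ) →L[ℝ] ℝ) (f : C_c(X, ℝ≥0)) :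
    BddAbove (valuesBelow L f) := by
  refine ⟨‖L‖ * ‖realOf f‖, ?_⟩
  rintro r ⟨g, hg, rfl⟩
  refine (le_abs_self _).trans ((L.le_opNorm _).trans ?_)
  gcongr
  refine (ContinuousMap.norm_le _ (norm_nonneg _)).2 fun x => ?_
  refine le_trans ?_ ((realOf f).norm_coe_le_norm x)
  simpa [realOf] using hg x

lemma valuesBelow_add [CompactSpace X] (L : C(X, ℝ) →L[ℝ] ℝ) (f₁ f₂ : C_c(X, ℝ≥0)) :
    valuesBelow L (f₁ + f₂) = valuesBelow L f₁ + valuesBelow L f₂ := by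
  ext r
  rw [Set.mem_add]
  constructor
  · rintro ⟨g, hg, rfl⟩
    let g₁ : C_c(X, ℝ≥0) := ⟨⟨fun x => min (g x) (f₁ x), by fun_prop⟩,
      HasCompactSupport.of_compactSpace _⟩
    let g₂ : C_c(X, ℝ≥0) := ⟨⟨fun x => g x - f₁ x, by fun_prop⟩,
      HasCompactSupport.of_compactSpace _⟩
    refine ⟨_, ⟨g₁, fun x => min_le_right _ _, rfl⟩, _, ⟨g₂, fun x => ?_, rfl⟩, ?_⟩
    · have h : g x ≤ f₁ x + f₂ x := by simpa using hg x
      exact tsub_le_iff_left.2 h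
    · rw [← map_add, ← realOf_add]
      congr 2
      ext x
      have : min (g x) (f₁ x) + (g x - f₁ x) = g x := by
        rcases le_total (g x) (f₁ x) with h | h
        · simp [h, tsub_eq_zero_of_le h]
        · simp [h]
      exact congrArg _ this
  · rintro ⟨_, ⟨g₁, h₁, rfl⟩, _, ⟨g₂, h₂, rfl⟩, rfl⟩
    refine ⟨g₁ + g₂, fun x => ?_, ?_⟩
    · simpa using add_le_add (h₁ x) (h₂ x)
    · rw [realOf_add, map_add]

lemma valuesBelow_smul (L : C(X, ℝ) →L[ℝ] ℝ) (a : ℝ≥0) (f : C_c(X, ℝ≥0)) :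
    valuesBelow L (a • f) = (a : ℝ) • valuesBelow L f := by
  ext r
  rw [Set.mem_smul_set]
  constructor
  · rintro ⟨g, hg, rfl⟩
    rcases eq_or_ne a 0 with rfl | ha
    · refine ⟨0, zero_mem_valuesBelow L f, ?_⟩
      have : realOf g = 0 := by
        ext x
        have := hg x
        simpa [realOf] using this
      simp [this]
    · refine ⟨_, ⟨a⁻¹ • g, fun x => ?_, rfl⟩, ?_⟩
      · have h : g x ≤ a * f x := by simpa using hg x
        simpa using (inv_mul_le_iff₀ (pos_iff_ne_zero.2 ha)).2 h
      · rw [realOf_smul, map_smul, smul_smul]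
        simp [ha]
  · rintro ⟨_, ⟨g, hg, rfl⟩, rfl⟩
    refine ⟨a • g, fun x => ?_, ?_⟩
    · simpa using mul_le_mul_right (hg x) a
    · rw [realOf_smul, map_smul]

/-- The positive part of a bounded functional, on nonnegative functions. -/
noncomputable def posPartFunctional [CompactSpace X] (L : C(X, ℝ) →L[ℝ] ℝ) :
    C_c(X, ℝ≥0) →ₗ[ℝ≥0] ℝ≥0 where
  toFun f := NNReal.mk (sSup (valuesBelow L f))
    (le_csSup (bddAbove_valuesBelow L f) (zero_mem_valuesBelow L f))
  map_add' f g := by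
    apply NNReal.eq
    change sSup (valuesBelow L (f + g)) = sSup (valuesBelow L f) + sSup (valuesBelow L g)
    rw [valuesBelow_add]
    exact csSup_add ⟨0, zero_mem_valuesBelow L f⟩ (bddAbove_valuesBelow L f)
      ⟨0, zero_mem_valuesBelow L g⟩ (bddAbove_valuesBelow L g)
  map_smul' a f := by
    apply NNReal.eq
    change sSup (valuesBelow L (a • f)) = (a : ℝ) * sSup (valuesBelow L f)
    rw [valuesBelow_smul, Real.sSup_smul_of_nonneg a.coe_nonneg, smul_eq_mul]

lemma le_posPartFunctional [CompactSpace X] (L : C(X, ℝ) →L[ℝ] ℝ) (f : C_c(X, ℝ≥0)) :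
    L (realOf f) ≤ posPartFunctional L f :=
  le_csSup (bddAbove_valuesBelow L f) ⟨f, fun _ => le_rfl, rfl⟩

/-- The negative part of a bounded functional, on nonnegative functions. -/
noncomputable def negPartFunctional [CompactSpace X] (L : C(X, ℝ) →L[ℝ] ℝ) :
    C_c(X, ℝ≥0) →ₗ[ℝ≥0] ℝ≥0 where
  toFun f := NNReal.mk (posPartFunctional L f - L (realOf f))
    (sub_nonneg.2 (le_posPartFunctional L f))
  map_add' f g := by
    apply NNReal.eq
    change (posPartFunctional L (f + g) : ℝ) - L (realOf (f + g)) =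
      (posPartFunctional L f - L (realOf f)) + (posPartFunctional L g - L (realOf g))
    rw [map_add, realOf_add, map_add, NNReal.coe_add]
    ring
  map_smul' a f := by
    apply NNReal.eq
    change (posPartFunctional L (a • f) : ℝ) - L (realOf (a • f)) =
      a * (posPartFunctional L f - L (realOf f))
    rw [map_smul, realOf_smul, map_smul, smul_eq_mul, smul_eq_mul, NNReal.coe_mul]
    ring

/-- Riesz representation: a bounded functional on `C(X, ℝ)` is the integral against a finite
signed Borel measure. -/
theorem exists_signedMeasure [CompactSpace X] [T2Space X] [MeasurableSpace X] [BorelSpace X]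
    (L : C(X, ℝ) →L[ℝ] ℝ) :
    ∃ m : SignedMeasure X, ∀ f : C(X, ℝ), L f = ∫ᵛ x, f x ∂<•m := by
  set μ := NNRealRMK.rieszMeasure (posPartFunctional L) with hμ
  set ν := NNRealRMK.rieszMeasure (negPartFunctional L) with hν
  refine ⟨μ.toSignedMeasure - ν.toSignedMeasure, fun f => ?_⟩
  have hi : ∀ (ρ : Measure X) [IsFiniteMeasure ρ] (g : C(X, ℝ)), Integrable g ρ := fun ρ _ g =>
    g.continuous.integrable_of_hasCompactSupport (HasCompactSupport.of_compactSpace _)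
  have key : ∀ g : C_c(X, ℝ≥0), ∫ x, realOf g x ∂μ - ∫ x, realOf g x ∂ν = L (realOf g) := by
    intro g
    have h1 : ∫ x, realOf g x ∂μ = posPartFunctional L g :=
      NNRealRMK.integral_rieszMeasure _ g
    have h2 : ∫ x, realOf g x ∂ν = negPartFunctional L g :=
      NNRealRMK.integral_rieszMeasure _ g
    have h3 : (negPartFunctional L g : ℝ) = posPartFunctional L g - L (realOf g) := rfl
    rw [h1, h2, h3]
    ring
  let p : C_c(X, ℝ≥0) := ⟨⟨fun x => (f x).toNNReal, by fun_prop⟩,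
    HasCompactSupport.of_compactSpace _⟩
  let n : C_c(X, ℝ≥0) := ⟨⟨fun x => (-f x).toNNReal, by fun_prop⟩,
    HasCompactSupport.of_compactSpace _⟩
  have hf : f = realOf p - realOf n := by
    ext x
    simp [realOf, p, n]
  rw [VectorMeasure.integral_sub_vectorMeasure, VectorMeasure.integral_toSignedMeasure,
    VectorMeasure.integral_toSignedMeasure]
  · conv_lhs => rw [hf, map_sub, ← key p, ← key n]
    have e : ∀ (ρ : Measure X) [IsFiniteMeasure ρ],
        ∫ x, f x ∂ρ = ∫ x, realOf p x ∂ρ - ∫ x, realOf n x ∂ρ := by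
      intro ρ _
      rw [← integral_sub (hi ρ _) (hi ρ _)]
      conv_lhs => rw [hf]
      rfl
    rw [e μ, e ν]
    ring
  · simp [VectorMeasure.Integrable, hi μ f]
  · simp [VectorMeasure.Integrable, hi ν f]

end Riesz

/-! ### Paths, windows, deterministic calculus via regularization -/

section Paths

variable {T : ℝ} [hT : Fact (0 < T)]

/-- The state space `B = C([-T, 0])` with the supremum norm. -/
abbrev PathSpace (T : ℝ) : Type := C(Icc (-T) (0 : ℝ), ℝ)

/-- The point `0` of `[-T, 0]`. -/
def zeroPt : Icc (-T) (0 : ℝ) := ⟨0, by have := hT.out; constructor <;> linarith⟩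

/-- A continuous function on `[-T, 0]`, extended to the real line by its boundary values. -/
noncomputable def extend (η : PathSpace T) : ℝ → ℝ :=
  IccExtend (by have := hT.out; linarith : -T ≤ (0 : ℝ)) η

/-- A continuous path on `[0, T]`, extended by `γ 0` for negative times and by `γ T` after `T`. -/
noncomputable def prolong (γ : C(Icc (0 : ℝ) T, ℝ)) : ℝ → ℝ :=
  IccExtend hT.out.le γ

/-- The window `γ_t(·)`, that is `x ↦ γ_{t + x}` for `x ∈ [-T, 0]`. -/
noncomputable def window (γ : C(Icc (0 : ℝ) T, ℝ)) (t : ℝ) : PathSpace T where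
  toFun x := prolong γ (t + x)
  continuous_toFun := by
    have : Continuous (prolong γ) := γ.continuous.Icc_extend'
    fun_prop

/-- `V_{2,ψ}` on `[-t, 0]`: the functions `η` whose deterministic quadratic variation by
regularization, `[η](x) = lim_{ε → 0+} ∫_0^x (η(r + ε) - η(r))² dr / ε`, exists and equals `ψ(x)`
for all `x ∈ [-t, 0]`. -/
def qvSpace (T : ℝ) [Fact (0 < T)] (ψ : ℝ → ℝ) (t : ℝ) : Set (PathSpace T) :=
  {η | ∀ x ∈ Icc (-t) 0, Tendsto
    (fun ε : ℝ => ∫ r in (0 : ℝ)..x, (extend η (r + ε) - extend η r) ^ 2 / ε)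
    (𝓝[>] 0) (𝓝 (ψ x))}

/-- The approximation `∫_{]-t,0]} m(dx) (η(x + ε) - η(x)) / ε` of the deterministic forward
integral. -/
noncomputable def detForwardApprox (m : SignedMeasure (Icc (-T) (0 : ℝ))) (t : ℝ)
    (η : PathSpace T) (ε : ℝ) : ℝ :=
  ∫ᵛ x in {x : Icc (-T) (0 : ℝ) | -t < (x : ℝ)}, (extend η (x + ε) - extend η x) / ε ∂<•m

/-- Existence of the deterministic forward integral `∫_{]-t,0]} m(dx) d⁻η(x)`. -/
def DetForwardExists (m : SignedMeasure (Icc (-T) (0 : ℝ))) (t : ℝ) (η : PathSpace T) : Prop :=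
  ∃ l : ℝ, Tendsto (detForwardApprox m t η) (𝓝[>] 0) (𝓝 l)

/-- The deterministic forward integral `∫_{]-t,0]} m(dx) d⁻η(x)`, used where it exists. -/
noncomputable def detForward (m : SignedMeasure (Icc (-T) (0 : ℝ))) (t : ℝ)
    (η : PathSpace T) : ℝ :=
  limUnder (𝓝[>] 0) (detForwardApprox m t η)

end Paths

/-! ### Functionals `u : [0, T] × C([-T, 0]) → ℝ` -/

section Functionals

variable {T : ℝ} [hT : Fact (0 < T)]

/-- The time derivative `∂_t u (t, η)` on `[0, T[` (one-sided at `0`). -/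
noncomputable def timeDeriv (u : ℝ → PathSpace T → ℝ) (t : ℝ) (η : PathSpace T) : ℝ :=
  derivWithin (fun s => u s η) (Ico 0 T) t

/-- `u` is of class `C^{1,2}([0, T[ × B) ∩ C^0([0, T] × B)`: `D` and `D²` are Fréchet derivatives
in the path variable. -/
structure IsC12 (u : ℝ → PathSpace T → ℝ) : Prop where
  continuousOn : ContinuousOn (fun p : ℝ × PathSpace T => u p.1 p.2) (Icc 0 T ×ˢ univ)
  differentiable_time : ∀ η, DifferentiableOn ℝ (fun s => u s η) (Ico 0 T)
  continuousOn_timeDeriv :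
    ContinuousOn (fun p : ℝ × PathSpace T => timeDeriv u p.1 p.2) (Ico 0 T ×ˢ univ)
  differentiable_space : ∀ t ∈ Ico 0 T, Differentiable ℝ (u t)
  continuousOn_fderiv :
    ContinuousOn (fun p : ℝ × PathSpace T => fderiv ℝ (u p.1) p.2) (Ico 0 T ×ˢ univ)
  differentiable_fderiv : ∀ t ∈ Ico 0 T, Differentiable ℝ (fderiv ℝ (u t))
  continuousOn_fderiv_fderiv :
    ContinuousOn (fun p : ℝ × PathSpace T => fderiv ℝ (fderiv ℝ (u p.1)) p.2) (Ico 0 T ×ˢ univ)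

/-- The signed measure on `[-T, 0]` representing an element of the dual of `C([-T, 0])`
(unique, by Riesz). -/
noncomputable def dualMeasure (L : PathSpace T →L[ℝ] ℝ) : SignedMeasure (Icc (-T) (0 : ℝ)) :=
  Classical.choose (exists_signedMeasure L)

/-- `D^{δ₀} u (t, η) = Du(t, η)({0})`. -/
noncomputable def gradDelta (u : ℝ → PathSpace T → ℝ) (t : ℝ) (η : PathSpace T) : ℝ :=
  dualMeasure (fderiv ℝ (u t) η) {zeroPt}

/-- `D^⊥ u (t, η) = Du(t, η) - D^{δ₀} u (t, η) δ₀`, a signed measure on `[-T, 0]`. -/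
noncomputable def gradPerp (u : ℝ → PathSpace T → ℝ) (t : ℝ) (η : PathSpace T) :
    SignedMeasure (Icc (-T) (0 : ℝ)) :=
  dualMeasure (fderiv ℝ (u t) η) - VectorMeasure.dirac zeroPt (gradDelta u t η)

/-- `I(u)(t, η) = ∫_{]-t,0]} D^⊥_{dx} u (t, η) d⁻η(x)`. -/
noncomputable def horizontalTerm (u : ℝ → PathSpace T → ℝ) (t : ℝ) (η : PathSpace T) : ℝ :=
  detForward (gradPerp u t η) t η

/-- Condition (C) related to `ψ`: the integrals `I(u)(t, η)` exist, and their approximations are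
bounded, uniformly in `ε`, by some `J(t, η)` whose supremum over (the sections of) any compact set
of pairs `(t, η)` is integrable in time. -/
def ConditionC (ψ : ℝ → ℝ) (u : ℝ → PathSpace T → ℝ) : Prop :=
  (∀ t ∈ Ico 0 T, ∀ η ∈ qvSpace T ψ t, DetForwardExists (gradPerp u t η) t η) ∧
  ∃ J : ℝ → PathSpace T → ℝ≥0,
    (∀ ε > 0, ∀ t ∈ Ico 0 T, ∀ η ∈ qvSpace T ψ t,
      |detForwardApprox (gradPerp u t η) t η ε| ≤ J t η) ∧
    ∀ K : Set (ℝ × PathSpace T), IsCompact K →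
      (∀ p ∈ K, p.1 ∈ Icc 0 T ∧ p.2 ∈ qvSpace T ψ p.1) →
      ∫⁻ s in Ico 0 T, ⨆ η ∈ {η | (s, η) ∈ K}, (J s η : ℝ≥0∞) < ∞

end Functionals

/-! ### The Chi-space `χ₀` -/

section Chi

variable {T : ℝ} [hT : Fact (0 < T)]

/-- Lebesgue measure on `[-T, 0]`. -/
noncomputable abbrev leb (T : ℝ) : Measure (Icc (-T) (0 : ℝ)) :=
  Measure.comap (fun x : Icc (-T) (0 : ℝ) => (x : ℝ)) volume

/-- The space `χ₀` of signed measures on `[-T, 0]²`, a direct sum of Banach spaces: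
`(l, a, b, k, g)` stands for the measure
`l δ₀(dx) δ₀(dy) + a(x) dx δ₀(dy) + δ₀(dx) b(y) dy + k(x, y) dx dy + g(x) δ_y(dx) dy`
with `l` real, `a`, `b`, `k` square integrable and `g` essentially bounded. The product norm is
equivalent to the sum of the five norms. -/
abbrev Chi0 (T : ℝ) : Type :=
  ℝ × Lp ℝ 2 (leb T) × Lp ℝ 2 (leb T) × Lp ℝ 2 ((leb T).prod (leb T)) × Lp ℝ ∞ (leb T)

/-- The integral `⟨c, F⟩` of a bounded Borel function `F` on `[-T, 0]²` against the measure
`c ∈ χ₀`. -/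
noncomputable def Chi0.pair (c : Chi0 T)
    (F : Icc (-T) (0 : ℝ) → Icc (-T) (0 : ℝ) → ℝ) : ℝ :=
  c.1 * F zeroPt zeroPt + (∫ x, c.2.1 x * F x zeroPt ∂leb T) +
    (∫ y, c.2.2.1 y * F zeroPt y ∂leb T) +
    (∫ z, c.2.2.2.1 z * F z.1 z.2 ∂(leb T).prod (leb T)) +
    ∫ x, c.2.2.2.2 x * F x x ∂leb T

/-- The indicator function of `D_t = {(x, y) ∈ [-t, 0]² | x = y}`. -/
noncomputable def diagIndicator (T t : ℝ) (x y : Icc (-T) (0 : ℝ)) : ℝ :=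
  {z : Icc (-T) (0 : ℝ) × Icc (-T) (0 : ℝ) | z.1 = z.2 ∧ -t ≤ (z.1 : ℝ)}.indicator 1 (x, y)

end Chi

/-! ### Forward integrals of processes -/

section Processes

variable {Ω : Type*} [MeasurableSpace Ω]

/-- `Z` is the limit in probability of `∫_0^t Y_r (X_{r + ε} - X_r) / ε dr` as `ε → 0+`, the
integrand `Y` being a.s. integrable on `[0, t]`. -/
def IsForwardLimit (P : Measure Ω) (Y X : ℝ → Ω → ℝ) (t : ℝ) (Z : Ω → ℝ) : Prop :=
  (∀ᵐ ω ∂P, IntervalIntegrable (fun r => Y r ω) volume 0 t) ∧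
  TendstoInMeasure P
    (fun ε ω => ∫ r in (0 : ℝ)..t, Y r ω * ((X (r + ε) ω - X r ω) / ε)) (𝓝[>] 0) Z

/-- `Z` is the improper forward integral `∫_0^T Y_r d⁻X_r`: the forward integrals up to `t < T`
exist, form a process continuous on `[0, T[`, and converge to `Z` in probability as `t → T`. -/
def IsImproperForwardIntegral (P : Measure Ω) (T : ℝ) (Y X : ℝ → Ω → ℝ) (Z : Ω → ℝ) : Prop :=
  ∃ F : ℝ → Ω → ℝ, (∀ t ∈ Ico 0 T, IsForwardLimit P Y X t (F t)) ∧
    (∀ ω, ContinuousOn (fun t => F t ω) (Ico 0 T)) ∧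
    TendstoInMeasure P F (𝓝[<] T) Z

/-- The canonical filtration of `X`: the sigma-algebra generated by `X_r`, `r ≤ s`. -/
abbrev canonicalSigma {T : ℝ} (X : Ω → C(Icc (0 : ℝ) T, ℝ)) (s : ℝ) : MeasurableSpace Ω :=
  ⨆ r : Icc (0 : ℝ) T, ⨆ (_ : (r : ℝ) ≤ s),
    MeasurableSpace.comap (fun ω => X ω r) inferInstance

end Processes

end WindowCalculus

open WindowCalculus

/-!
The theorem is an Itô formula for `u(s, X_s(·))`, and it holds path by path. Let `g` be a path of
`X`, prolonged to the line, with quadratic variation `σ² t`; let `η_s` be its window at time `s` and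
`Δ_s = η_{s+ε} - η_s`. For `t < T`, the quotient
`ε⁻¹ ∫_0^t (u(s + ε, η_{s+ε}) - u(s, η_s)) ds` converges to `u(t, η_t) - u(0, η_0)`. The integrand
is expanded to first order in time and to second order in space, and the equation shows that in the
limit everything cancels except `ε⁻¹ ∫_0^t D^{δ₀}u(s, η_s) (g(s + ε) - g(s)) ds`
(`HasQV.tendsto_forwardIntegral`). The limits in probability follow from the almost sure ones, and
at `t = T` only the continuity of `u` is used. Adaptedness holds because `D^{δ₀}u(s, ·)` is
continuous and a continuous functional of the window is measurable for the sigma-algebra of its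
evaluations.

*Second order.* The second derivative belongs to `χ₀` on `V_{2,ψ}` only, but this set is dense,
being stable under Lipschitz perturbations. Hence near a window `D²u` is bounded, and close to its value
there, as a form for the seminorm `|f(0)| + ‖f‖_{L²}` (`exists_form_near`). The integral over time
of the square of this seminorm of `Δ_s` is of order `ε`, so that Taylor's formula leaves a
negligible remainder. In `ε⁻¹ ∫ ⟨D²u, Δ_s ⊗ Δ_s⟩ ds` the square integrable components do not
contribute, since `Δ_s / √ε` tends weakly to `0` in `L²`; the atom at `(0, 0)` and the diagonal
density give `σ² ⟨D²u, 1_{D_s}⟩` (`HasQV.tendsto_integral_form`).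

*First order.* What has to be shown is that `Du(s, η_s)`, freed from its atom at `0`, gives the
integral `I(u)(s, η_s)` when applied to `Δ_s / ε` (`tendsto_integral_first_order`). The increment
`Δ_s` differs from that of the function `η_s` extended by its boundary values in two places.

* At the right end, on `]-ε, 0]`, it involves the future of the path. This part `f` is removed by
  means of condition (C). That condition can be used for `η_s + A_n φ_n(s)` with `A_n → ∞` if the
  `φ_n(s)` are Lipschitz and tend to `0` uniformly, and division by `A_n` shows that the integrals of
  the increments of `φ_n(s)` are negligible if the above seminorm of `φ_n(s)` is `o(√ε)` in mean
  square over time (`tendsto_integral_rightPart_extIncr`). A function `f`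
  supported in `]-ε, 0[` is, up to a small average of translates, the increment of
  `-∑_{j < N} (1 - j / N) f(· + j ε)`.
* On `[-T, -s]`, which the integral over `]-s, 0]` leaves out, it involves the initial part of the
  path. Once the increments of a localized copy of this part are subtracted, `Δ_s` vanishes there.
  The contribution of the copy is negligible, by summation by parts in time
  (`tendsto_integral_apply_initPart`) and by condition (C) again.
-/

set_option linter.unusedSectionVars false

namespace WindowCalculus

/-! ### Functionals on `C([-T, 0])` and their signed measures -/

instance isFiniteMeasure_variation {X : Type*} [MeasurableSpace X] (m : SignedMeasure X) :
    IsFiniteMeasure m.variation := by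
  rw [← SignedMeasure.totalVariation_eq_variation, SignedMeasure.totalVariation]
  infer_instance

lemma integrable_of_continuous {X : Type*} [TopologicalSpace X] [CompactSpace X]
    [MeasurableSpace X] [BorelSpace X] (m : SignedMeasure X) (f : C(X, ℝ)) :
    m.Integrable f :=
  f.continuous.integrable_of_hasCompactSupport (HasCompactSupport.of_compactSpace _)

section Dual

variable {T : ℝ} [hT : Fact (0 < T)]

lemma dualMeasure_spec (L : PathSpace T →L[ℝ] ℝ) (f : PathSpace T) :
    L f = ∫ᵛ x, f x ∂<•(dualMeasure L) :=
  Classical.choose_spec (exists_signedMeasure L) f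

/-- The mass `L({0})` of the signed measure representing the functional `L`. -/
noncomputable def deltaPart (L : PathSpace T →L[ℝ] ℝ) : ℝ := dualMeasure L {zeroPt}

/-- The integral of `F` over `]-s, 0]` against `L - L({0}) δ₀`. -/
noncomputable def rightPart (L : PathSpace T →L[ℝ] ℝ) (s : ℝ)
    (F : Icc (-T) (0 : ℝ) → ℝ) : ℝ :=
  ∫ᵛ x in {x : Icc (-T) (0 : ℝ) | -s < (x : ℝ)}, F x
    ∂<•(dualMeasure L - VectorMeasure.dirac zeroPt (deltaPart L))

/-- Bounded pointwise convergence passes through a bounded functional, the limit being the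
integral of the (discontinuous) limit against the representing measure. -/
lemma tendsto_apply_of_bounded (L : PathSpace T →L[ℝ] ℝ) {F : ℕ → PathSpace T}
    {f : Icc (-T) (0 : ℝ) → ℝ} (C : ℝ) (hF : ∀ n x, |F n x| ≤ C)
    (h : ∀ x, Tendsto (fun n => F n x) atTop (𝓝 (f x))) :
    Tendsto (fun n => L (F n)) atTop (𝓝 (∫ᵛ x, f x ∂<•(dualMeasure L))) := by
  simp only [dualMeasure_spec]
  refine VectorMeasure.tendsto_integral_filter_of_norm_le_const (.of_forall fun n => ?_)
    ⟨C, .of_forall fun n => .of_forall fun x => hF n x⟩ (.of_forall h)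
  exact (F n).continuous.aestronglyMeasurable

lemma tendsto_apply_zero (L : PathSpace T →L[ℝ] ℝ) {F : ℕ → PathSpace T}
    (C : ℝ) (hF : ∀ n x, |F n x| ≤ C) (h : ∀ x, Tendsto (fun n => F n x) atTop (𝓝 0)) :
    Tendsto (fun n => L (F n)) atTop (𝓝 0) := by
  have := tendsto_apply_of_bounded L C hF h
  simpa using this

/-- The hat function `x ↦ max 0 (1 + n x)`, which decreases to the indicator of `{0}`. -/
noncomputable def bump (T : ℝ) (n : ℕ) : PathSpace T :=
  ⟨fun x => max 0 (1 + n * (x : ℝ)), by fun_prop⟩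

/-- A cutoff vanishing on `[-T, -s]` and at `0`, increasing to the indicator of `]-s, 0[`. -/
noncomputable def cut (T : ℝ) (s : ℝ) (n : ℕ) : PathSpace T :=
  ⟨fun x => max 0 (min 1 (n * ((x : ℝ) + s))) * (1 - max 0 (1 + n * (x : ℝ))), by fun_prop⟩

lemma bump_mem (n : ℕ) (x : Icc (-T) (0 : ℝ)) : 0 ≤ bump T n x ∧ bump T n x ≤ 1 := by
  have hx := x.2.2
  simp only [bump, ContinuousMap.coe_mk]
  have : (n : ℝ) * x ≤ 0 := mul_nonpos_of_nonneg_of_nonpos (by positivity) hx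
  exact ⟨le_max_left _ _, max_le zero_le_one (by linarith)⟩

lemma cut_mem (s : ℝ) (n : ℕ) (x : Icc (-T) (0 : ℝ)) : 0 ≤ cut T s n x ∧ cut T s n x ≤ 1 := by
  have h := bump_mem n x
  have h1 : max 0 (min 1 ((n : ℝ) * (x + s))) ≤ 1 := max_le zero_le_one (min_le_left _ _)
  have h2 : (0 : ℝ) ≤ max 0 (min 1 ((n : ℝ) * (x + s))) := le_max_left _ _
  simp only [bump, ContinuousMap.coe_mk] at h
  simp only [cut, ContinuousMap.coe_mk]
  constructor
  · exact mul_nonneg h2 (by linarith)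
  · nlinarith

@[simp] lemma coe_zeroPt : ((zeroPt : Icc (-T) (0 : ℝ)) : ℝ) = 0 := rfl

@[simp] lemma bump_zero (n : ℕ) : bump T n zeroPt = 1 := by
  simp [bump]

@[simp] lemma cut_zero (s : ℝ) (n : ℕ) : cut T s n zeroPt = 0 := by
  simp [cut]

lemma neg_of_ne_zeroPt {x : Icc (-T) (0 : ℝ)} (h : x ≠ zeroPt) : (x : ℝ) < 0 :=
  lt_of_le_of_ne x.2.2 fun h' => h (Subtype.ext h')

lemma tendsto_bump_of_ne {x : Icc (-T) (0 : ℝ)} (hx : x ≠ zeroPt) :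
    Tendsto (fun n => bump T n x) atTop (𝓝 0) := by
  have h := neg_of_ne_zeroPt hx
  obtain ⟨N, hN⟩ := exists_nat_gt (-1 / (x : ℝ))
  refine tendsto_const_nhds.congr' ?_
  filter_upwards [eventually_ge_atTop N] with n hn
  have h1 : -1 / (x : ℝ) < n := hN.trans_le (by exact_mod_cast hn)
  rw [div_lt_iff_of_neg h] at h1
  simp only [bump, ContinuousMap.coe_mk]
  rw [max_eq_left]
  linarith

lemma tendsto_cut_of_lt {s : ℝ} {x : Icc (-T) (0 : ℝ)} (hx : x ≠ zeroPt) (hs : -s < x) :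
    Tendsto (fun n => cut T s n x) atTop (𝓝 1) := by
  have h1 : Tendsto (fun n : ℕ => max 0 (min 1 ((n : ℝ) * (x + s)))) atTop (𝓝 1) := by
    have hp : 0 < (x : ℝ) + s := by linarith
    obtain ⟨N, hN⟩ := exists_nat_gt (1 / ((x : ℝ) + s))
    refine tendsto_const_nhds.congr' ?_
    filter_upwards [eventually_ge_atTop N] with n hn
    have h1 : 1 / ((x : ℝ) + s) < n := hN.trans_le (by exact_mod_cast hn)
    rw [div_lt_iff₀ hp] at h1
    rw [min_eq_left h1.le, max_eq_right zero_le_one]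
  have h2 := (tendsto_bump_of_ne hx).const_sub 1
  simpa [cut, bump] using h1.mul h2

lemma cut_of_le {s : ℝ} {x : Icc (-T) (0 : ℝ)} (hs : (x : ℝ) ≤ -s) (n : ℕ) :
    cut T s n x = 0 := by
  have : (n : ℝ) * (x + s) ≤ 0 :=
    mul_nonpos_of_nonneg_of_nonpos (by positivity) (by linarith)
  simp only [cut, ContinuousMap.coe_mk]
  rw [max_eq_left ((min_le_right _ _).trans this), zero_mul]

lemma tendsto_bump_deltaPart (L : PathSpace T →L[ℝ] ℝ) :
    Tendsto (fun n => L (bump T n)) atTop (𝓝 (deltaPart L)) := by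
  classical
  have h := tendsto_apply_of_bounded L (F := bump T)
    (f := ({zeroPt} : Set (Icc (-T) (0 : ℝ))).indicator fun _ => 1) 1
    (fun n x => abs_le.2 ⟨by linarith [(bump_mem n x).1], (bump_mem n x).2⟩) (fun x => by
      by_cases hx : x = zeroPt
      · subst hx; simp
      · rw [indicator_of_notMem (by simpa using hx)]
        exact tendsto_bump_of_ne hx)
  rw [VectorMeasure.integral_indicator (measurableSet_singleton _),
    VectorMeasure.integral_singleton] at h
  simpa [deltaPart] using h

lemma measurableSet_right (s : ℝ) : MeasurableSet {x : Icc (-T) (0 : ℝ) | -s < (x : ℝ)} :=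
  measurableSet_lt measurable_const measurable_subtype_coe

/-- The measure `L - L({0}) δ₀` has no atom at `0`, so that convergence at `0` is not needed. -/
lemma tendsto_rightPart (L : PathSpace T →L[ℝ] ℝ) (s : ℝ) {F : ℕ → Icc (-T) (0 : ℝ) → ℝ}
    {f : Icc (-T) (0 : ℝ) → ℝ} (C : ℝ) (hFc : ∀ n, Continuous (F n)) (hF : ∀ n x, |F n x| ≤ C)
    (h : ∀ x, x ≠ zeroPt → -s < (x : ℝ) → Tendsto (fun n => F n x) atTop (𝓝 (f x))) :
    Tendsto (fun n => rightPart L s (F n)) atTop (𝓝 (rightPart L s f)) := by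
  refine VectorMeasure.tendsto_integral_filter_of_norm_le_const (.of_forall fun n => ?_)
    ⟨C, .of_forall fun n => .of_forall fun x => hF n x⟩ ?_
  · exact (hFc n).aestronglyMeasurable
  · rw [VectorMeasure.variation_restrict (measurableSet_right s),
      ae_restrict_iff' (measurableSet_right s)]
    have hz :
        (dualMeasure L - VectorMeasure.dirac zeroPt (deltaPart L)).variation {zeroPt} = 0 := by
      rw [VectorMeasure.variation_apply_eq_zero (measurableSet_singleton _)]
      intro t ht hm
      rcases subset_singleton_iff_eq.1 ht with rfl | rfl
      · simp
      · simp [deltaPart]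
    have : ∀ᵐ x ∂(dualMeasure L - VectorMeasure.dirac zeroPt (deltaPart L)).variation,
        x ≠ zeroPt := by
      rw [ae_iff]; simpa using hz
    filter_upwards [this] with x hx hs using h x hx hs

lemma rightPart_of_vanish (L : PathSpace T →L[ℝ] ℝ) (s : ℝ) (F : PathSpace T)
    (h0 : F zeroPt = 0) (hF : ∀ x : Icc (-T) (0 : ℝ), (x : ℝ) ≤ -s → F x = 0) :
    rightPart L s F = L F := by
  classical
  rw [dualMeasure_spec, rightPart, ← VectorMeasure.integral_indicator (measurableSet_right s)]
  have : {x : Icc (-T) (0 : ℝ) | -s < (x : ℝ)}.indicator F = F := by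
    ext x
    by_cases hx : -s < (x : ℝ)
    · rw [indicator_of_mem (by exact hx)]
    · rw [indicator_of_notMem (by exact hx), hF x (not_lt.1 hx)]
  rw [this, VectorMeasure.integral_sub_vectorMeasure, VectorMeasure.integral_dirac]
  · simp [h0]
  · exact integrable_of_continuous _ _
  · exact integrable_of_continuous _ _

/-- The right part is a limit of values of `L` at continuous functions vanishing at `0`. -/
lemma tendsto_cut_rightPart (L : PathSpace T →L[ℝ] ℝ) (s : ℝ) (F : PathSpace T) :
    Tendsto (fun n => L (cut T s n * F)) atTop (𝓝 (rightPart L s F)) := by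
  have h := tendsto_rightPart L s (F := fun n => ⇑(cut T s n * F)) (f := F) ‖F‖
    (fun n => (cut T s n * F).continuous) (fun n x => ?_) (fun x hx hs => ?_)
  · refine h.congr fun n => rightPart_of_vanish L s _ (by simp) fun x hx => ?_
    simp [cut_of_le hx]
  · have := cut_mem s n x
    have h2 := F.norm_coe_le_norm x
    rw [ContinuousMap.coe_mul, Pi.mul_apply, abs_mul, abs_of_nonneg this.1]
    rw [Real.norm_eq_abs] at h2
    nlinarith [abs_nonneg (F x)]
  · simpa using (tendsto_cut_of_lt hx hs).mul_const (F x)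

lemma norm_cut_mul_le (s : ℝ) (n : ℕ) (F : PathSpace T) : ‖cut T s n * F‖ ≤ ‖F‖ := by
  refine (ContinuousMap.norm_le _ (norm_nonneg _)).2 fun x => ?_
  have := cut_mem s n x
  have h2 := F.norm_coe_le_norm x
  rw [ContinuousMap.coe_mul, Pi.mul_apply, norm_mul, Real.norm_of_nonneg this.1]
  nlinarith [norm_nonneg (F x)]

lemma norm_bump_le (n : ℕ) : ‖bump T n‖ ≤ 1 :=
  (ContinuousMap.norm_le _ zero_le_one).2 fun x => by
    rw [Real.norm_of_nonneg (bump_mem n x).1]; exact (bump_mem n x).2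

lemma abs_rightPart_le (L : PathSpace T →L[ℝ] ℝ) (s : ℝ) (F : PathSpace T) :
    |rightPart L s F| ≤ ‖L‖ * ‖F‖ := by
  refine le_of_tendsto (tendsto_cut_rightPart L s F).abs (.of_forall fun n => ?_)
  refine (L.le_opNorm _).trans ?_
  gcongr
  exact norm_cut_mul_le s n F

lemma rightPart_add (L : PathSpace T →L[ℝ] ℝ) (s : ℝ) (F G : PathSpace T) :
    rightPart L s (F + G : PathSpace T) = rightPart L s F + rightPart L s G := by
  refine tendsto_nhds_unique (tendsto_cut_rightPart L s (F + G)) ?_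
  refine ((tendsto_cut_rightPart L s F).add (tendsto_cut_rightPart L s G)).congr fun n => ?_
  rw [mul_add, map_add]

lemma rightPart_smul (L : PathSpace T →L[ℝ] ℝ) (s : ℝ) (a : ℝ) (F : PathSpace T) :
    rightPart L s (a • F : PathSpace T) = a * rightPart L s F := by
  refine tendsto_nhds_unique (tendsto_cut_rightPart L s (a • F)) ?_
  refine ((tendsto_cut_rightPart L s F).const_mul a).congr fun n => ?_
  rw [mul_smul_comm, map_smul, smul_eq_mul]

lemma rightPart_sub (L : PathSpace T →L[ℝ] ℝ) (s : ℝ) (F G : PathSpace T) :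
    rightPart L s (F - G : PathSpace T) = rightPart L s F - rightPart L s G := by
  refine tendsto_nhds_unique (tendsto_cut_rightPart L s (F - G)) ?_
  refine ((tendsto_cut_rightPart L s F).sub (tendsto_cut_rightPart L s G)).congr fun n => ?_
  rw [mul_sub, map_sub]

lemma rightPart_sub_left (L M : PathSpace T →L[ℝ] ℝ) (s : ℝ) (F : PathSpace T) :
    rightPart (L - M) s F = rightPart L s F - rightPart M s F := by
  refine tendsto_nhds_unique (tendsto_cut_rightPart (L - M) s F) ?_
  exact (tendsto_cut_rightPart L s F).sub (tendsto_cut_rightPart M s F)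

lemma deltaPart_sub (L M : PathSpace T →L[ℝ] ℝ) :
    deltaPart (L - M) = deltaPart L - deltaPart M :=
  tendsto_nhds_unique (tendsto_bump_deltaPart (L - M))
    ((tendsto_bump_deltaPart L).sub (tendsto_bump_deltaPart M))

lemma abs_deltaPart_le (L : PathSpace T →L[ℝ] ℝ) : |deltaPart L| ≤ ‖L‖ := by
  refine le_of_tendsto (tendsto_bump_deltaPart L).abs (.of_forall fun n => ?_)
  refine (L.le_opNorm _).trans ?_
  exact mul_le_of_le_one_right (norm_nonneg _) (norm_bump_le n)

lemma continuous_deltaPart : Continuous (deltaPart : (PathSpace T →L[ℝ] ℝ) → ℝ) := by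
  have h : LipschitzWith 1 (deltaPart : (PathSpace T →L[ℝ] ℝ) → ℝ) :=
    LipschitzWith.of_dist_le_mul fun L M => by
      rw [Real.dist_eq, ← deltaPart_sub, dist_eq_norm, NNReal.coe_one, one_mul]
      exact abs_deltaPart_le _
  exact h.continuous

/-- A function vanishing on `[-T, -s]` is only seen by the atom at `0` and by the right part. -/
lemma apply_eq_of_vanish (L : PathSpace T →L[ℝ] ℝ) {s : ℝ} (H : PathSpace T)
    (hH : ∀ x : Icc (-T) (0 : ℝ), (x : ℝ) ≤ -s → H x = 0) :
    L H = deltaPart L * H zeroPt + rightPart L s H := by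
  have h1 := (tendsto_bump_deltaPart L).mul_const (H zeroPt)
  have h2 := tendsto_cut_rightPart L s H
  refine (tendsto_nhds_unique (h1.add h2) ?_).symm
  have h3 : Tendsto (fun n => L (H - H zeroPt • bump T n - cut T s n * H)) atTop (𝓝 0) := by
    refine tendsto_apply_zero L (‖H‖ + ‖H‖ + ‖H‖) (fun n x => ?_) fun x => ?_
    · refine ((H - H zeroPt • bump T n - cut T s n * H).norm_coe_le_norm x).trans ?_
      refine (norm_sub_le _ _).trans (add_le_add ((norm_sub_le _ _).trans ?_)
        (norm_cut_mul_le s n H))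
      gcongr
      rw [norm_smul]
      exact (mul_le_mul (H.norm_coe_le_norm _) (norm_bump_le n) (norm_nonneg _)
        (norm_nonneg _)).trans (by simp)
    · by_cases hx : x = zeroPt
      · subst hx; simp
      by_cases hxs : -s < (x : ℝ)
      · have := ((tendsto_bump_of_ne hx).const_mul (H zeroPt)).const_sub (H x) |>.sub
          ((tendsto_cut_of_lt hx hxs).mul_const (H x))
        simpa using this
      · have hc := fun n => cut_of_le (not_lt.1 hxs) n
        have := (tendsto_bump_of_ne hx).const_mul (H zeroPt)
        simpa [hc, hH x (not_lt.1 hxs)] using this.neg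
  have h4 := h3.const_sub (L H)
  rw [sub_zero] at h4
  refine h4.congr fun n => ?_
  simp only [map_sub, map_smul, smul_eq_mul]
  ring

end Dual

/-! ### The bilinear forms of `χ₀` and the seminorm they are continuous for -/

section Chi

variable {T : ℝ} [hT : Fact (0 < T)]

instance isFiniteMeasure_leb : IsFiniteMeasure (leb T) := by
  refine ⟨?_⟩
  rw [(MeasurableEmbedding.subtype_coe measurableSet_Icc).comap_apply]
  refine (measure_mono (t := Icc (-T) 0) ?_).trans_lt measure_Icc_lt_top
  rintro _ ⟨x, -, rfl⟩
  exact x.2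

lemma integral_leb (F : ℝ → ℝ) : ∫ x, F x ∂leb T = ∫ x in (-T)..0, F x := by
  have := hT.out
  rw [intervalIntegral.integral_of_le (by linarith), ← integral_Icc_eq_integral_Ioc]
  exact integral_subtype_comap measurableSet_Icc F

/-- The class of a continuous function in `L²([-T, 0])`. -/
noncomputable def toL2 : PathSpace T →L[ℝ] Lp ℝ 2 (leb T) := ContinuousMap.toLp 2 (leb T) ℝ

lemma coeFn_toL2 (f : PathSpace T) : toL2 f =ᵐ[leb T] f := ContinuousMap.coeFn_toLp _ _

lemma inner_toL2 (f : PathSpace T) (a : Lp ℝ 2 (leb T)) :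
    inner ℝ (toL2 f) a = ∫ x, a x * f x ∂leb T := by
  rw [L2.inner_def]
  refine integral_congr_ae ?_
  filter_upwards [coeFn_toL2 f] with x hx
  rw [hx]; simp

lemma norm_toL2_sq (f : PathSpace T) : ‖toL2 f‖ ^ 2 = ∫ x, f x ^ 2 ∂leb T := by
  rw [← real_inner_self_eq_norm_sq, inner_toL2]
  refine integral_congr_ae ?_
  filter_upwards [coeFn_toL2 f] with x hx
  rw [hx, sq]

lemma norm_toL2_sq_eq (f : PathSpace T) (F : ℝ → ℝ) (h : ∀ x, f x = F x) :
    ‖toL2 f‖ ^ 2 = ∫ x in (-T)..0, F x ^ 2 := by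
  rw [norm_toL2_sq, ← integral_leb fun x => F x ^ 2]
  simp [h]

/-- The seminorm `|f(0)| + ‖f‖_{L²}` on `C([-T, 0])`: elements of `χ₀` are bilinear forms bounded
for it. -/
noncomputable def hilbertNorm (f : PathSpace T) : ℝ := |f zeroPt| + ‖toL2 f‖

lemma hilbertNorm_nonneg (f : PathSpace T) : 0 ≤ hilbertNorm f := by
  unfold hilbertNorm; positivity

lemma hilbertNorm_smul (a : ℝ) (f : PathSpace T) : hilbertNorm (a • f) = |a| * hilbertNorm f := by
  unfold hilbertNorm
  rw [map_smul, ContinuousMap.smul_apply, smul_eq_mul, abs_mul, norm_smul, Real.norm_eq_abs]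
  ring

lemma continuous_hilbertNorm : Continuous (hilbertNorm : PathSpace T → ℝ) := by
  unfold hilbertNorm
  have h := (toL2 (T := T)).continuous
  have h2 : Continuous fun f : PathSpace T => f zeroPt := continuous_eval_const _
  fun_prop

lemma norm_toL2_le (f : PathSpace T) : ‖toL2 f‖ ≤ hilbertNorm f := by
  unfold hilbertNorm; linarith [abs_nonneg (f zeroPt)]

/-- The class of `(x, y) ↦ f x * g y` in `L²([-T, 0]²)`. -/
noncomputable def tensorL2 (f g : PathSpace T) : Lp ℝ 2 ((leb T).prod (leb T)) :=
  ContinuousMap.toLp 2 _ ℝ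
    (⟨fun z => f z.1 * g z.2, by fun_prop⟩ : C(Icc (-T) (0 : ℝ) × Icc (-T) (0 : ℝ), ℝ))

lemma coeFn_tensorL2 (f g : PathSpace T) :
    tensorL2 f g =ᵐ[(leb T).prod (leb T)] fun z => f z.1 * g z.2 :=
  ContinuousMap.coeFn_toLp _ _

lemma inner_tensorL2 (f g : PathSpace T) (k : Lp ℝ 2 ((leb T).prod (leb T))) :
    inner ℝ (tensorL2 f g) k = ∫ z, k z * (f z.1 * g z.2) ∂(leb T).prod (leb T) := by
  rw [L2.inner_def]
  refine integral_congr_ae ?_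
  filter_upwards [coeFn_tensorL2 f g] with x hx
  rw [hx]; simp

lemma norm_tensorL2 (f g : PathSpace T) : ‖tensorL2 f g‖ = ‖toL2 f‖ * ‖toL2 g‖ := by
  rw [← sq_eq_sq₀ (norm_nonneg _) (by positivity), mul_pow, norm_toL2_sq, norm_toL2_sq,
    ← real_inner_self_eq_norm_sq, inner_tensorL2, ← integral_prod_mul]
  refine integral_congr_ae ?_
  filter_upwards [coeFn_tensorL2 f g] with x hx
  rw [hx]; ring

lemma integrable_leb (f : PathSpace T) : Integrable f (leb T) :=
  f.continuous.integrable_of_hasCompactSupport (HasCompactSupport.of_compactSpace _)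

lemma integrable_leb_mul (f g : PathSpace T) : Integrable (fun x => f x * g x) (leb T) :=
  integrable_leb (f * g)

lemma integral_abs_mul_le (f g : PathSpace T) :
    ∫ x, |f x * g x| ∂leb T ≤ ‖toL2 f‖ * ‖toL2 g‖ := by
  let fa : PathSpace T := ⟨fun x => |f x|, by fun_prop⟩
  let ga : PathSpace T := ⟨fun x => |g x|, by fun_prop⟩
  have h1 : ‖toL2 fa‖ = ‖toL2 f‖ := by
    rw [← sq_eq_sq₀ (norm_nonneg _) (norm_nonneg _), norm_toL2_sq, norm_toL2_sq]
    simp [fa]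
  have h2 : ‖toL2 ga‖ = ‖toL2 g‖ := by
    rw [← sq_eq_sq₀ (norm_nonneg _) (norm_nonneg _), norm_toL2_sq, norm_toL2_sq]
    simp [ga]
  rw [← h1, ← h2]
  refine le_trans (le_of_eq ?_) (real_inner_le_norm (toL2 fa) (toL2 ga))
  rw [inner_toL2]
  refine integral_congr_ae ?_
  filter_upwards [coeFn_toL2 ga] with x hx
  rw [hx]
  simp [fa, ga, abs_mul, mul_comm]

lemma ae_abs_le_norm (g : Lp ℝ ∞ (leb T)) : ∀ᵐ x ∂leb T, |g x| ≤ ‖g‖ := by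
  have h := ae_le_eLpNormEssSup (f := g) (μ := leb T)
  have hg : eLpNormEssSup g (leb T) ≠ ∞ := by
    rw [← eLpNorm_exponent_top]; exact Lp.eLpNorm_ne_top g
  filter_upwards [h] with x hx
  have := ENNReal.toReal_mono hg hx
  rwa [toReal_enorm, Real.norm_eq_abs, ← eLpNorm_exponent_top, ← Lp.norm_def] at this

lemma integrable_linfty_mul (g : Lp ℝ ∞ (leb T)) {f : Icc (-T) (0 : ℝ) → ℝ}
    (hf : Integrable f (leb T)) : Integrable (fun x => g x * f x) (leb T) :=
  hf.bdd_mul (Lp.aestronglyMeasurable g) (ae_abs_le_norm g)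

lemma abs_integral_linfty_mul_le (g : Lp ℝ ∞ (leb T)) (f h : PathSpace T) :
    |∫ x, g x * (f x * h x) ∂leb T| ≤ ‖g‖ * (‖toL2 f‖ * ‖toL2 h‖) := by
  have hi := integrable_leb_mul f h
  refine (abs_integral_le_integral_abs).trans ?_
  refine le_trans ?_ (mul_le_mul_of_nonneg_left (integral_abs_mul_le f h) (norm_nonneg g))
  rw [← integral_const_mul]
  refine integral_mono_ae (integrable_linfty_mul g hi).abs (hi.abs.const_mul _) ?_
  filter_upwards [ae_abs_le_norm g] with x hx
  rw [abs_mul]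
  exact mul_le_mul_of_nonneg_right hx (abs_nonneg _)

/-- The bilinear form on `C([-T, 0])` defined by an element of `χ₀`. -/
noncomputable def Chi0.form (c : Chi0 T) (f g : PathSpace T) : ℝ :=
  Chi0.pair c fun x y => f x * g y

lemma form_eq (c : Chi0 T) (f g : PathSpace T) :
    c.form f g = c.1 * (f zeroPt * g zeroPt) + inner ℝ (toL2 f) c.2.1 * g zeroPt +
      f zeroPt * inner ℝ (toL2 g) c.2.2.1 + inner ℝ (tensorL2 f g) c.2.2.2.1 +
      ∫ x, c.2.2.2.2 x * (f x * g x) ∂leb T := by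
  rw [Chi0.form, Chi0.pair, inner_toL2, inner_toL2, inner_tensorL2, ← integral_mul_const,
    ← integral_const_mul]
  congr 4
  · congr 1
    ext x; ring
  · ext x; ring

lemma form_sub (c d : Chi0 T) (f g : PathSpace T) :
    (c - d).form f g = c.form f g - d.form f g := by
  have hi := integrable_leb_mul f g
  have h : ∫ x, (c - d).2.2.2.2 x * (f x * g x) ∂leb T =
      ∫ x, c.2.2.2.2 x * (f x * g x) ∂leb T - ∫ x, d.2.2.2.2 x * (f x * g x) ∂leb T := by
    rw [← integral_sub (integrable_linfty_mul _ hi) (integrable_linfty_mul _ hi)]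
    refine integral_congr_ae ?_
    filter_upwards [Lp.coeFn_sub c.2.2.2.2 d.2.2.2.2] with x hx
    simp only [Prod.snd_sub]
    rw [hx, Pi.sub_apply]; ring
  rw [form_eq, form_eq, form_eq, h]
  simp only [Prod.fst_sub, Prod.snd_sub, inner_sub_right]
  ring

lemma norm_components_le (c : Chi0 T) :
    |c.1| ≤ ‖c‖ ∧ ‖c.2.1‖ ≤ ‖c‖ ∧ ‖c.2.2.1‖ ≤ ‖c‖ ∧ ‖c.2.2.2.1‖ ≤ ‖c‖ ∧ ‖c.2.2.2.2‖ ≤ ‖c‖ := by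
  have h1 := norm_snd_le c
  have h2 := (norm_snd_le c.2).trans h1
  have h3 := (norm_snd_le c.2.2).trans h2
  have h4 := (norm_snd_le c.2.2.2).trans h3
  exact ⟨norm_fst_le c, (norm_fst_le c.2).trans h1, (norm_fst_le c.2.2).trans h2,
    (norm_fst_le c.2.2.2).trans h3, h4⟩

lemma abs_form_le (c : Chi0 T) (f g : PathSpace T) :
    |c.form f g| ≤ 2 * ‖c‖ * (hilbertNorm f * hilbertNorm g) := by
  obtain ⟨h1, h2, h3, h4, h5⟩ := norm_components_le c
  rw [form_eq]
  have a1 : |c.1 * (f zeroPt * g zeroPt)| ≤ ‖c‖ * (|f zeroPt| * |g zeroPt|) := by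
    rw [abs_mul, abs_mul]; gcongr
  have a2 : |inner ℝ (toL2 f) c.2.1 * g zeroPt| ≤ ‖c‖ * (‖toL2 f‖ * |g zeroPt|) := by
    rw [abs_mul]
    have := (abs_real_inner_le_norm (toL2 f) c.2.1).trans
      (mul_le_mul_of_nonneg_left h2 (norm_nonneg _))
    nlinarith [abs_nonneg (g zeroPt)]
  have a3 : |f zeroPt * inner ℝ (toL2 g) c.2.2.1| ≤ ‖c‖ * (|f zeroPt| * ‖toL2 g‖) := by
    rw [abs_mul]
    have := (abs_real_inner_le_norm (toL2 g) c.2.2.1).trans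
      (mul_le_mul_of_nonneg_left h3 (norm_nonneg _))
    nlinarith [abs_nonneg (f zeroPt)]
  have a4 : |inner ℝ (tensorL2 f g) c.2.2.2.1| ≤ ‖c‖ * (‖toL2 f‖ * ‖toL2 g‖) := by
    have := (abs_real_inner_le_norm (tensorL2 f g) c.2.2.2.1).trans
      (mul_le_mul_of_nonneg_left h4 (norm_nonneg _))
    rw [norm_tensorL2] at this
    linarith
  have a5 := (abs_integral_linfty_mul_le c.2.2.2.2 f g).trans
    (mul_le_mul_of_nonneg_right h5 (by positivity))
  refine (abs_add_le _ _).trans (le_trans (add_le_add ((abs_add_le _ _).trans (add_le_add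
    ((abs_add_le _ _).trans (add_le_add
      ((abs_add_le _ _).trans (add_le_add a1 a2)) a3)) a4)) a5) ?_)
  unfold hilbertNorm
  have : 0 ≤ ‖c‖ * (|f zeroPt| * |g zeroPt| + ‖toL2 f‖ * |g zeroPt| + |f zeroPt| * ‖toL2 g‖) := by
    positivity
  nlinarith

lemma form_add_left (c : Chi0 T) (f f' g : PathSpace T) :
    c.form (f + f') g = c.form f g + c.form f' g := by
  have ht : tensorL2 (f + f') g = tensorL2 f g + tensorL2 f' g := by
    rw [tensorL2, tensorL2, tensorL2, ← map_add]
    congr 1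
    ext z
    simp [add_mul]
  have hi : ∫ x, c.2.2.2.2 x * ((f + f') x * g x) ∂leb T = ∫ x, c.2.2.2.2 x * (f x * g x) ∂leb T
      + ∫ x, c.2.2.2.2 x * (f' x * g x) ∂leb T := by
    rw [← integral_add (integrable_linfty_mul _ (integrable_leb_mul f g))
      (integrable_linfty_mul _ (integrable_leb_mul f' g))]
    refine integral_congr_ae (.of_forall fun x => ?_)
    simp only [ContinuousMap.add_apply]; ring
  rw [form_eq, form_eq, form_eq, hi, ht, map_add, inner_add_left, inner_add_left]
  simp only [ContinuousMap.add_apply]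
  ring

lemma form_add_right (c : Chi0 T) (f g g' : PathSpace T) :
    c.form f (g + g') = c.form f g + c.form f g' := by
  have ht : tensorL2 f (g + g') = tensorL2 f g + tensorL2 f g' := by
    rw [tensorL2, tensorL2, tensorL2, ← map_add]
    congr 1
    ext z
    simp [mul_add]
  have hi : ∫ x, c.2.2.2.2 x * (f x * (g + g') x) ∂leb T = ∫ x, c.2.2.2.2 x * (f x * g x) ∂leb T
      + ∫ x, c.2.2.2.2 x * (f x * g' x) ∂leb T := by
    rw [← integral_add (integrable_linfty_mul _ (integrable_leb_mul f g))
      (integrable_linfty_mul _ (integrable_leb_mul f g'))]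
    refine integral_congr_ae (.of_forall fun x => ?_)
    simp only [ContinuousMap.add_apply]; ring
  rw [form_eq, form_eq, form_eq, hi, ht, map_add, inner_add_left, inner_add_left]
  simp only [ContinuousMap.add_apply]
  ring

lemma hilbertNorm_zero : hilbertNorm (0 : PathSpace T) = 0 := by
  simp [hilbertNorm]

lemma form_self_sub_le (c : Chi0 T) (f g : PathSpace T) :
    |c.form f f - c.form g g| ≤
      2 * ‖c‖ * (hilbertNorm (f - g) * (hilbertNorm f + hilbertNorm g)) := by
  have e : c.form f f - c.form g g = c.form f (f - g) + c.form (f - g) g := by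
    have h1 := form_add_right c f (f - g) g
    have h2 := form_add_left c (f - g) g g
    rw [sub_add_cancel] at h1 h2
    linarith
  rw [e]
  refine (abs_add_le _ _).trans ((add_le_add (abs_form_le _ _ _) (abs_form_le _ _ _)).trans
    (le_of_eq ?_))
  ring

lemma ContinuousOn.form_self {A : Set ℝ} {c : ℝ → Chi0 T} {f : ℝ → PathSpace T}
    (hc : ContinuousOn c A) (hf : ContinuousOn f A) :
    ContinuousOn (fun s => (c s).form (f s) (f s)) A := by
  intro s hs
  have h0 : Tendsto (fun r => 2 * ‖c r - c s‖ * (hilbertNorm (f r) * hilbertNorm (f r)) +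
      2 * ‖c s‖ * (hilbertNorm (f r - f s) * (hilbertNorm (f r) + hilbertNorm (f s))))
      (𝓝[A] s) (𝓝 (2 * 0 * (hilbertNorm (f s) * hilbertNorm (f s)) +
      2 * ‖c s‖ * (0 * (hilbertNorm (f s) + hilbertNorm (f s))))) := by
    have h1 : Tendsto (fun r => ‖c r - c s‖) (𝓝[A] s) (𝓝 0) :=
      tendsto_iff_norm_sub_tendsto_zero.1 (hc s hs)
    have h2 : Tendsto (fun r => hilbertNorm (f r)) (𝓝[A] s) (𝓝 (hilbertNorm (f s))) :=
      (continuous_hilbertNorm.tendsto _).comp (hf s hs)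
    have h3 : Tendsto (fun r => hilbertNorm (f r - f s)) (𝓝[A] s) (𝓝 0) := by
      have := (continuous_hilbertNorm.tendsto (f s - f s)).comp
        (((hf s hs).tendsto).sub_const (f s))
      rwa [sub_self, hilbertNorm_zero] at this
    exact ((h1.const_mul 2).mul (h2.mul h2)).add ((h3.mul (h2.add_const _)).const_mul _)
  simp only [mul_zero, zero_mul, add_zero] at h0
  refine tendsto_iff_norm_sub_tendsto_zero.2 (squeeze_zero (fun _ => norm_nonneg _)
    (fun r => ?_) h0)
  rw [Real.norm_eq_abs]
  have e : (c r).form (f r) (f r) - (c s).form (f s) (f s) =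
    (c r - c s).form (f r) (f r) + ((c s).form (f r) (f r) - (c s).form (f s) (f s)) := by
    rw [form_sub]; ring
  rw [e]
  exact (abs_add_le _ _).trans (add_le_add (abs_form_le _ _ _) (form_self_sub_le _ _ _))

end Chi

/-! ### Paths of finite quadratic variation and their windows -/

section Paths

variable {T : ℝ} [hT : Fact (0 < T)]

lemma continuous_extend (η : PathSpace T) : Continuous (extend η) := η.continuous.Icc_extend'

lemma extend_coe (η : PathSpace T) (x : Icc (-T) (0 : ℝ)) : extend η x = η x := IccExtend_val _ _ x

lemma extend_of_nonneg (η : PathSpace T) {x : ℝ} (hx : 0 ≤ x) : extend η x = η zeroPt :=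
  IccExtend_of_right_le _ _ hx

lemma extend_add (η φ : PathSpace T) (x : ℝ) :
    extend (η + φ) x = extend η x + extend φ x := rfl

lemma extend_smul (a : ℝ) (φ : PathSpace T) (x : ℝ) :
    extend (a • φ) x = a * extend φ x := rfl

lemma abs_extend_le (η : PathSpace T) (x : ℝ) : |extend η x| ≤ ‖η‖ := η.norm_coe_le_norm _

/-- The increment `x ↦ η(x + ε) - η(x)` of the extended function. -/
noncomputable def extIncr (ε : ℝ) (η : PathSpace T) : PathSpace T :=
  ⟨fun x => extend η (x + ε) - extend η x, by have := continuous_extend η; fun_prop⟩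

lemma extIncr_apply (ε : ℝ) (η : PathSpace T) (x : Icc (-T) (0 : ℝ)) :
    extIncr ε η x = extend η (x + ε) - η x := by
  rw [← extend_coe η x]; rfl

lemma extIncr_add (ε : ℝ) (η φ : PathSpace T) :
    extIncr ε (η + φ) = extIncr ε η + extIncr ε φ := by
  ext x
  simp only [extIncr, ContinuousMap.coe_mk, ContinuousMap.add_apply, extend_add]; ring

lemma extIncr_smul (ε a : ℝ) (φ : PathSpace T) :
    extIncr ε (a • φ) = a • extIncr ε φ := by
  ext x
  simp only [extIncr, ContinuousMap.coe_mk, ContinuousMap.smul_apply, extend_smul, smul_eq_mul]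
  ring

lemma norm_extIncr_le (ε : ℝ) (φ : PathSpace T) : ‖extIncr ε φ‖ ≤ 2 * ‖φ‖ := by
  refine (ContinuousMap.norm_le _ (by positivity)).2 fun x => ?_
  have h1 := abs_extend_le φ (x + ε)
  have h2 := abs_extend_le φ x
  simp only [extIncr, ContinuousMap.coe_mk, Real.norm_eq_abs]
  exact (abs_sub _ _).trans (by linarith)

lemma continuous_extIncr (ε : ℝ) : Continuous (extIncr ε : PathSpace T → PathSpace T) := by
  have h : LipschitzWith 2 (extIncr ε : PathSpace T → PathSpace T) :=
    LipschitzWith.of_dist_le_mul fun η φ => by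
      have e : extIncr ε η - extIncr ε φ = extIncr ε (η - φ) := by
        rw [sub_eq_add_neg, sub_eq_add_neg, extIncr_add, ← neg_one_smul ℝ φ, extIncr_smul,
          neg_one_smul]
      rw [dist_eq_norm, dist_eq_norm, e]
      exact norm_extIncr_le _ _
  exact h.continuous

/-- The approximate forward integral in terms of the right part of the derivative. -/
lemma detForwardApprox_eq (u : ℝ → PathSpace T → ℝ) (t : ℝ) (η : PathSpace T) (ε : ℝ) :
    detForwardApprox (gradPerp u t η) t η ε =
      ε⁻¹ * rightPart (fderiv ℝ (u t) η) t (extIncr ε η) := by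
  rw [← rightPart_smul]
  unfold detForwardApprox rightPart
  congr 1
  ext x
  simp [extIncr, div_eq_inv_mul]

/-- The window `x ↦ g (s + x)` of a function on the line. -/
noncomputable def windowOf (T : ℝ) (g : C(ℝ, ℝ)) (s : ℝ) : PathSpace T :=
  ⟨fun x => g (s + x), by fun_prop⟩

/-- The prolonged path as a continuous function on the line. -/
noncomputable def prolongC (γ : C(Icc (0 : ℝ) T, ℝ)) : C(ℝ, ℝ) :=
  ⟨prolong γ, γ.continuous.Icc_extend'⟩

lemma windowOf_apply (g : C(ℝ, ℝ)) (s : ℝ) (x : Icc (-T) (0 : ℝ)) :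
    windowOf T g s x = g (s + x) := rfl

lemma continuous_windowOf (g : C(ℝ, ℝ)) : Continuous (windowOf T g) := by
  refine ContinuousMap.continuous_of_continuous_uncurry _ ?_
  change Continuous fun p : ℝ × Icc (-T) (0 : ℝ) => g (p.1 + p.2)
  fun_prop

lemma extend_windowOf (g : C(ℝ, ℝ)) (s : ℝ) {x : ℝ} (hx : -T ≤ x) :
    extend (windowOf T g s) x = g (s + min x 0) := by
  rcases le_total x 0 with h | h
  · rw [min_eq_left h]
    exact extend_coe _ ⟨x, hx, h⟩
  · rw [min_eq_right h, extend_of_nonneg _ h]; rfl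

/-- A continuous function on the line, constant before `0` and after `T`, whose quadratic
variation at `t ∈ [0, T]` is `σ² t`. -/
structure HasQV (T σ : ℝ) (g : C(ℝ, ℝ)) : Prop where
  left : ∀ y ≤ 0, g y = g 0
  right : ∀ y, T ≤ y → g y = g T
  qv : ∀ t ∈ Icc 0 T, Tendsto
      (fun ε : ℝ => ∫ s in (0 : ℝ)..t, (g (s + ε) - g s) ^ 2 / ε) (𝓝[>] 0) (𝓝 (σ ^ 2 * t))

/-- A modulus of continuity at scale `2 ε`, together with a bound. -/
lemma HasQV.exists_modulus {σ : ℝ} {g : C(ℝ, ℝ)} (hg : HasQV T σ g) :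
    ∃ B : ℝ, ∃ w : ℝ → ℝ, 0 ≤ B ∧ (∀ y, |g y| ≤ B) ∧ Tendsto w (𝓝[>] 0) (𝓝 0) ∧
      (∀ ε, 0 ≤ w ε) ∧ (∀ ε, w ε ≤ 2 * B) ∧
      ∀ ε > 0, ∀ a b, |a - b| ≤ 2 * ε → |g a - g b| ≤ w ε := by
  have hT' := hT.out
  have hgi : ∀ y, g y = IccExtend hT'.le (fun x : Icc (0 : ℝ) T => g x) y := fun y => by
    rcases le_total y 0 with h | h
    · rw [IccExtend_of_le_left _ _ h, hg.left y h]
    · rcases le_total T y with h' | h'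
      · rw [IccExtend_of_right_le _ _ h', hg.right y h']
      · rw [IccExtend_of_mem _ _ ⟨h, h'⟩]
  let γ : C(Icc (0 : ℝ) T, ℝ) := ⟨fun x => g x, by fun_prop⟩
  have hB : ∀ y, |g y| ≤ ‖γ‖ := fun y => by rw [hgi]; exact γ.norm_coe_le_norm _
  have hu : UniformContinuous g := by
    have : (g : ℝ → ℝ) = γ ∘ projIcc 0 T hT'.le := funext hgi
    rw [this]
    exact (CompactSpace.uniformContinuous_of_continuous γ.continuous).comp
      (LipschitzWith.projIcc hT'.le).uniformContinuous
  let A : ℝ → Set ℝ := fun ε => {r | ∃ a b, |a - b| ≤ 2 * ε ∧ |g a - g b| = r}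
  have hA2 : ∀ ε, ∀ r ∈ A ε, r ≤ 2 * ‖γ‖ := by
    rintro ε r ⟨a, b, -, rfl⟩
    exact (abs_sub _ _).trans (by linarith [hB a, hB b])
  have hA0 : ∀ ε, ∀ r ∈ A ε, 0 ≤ r := by
    rintro ε r ⟨a, b, -, rfl⟩
    exact abs_nonneg _
  refine ⟨‖γ‖, fun ε => sSup (A ε), norm_nonneg _, hB, ?_, fun ε => Real.sSup_nonneg (hA0 ε),
    fun ε => Real.sSup_le (hA2 ε) (by positivity), fun ε _ a b hab =>
      le_csSup ⟨2 * ‖γ‖, fun r hr => hA2 ε r hr⟩ ⟨a, b, hab, rfl⟩⟩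
  rw [Metric.tendsto_nhds]
  intro κ hκ
  obtain ⟨δ, hδ, h⟩ := Metric.uniformContinuous_iff.1 hu (κ / 2) (by positivity)
  have h1 : ∀ᶠ ε : ℝ in 𝓝[>] 0, ε < δ / 2 :=
    (eventually_lt_nhds (by positivity)).filter_mono nhdsWithin_le_nhds
  filter_upwards [h1] with ε hε
  rw [Real.dist_eq, sub_zero, abs_of_nonneg (Real.sSup_nonneg (hA0 ε))]
  refine lt_of_le_of_lt (Real.sSup_le ?_ (by positivity)) (half_lt_self hκ)
  rintro r ⟨a, b, hab, rfl⟩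
  refine le_of_lt ?_
  have := h (a := a) (b := b) (by rw [Real.dist_eq]; linarith)
  rwa [Real.dist_eq] at this

lemma uniformContinuous_extend (η : PathSpace T) : UniformContinuous (extend η) :=
  (CompactSpace.uniformContinuous_of_continuous η.continuous).comp
    (LipschitzWith.projIcc (a := -T) (b := 0) (by have := hT.out; linarith)).uniformContinuous

lemma abs_extend_sub_le {φ : PathSpace T} {K : ℝ} (hφ : ∀ x y, |φ x - φ y| ≤ K * |(x : ℝ) - y|)
    (hK : 0 ≤ K) (a b : ℝ) : |extend φ a - extend φ b| ≤ K * |a - b| := by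
  have h := (LipschitzWith.projIcc (a := -T) (b := 0)
    (by have := hT.out; linarith)).dist_le_mul a b
  rw [Subtype.dist_eq, Real.dist_eq, Real.dist_eq, NNReal.coe_one, one_mul] at h
  exact (hφ _ _).trans (mul_le_mul_of_nonneg_left h hK)

/-- Lipschitz perturbations do not change the quadratic variation. -/
lemma add_mem_qvSpace {ψ : ℝ → ℝ} {t : ℝ} {η φ : PathSpace T} (hη : η ∈ qvSpace T ψ t) {K : ℝ}
    (hK : 0 ≤ K) (hφ : ∀ x y, |φ x - φ y| ≤ K * |(x : ℝ) - y|) : η + φ ∈ qvSpace T ψ t := by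
  intro x hx
  have h := hη x hx
  have hc1 := continuous_extend η
  have hc2 := continuous_extend φ
  refine (tendsto_iff_of_dist ?_).1 h
  rw [Metric.tendsto_nhds]
  intro κ hκ
  have hx0 : 0 ≤ -x := by linarith [hx.2]
  set M := (2 * K + K ^ 2) * (-x) + 1 with hM
  have hMpos : 0 < M := by positivity
  obtain ⟨δ, hδ, hδ'⟩ := Metric.uniformContinuous_iff.1 (uniformContinuous_extend η)
    (κ / (2 * M)) (by positivity)
  have h1 : ∀ᶠ ε : ℝ in 𝓝[>] 0, ε < min δ (κ / (2 * M)) :=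
    (eventually_lt_nhds (by positivity)).filter_mono nhdsWithin_le_nhds
  filter_upwards [h1, self_mem_nhdsWithin] with ε hε hε0
  have hε0 : 0 < ε := hε0
  have e : ∫ r in (0 : ℝ)..x, (extend η (r + ε) - extend η r) ^ 2 / ε =
      (∫ r in (0 : ℝ)..x, (extend (η + φ) (r + ε) - extend (η + φ) r) ^ 2 / ε) -
      ∫ r in (0 : ℝ)..x, ((extend (η + φ) (r + ε) - extend (η + φ) r) ^ 2 / ε -
        (extend η (r + ε) - extend η r) ^ 2 / ε) := by
    rw [intervalIntegral.integral_sub]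
    · ring
    · simp only [extend_add]
      exact Continuous.intervalIntegrable (by fun_prop) _ _
    · exact Continuous.intervalIntegrable (by fun_prop) _ _
  rw [Real.dist_eq, sub_zero, abs_of_nonneg dist_nonneg, e, Real.dist_eq, sub_right_comm, sub_self,
    zero_sub, abs_neg]
  have hb : ∀ r ∈ uIoc 0 x, ‖(extend (η + φ) (r + ε) - extend (η + φ) r) ^ 2 / ε -
        (extend η (r + ε) - extend η r) ^ 2 / ε‖ ≤ (2 * K + K ^ 2) * (κ / (2 * M)) := by
    intro r _
    have d1 : |extend η (r + ε) - extend η r| ≤ κ / (2 * M) := by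
      have := hδ' (a := r + ε) (b := r) (by
        rw [Real.dist_eq, add_sub_cancel_left, abs_of_pos hε0]
        exact hε.trans_le (min_le_left _ _))
      rw [Real.dist_eq] at this
      exact this.le
    have d2 : |extend φ (r + ε) - extend φ r| ≤ K * ε := by
      have := abs_extend_sub_le hφ hK (r + ε) r
      rwa [add_sub_cancel_left, abs_of_pos hε0] at this
    have d3 : ε ≤ κ / (2 * M) := hε.le.trans (min_le_right _ _)
    simp only [extend_add]
    set a := extend η (r + ε) - extend η r
    set b := extend φ (r + ε) - extend φ r
    have e2 : (extend η (r + ε) + extend φ (r + ε) - (extend η r + extend φ r)) ^ 2 / ε - a ^ 2 / ε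
        = 2 * a * (b / ε) + b * (b / ε) := by
      have : extend η (r + ε) + extend φ (r + ε) - (extend η r + extend φ r) = a + b := by
        simp only [a, b]; ring
      rw [this]; ring
    have d4 : |b / ε| ≤ K := by
      rw [abs_div, abs_of_pos hε0, div_le_iff₀ hε0]; exact d2
    rw [e2, Real.norm_eq_abs]
    calc |2 * a * (b / ε) + b * (b / ε)| ≤ |2 * a * (b / ε)| + |b * (b / ε)| := abs_add_le _ _
      _ = 2 * (|a| * |b / ε|) + |b| * |b / ε| := by
        rw [abs_mul, abs_mul, abs_mul, abs_two]; ring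
      _ ≤ 2 * (κ / (2 * M) * K) + K * (κ / (2 * M)) * K := by
        have : |b| ≤ K * (κ / (2 * M)) := d2.trans (by gcongr)
        gcongr
      _ = (2 * K + K ^ 2) * (κ / (2 * M)) := by ring
  have := intervalIntegral.norm_integral_le_of_norm_le_const hb
  rw [Real.norm_eq_abs, sub_zero, abs_of_nonpos hx.2] at this
  refine this.trans_lt ?_
  have h3 : (2 * K + K ^ 2) * (κ / (2 * M)) * -x = (M - 1) * (κ / (2 * M)) := by rw [hM]; ring
  have h4 : M * (κ / (2 * M)) = κ / 2 := by field_simp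
  have h5 : 0 < κ / (2 * M) := by positivity
  rw [h3, sub_mul, h4]
  linarith

/-- An integral over `[a, s]` of a function vanishing before `s - ε` is small. -/
lemma abs_integral_le_of_vanish {D : ℝ → ℝ} {a s ε M : ℝ} (has : a ≤ s) (hε : 0 ≤ ε)
    (hM : 0 ≤ M) (hD : ∀ r ≤ s - ε, D r = 0) (hb : ∀ r, |D r| ≤ M) (hc : Continuous D) :
    |∫ r in a..s, D r| ≤ M * ε := by
  have e : ∫ r in a..s, D r = ∫ r in (max a (s - ε))..s, D r := by
    rw [← intervalIntegral.integral_add_adjacent_intervals (b := max a (s - ε))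
      (hc.intervalIntegrable _ _) (hc.intervalIntegrable _ _)]
    rw [add_eq_right]
    rcases le_total a (s - ε) with h | h
    · rw [max_eq_right h, intervalIntegral.integral_congr (g := fun _ => 0),
        intervalIntegral.integral_zero]
      intro r hr
      rw [uIcc_of_le h] at hr
      exact hD r hr.2
    · rw [max_eq_left h, intervalIntegral.integral_same]
  rw [e]
  have := intervalIntegral.norm_integral_le_of_norm_le_const (f := D) (C := M)
    (a := max a (s - ε)) (b := s) fun r _ => hb r
  rw [Real.norm_eq_abs] at this
  refine this.trans (mul_le_mul_of_nonneg_left ?_ hM)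
  rw [abs_of_nonneg (by rw [sub_nonneg]; exact max_le has (by linarith))]
  linarith [le_max_right a (s - ε)]

/-- Windows of a path of quadratic variation `σ² t` belong to `V_{2,ψ}`. -/
lemma HasQV.windowOf_mem {σ : ℝ} {g : C(ℝ, ℝ)} (hg : HasQV T σ g) {s : ℝ} (hs : s ∈ Icc 0 T) :
    windowOf T g s ∈ qvSpace T (fun t => σ ^ 2 * t) s := by
  intro x hx
  obtain ⟨B, w, hB, hgB, hw, hw0, -, hwm⟩ := hg.exists_modulus
  have hgc := g.continuous
  have hsx : s + x ∈ Icc 0 T := ⟨by linarith [hx.1], by linarith [hx.2, hs.2]⟩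
  have h1 := (hg.qv _ hsx).sub (hg.qv s hs)
  have h2 : Tendsto (fun ε => w ε ^ 2 + w ε ^ 2) (𝓝[>] 0) (𝓝 0) := by
    simpa using (hw.pow 2).add (hw.pow 2)
  have e0 : σ ^ 2 * (s + x) - σ ^ 2 * s = σ ^ 2 * x := by ring
  rw [e0] at h1
  refine (tendsto_iff_of_dist ?_).1 h1
  refine squeeze_zero' (.of_forall fun _ => dist_nonneg) ?_ h2
  filter_upwards [self_mem_nhdsWithin] with ε hε
  have hε : 0 < ε := hε
  have i1 : ∀ a b, IntervalIntegrable (fun r => (g (r + ε) - g r) ^ 2 / ε) volume a b :=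
    fun a b => Continuous.intervalIntegrable (by fun_prop) _ _
  let D : ℝ → ℝ := fun r => (g (min (r + ε) s) - g r) ^ 2 / ε
  have hD : Continuous D := by fun_prop
  have e1 : ∫ r in (0 : ℝ)..x, (extend (windowOf T g s) (r + ε) - extend (windowOf T g s) r) ^ 2 / ε
      = ∫ r in s..(s + x), D r := by
    have h3 := intervalIntegral.integral_comp_add_left (fun r => D r) (a := 0) (b := x) s
    rw [add_zero] at h3
    rw [← h3]
    refine intervalIntegral.integral_congr fun r hr => ?_
    rw [uIcc_of_ge hx.2] at hr
    have hrT : -T ≤ r := by linarith [hx.1, hr.1, hs.2]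
    simp only [D]
    rw [extend_windowOf g s hrT, extend_windowOf g s (by linarith), min_eq_left hr.2]
    congr 4
    rw [← min_add_add_left]; congr 1 <;> ring
  rw [e1, intervalIntegral.integral_interval_sub_left (i1 _ _) (i1 _ _), Real.dist_eq,
    ← intervalIntegral.integral_sub (i1 _ _) (hD.intervalIntegrable _ _),
    intervalIntegral.integral_symm, abs_neg]
  have hwε := hw0 ε
  have h4 := abs_integral_le_of_vanish (D := fun r => (g (r + ε) - g r) ^ 2 / ε - D (min r s))
    (a := s + x) (s := s) (ε := ε) (M := (w ε ^ 2 + w ε ^ 2) / ε) (by linarith [hx.2]) hε.le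
    (by positivity) (fun r hr => ?_) (fun r => ?_) (by fun_prop)
  · rw [div_mul_cancel₀ _ hε.ne'] at h4
    refine le_trans (le_of_eq ?_) h4
    congr 1
    refine intervalIntegral.integral_congr fun r hr => ?_
    rw [uIcc_of_le (by linarith [hx.2])] at hr
    simp only [min_eq_left hr.2]
  · simp only [D]
    rw [min_eq_left (by linarith : r ≤ s), min_eq_left (by linarith : r + ε ≤ s), sub_self]
  · have b1 : |(g (r + ε) - g r) ^ 2 / ε| ≤ w ε ^ 2 / ε := by
      rw [abs_of_nonneg (by positivity), ← sq_abs]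
      gcongr
      exact hwm ε hε _ _ (by rw [add_sub_cancel_left, abs_of_pos hε]; linarith)
    have b2 : |D (min r s)| ≤ w ε ^ 2 / ε := by
      simp only [D]
      rw [abs_of_nonneg (by positivity), ← sq_abs]
      gcongr
      refine hwm ε hε _ _ ?_
      rw [abs_of_nonneg]
      · linarith [min_le_left (min r s + ε) s]
      · rw [sub_nonneg]
        exact le_min (by linarith) (min_le_right _ _)
    refine (abs_sub _ _).trans ((add_le_add b1 b2).trans (le_of_eq ?_))
    rw [add_div]

lemma hasQV_prolongC {σ : ℝ} {γ : C(Icc (0 : ℝ) T, ℝ)}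
    (h : ∀ t ∈ Icc 0 T, Tendsto
      (fun ε : ℝ => ∫ s in (0 : ℝ)..t, (prolong γ (s + ε) - prolong γ s) ^ 2 / ε)
      (𝓝[>] 0) (𝓝 (σ ^ 2 * t))) : HasQV T σ (prolongC γ) where
  left y hy := by
    change prolong γ y = prolong γ 0
    unfold prolong
    rw [IccExtend_of_le_left _ _ hy, IccExtend_left]
  right y hy := by
    change prolong γ y = prolong γ T
    unfold prolong
    rw [IccExtend_of_right_le _ _ hy, IccExtend_right]
  qv := h

/-- Lipschitz functions are dense among the continuous functions on a compact interval. -/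
lemma exists_lipschitz_near {a b : ℝ} (f : C(Icc a b, ℝ)) {δ : ℝ} (hδ : 0 < δ) :
    ∃ p : C(Icc a b, ℝ), ∃ K : ℝ, 0 ≤ K ∧ (∀ x y, |p x - p y| ≤ K * |(x : ℝ) - y|) ∧
      ‖p - f‖ < δ := by
  obtain ⟨p, hp⟩ := exists_polynomial_near_continuousMap a b f δ hδ
  obtain ⟨K, hK⟩ := LocallyLipschitzOn.exists_lipschitzOnWith_of_compact (s := Icc a b)
    isCompact_Icc ((p.contDiff_aeval 1).locallyLipschitz.locallyLipschitzOn)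
  refine ⟨_, K, K.2, fun x y => ?_, hp⟩
  have := hK.dist_le_mul x x.2 y y.2
  rw [Real.dist_eq, Real.dist_eq, Polynomial.coe_aeval_eq_eval] at this
  exact this

/-- If `V_{2,ψ}` on `[-t, 0]` is not empty, it is dense. -/
lemma exists_mem_qvSpace_near {ψ : ℝ → ℝ} {t : ℝ} {η : PathSpace T} (hη : η ∈ qvSpace T ψ t)
    (ζ : PathSpace T) {δ : ℝ} (hδ : 0 < δ) : ∃ ζ' ∈ qvSpace T ψ t, ‖ζ' - ζ‖ < δ := by
  obtain ⟨p, K, hK, hp, h⟩ := exists_lipschitz_near (ζ - η) hδ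
  refine ⟨η + p, add_mem_qvSpace hη hK hp, ?_⟩
  rwa [show η + p - ζ = p - (ζ - η) by abel]

/-- A path is a uniform limit of Lipschitz functions on the line. -/
lemma HasQV.exists_lipschitz_near {σ : ℝ} {g : C(ℝ, ℝ)} (hg : HasQV T σ g) {δ : ℝ} (hδ : 0 < δ) :
    ∃ p : C(ℝ, ℝ), ∃ K : ℝ, 0 ≤ K ∧ (∀ x y, |p x - p y| ≤ K * |x - y|) ∧
      ∀ y, |p y - g y| ≤ δ := by
  have hT' := hT.out
  let γ : C(Icc (0 : ℝ) T, ℝ) := ⟨fun x => g x, by fun_prop⟩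
  obtain ⟨p, K, hK, hp, h⟩ := WindowCalculus.exists_lipschitz_near γ hδ
  refine ⟨⟨IccExtend hT'.le p, p.continuous.Icc_extend'⟩, K, hK, fun x y => ?_, fun y => ?_⟩
  · have h := (LipschitzWith.projIcc hT'.le).dist_le_mul x y
    rw [Subtype.dist_eq, Real.dist_eq, Real.dist_eq, NNReal.coe_one, one_mul] at h
    exact (hp _ _).trans (mul_le_mul_of_nonneg_left h hK)
  · have hgi : g y = g (projIcc 0 T hT'.le y) := by
      rcases le_total y 0 with h | h
      · rw [projIcc_of_le_left _ h, hg.left y h]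
      · rcases le_total T y with h' | h'
        · rw [projIcc_of_right_le _ h', hg.right y h']
        · rw [projIcc_of_mem _ ⟨h, h'⟩]
    have := ((p - γ).norm_coe_le_norm (projIcc 0 T hT'.le y)).trans h.le
    rw [hgi]
    exact this

end Paths

section Bounds

variable {T : ℝ} [hT : Fact (0 < T)]

/-- The increment of a window beyond its right end, `x ↦ g (s + (x + ε)⁺) - g s`. -/
noncomputable def futureIncr (T : ℝ) (ε : ℝ) (g : C(ℝ, ℝ)) (s : ℝ) : PathSpace T :=
  ⟨fun x => g (s + max (x + ε) 0) - g s, by fun_prop⟩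

/-- The increment of a window is the increment of its extension plus the increment beyond its
right end. -/
lemma windowOf_sub {ε : ℝ} (hε : 0 ≤ ε) (g : C(ℝ, ℝ)) (s : ℝ) :
    windowOf T g (s + ε) - windowOf T g s =
      extIncr ε (windowOf T g s) + futureIncr T ε g s := by
  ext x
  have hx := x.2.1
  simp only [ContinuousMap.sub_apply, ContinuousMap.add_apply, extIncr_apply, windowOf_apply,
    extend_windowOf g s (by linarith : -T ≤ x + ε), futureIncr, ContinuousMap.coe_mk]
  rcases le_total ((x : ℝ) + ε) 0 with h | h
  · rw [min_eq_left h, max_eq_right h, add_zero, show s + ε + (x : ℝ) = s + (x + ε) by ring]; ring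
  · rw [min_eq_right h, max_eq_left h, add_zero, show s + ε + (x : ℝ) = s + (x + ε) by ring]; ring

lemma norm_toL2_le_of_vanish {f : PathSpace T} {F : ℝ → ℝ} (h : ∀ x, f x = F x)
    (hF : Continuous F) {ε M : ℝ} (hε : 0 ≤ ε) (hM : 0 ≤ M) (hv : ∀ r ≤ -ε, F r = 0)
    (hb : ∀ r, |F r| ≤ M) : ‖toL2 f‖ ≤ M * √ε := by
  refine le_of_sq_le_sq ?_ (by positivity)
  rw [mul_pow, Real.sq_sqrt hε, norm_toL2_sq_eq f F h]
  have := abs_integral_le_of_vanish (D := fun r => F r ^ 2) (a := -T) (s := 0) (ε := ε) (M := M ^ 2)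
    (by have := hT.out; linarith) hε (by positivity) (fun r hr => by
      rw [hv r (by linarith)]; simp)
    (fun r => by rw [abs_of_nonneg (by positivity), ← sq_abs]; gcongr; exact hb r) (by fun_prop)
  exact (le_abs_self _).trans this

/-- The increments of the windows of a path with quadratic variation are of order `√ε` in `L²`. -/
lemma HasQV.exists_bounds {σ : ℝ} {g : C(ℝ, ℝ)} (hg : HasQV T σ g) :
    ∃ C > 0, ∃ ε₀ > 0, ∀ ε, 0 < ε → ε ≤ ε₀ →
      (∀ t ∈ Icc 0 T, ∫ s in (0 : ℝ)..t, (g (s + ε) - g s) ^ 2 ≤ C ^ 2 * ε) ∧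
      ∀ s ∈ Icc 0 T, ‖toL2 (windowOf T g (s + ε) - windowOf T g s)‖ ≤ C * √ε ∧
        ‖toL2 (extIncr ε (windowOf T g s))‖ ≤ C * √ε := by
  have hT' := hT.out
  have hgc := g.continuous
  obtain ⟨B, w, hB, hgB, hw, hw0, -, hwm⟩ := hg.exists_modulus
  have h1 := (hg.qv T ⟨hT'.le, le_rfl⟩).eventually (eventually_lt_nhds (lt_add_one _))
  obtain ⟨ε₁, hε₁, h2⟩ := mem_nhdsGT_iff_exists_Ioc_subset.1 h1
  have hε₁ : 0 < ε₁ := hε₁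
  set A := σ ^ 2 * T + 1 with hA
  have hA0 : 0 < A := by positivity
  set C := √A + 2 * B + 2 * B with hC
  have hCA : A ≤ (√A + 2 * B) ^ 2 := by
    nlinarith [Real.sq_sqrt hA0.le, Real.sqrt_nonneg A]
  have hsA : 0 < √A := Real.sqrt_pos.2 hA0
  refine ⟨C, by positivity, ε₁, hε₁, fun ε hε hεε => ?_⟩
  have i1 : ∀ a b, IntervalIntegrable (fun r => (g (r + ε) - g r) ^ 2) volume a b :=
    fun a b => Continuous.intervalIntegrable (by fun_prop) _ _
  have hTot : ∫ s in (0 : ℝ)..T, (g (s + ε) - g s) ^ 2 ≤ A * ε := by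
    have := h2 ⟨hε, hεε⟩
    simp only [mem_ofPred_eq, intervalIntegral.integral_div] at this
    rw [div_lt_iff₀ hε] at this
    exact this.le
  have ht : ∀ t ∈ Icc 0 T, ∫ s in (0 : ℝ)..t, (g (s + ε) - g s) ^ 2 ≤ A * ε := fun t ht =>
    (intervalIntegral.integral_mono_interval le_rfl ht.1 ht.2
      (.of_forall fun _ => sq_nonneg _) (i1 _ _)).trans hTot
  have hinc : ∀ a b, |g a - g b| ≤ 2 * B := fun a b =>
    (abs_sub _ _).trans (by linarith [hgB a, hgB b])
  have hΔ : ∀ s ∈ Icc 0 T,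
      ‖toL2 (windowOf T g (s + ε) - windowOf T g s)‖ ≤ (√A + 2 * B) * √ε := by
    intro s hs
    refine le_of_sq_le_sq ?_ (by positivity)
    rw [norm_toL2_sq_eq _ (fun x => g (s + x + ε) - g (s + x)) (fun x => by
      simp only [ContinuousMap.sub_apply, windowOf_apply]
      rw [add_right_comm])]
    rw [intervalIntegral.integral_comp_add_left (fun r => (g (r + ε) - g r) ^ 2) s, add_zero,
      mul_pow, Real.sq_sqrt hε.le]
    have h3 : ∫ r in (s + -T)..s, (g (r + ε) - g r) ^ 2 ≤
        (∫ r in (s + -T)..0, (g (r + ε) - g r) ^ 2) +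
          ∫ r in (0 : ℝ)..s, (g (r + ε) - g r) ^ 2 := by
      rw [intervalIntegral.integral_add_adjacent_intervals (i1 _ _) (i1 _ _)]
    have h4 := abs_integral_le_of_vanish (D := fun r => (g (r + ε) - g r) ^ 2) (a := s + -T)
      (s := 0) (ε := ε) (M := (2 * B) ^ 2) (by linarith [hs.2]) hε.le (by positivity)
      (fun r hr => by rw [hg.left r (by linarith), hg.left (r + ε) (by linarith)]; simp)
      (fun r => by rw [abs_of_nonneg (by positivity), ← sq_abs]; gcongr; exact hinc _ _)
      (by fun_prop)
    have h5 := ht s hs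
    have h6 := (le_abs_self _).trans h4
    have h7 : A + (2 * B) ^ 2 ≤ (√A + 2 * B) ^ 2 := by
      nlinarith [Real.sq_sqrt hA0.le, mul_nonneg hsA.le hB]
    nlinarith
  have hsε := Real.sqrt_nonneg ε
  refine ⟨fun t h => (ht t h).trans ?_, fun s hs => ⟨(hΔ s hs).trans ?_, ?_⟩⟩
  · gcongr
    refine hCA.trans ?_
    gcongr
    linarith
  · gcongr; linarith
  · have e : extIncr ε (windowOf T g s) =
        (windowOf T g (s + ε) - windowOf T g s) - futureIncr T ε g s := by
      rw [windowOf_sub hε.le]; abel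
    have h8 : ‖toL2 (futureIncr T ε g s)‖ ≤ 2 * B * √ε :=
      norm_toL2_le_of_vanish (F := fun x => g (s + max (x + ε) 0) - g s) (fun x => rfl)
        (by fun_prop) hε.le (by positivity)
        (fun r hr => by rw [max_eq_right (by linarith), add_zero, sub_self]) fun r => hinc _ _
    rw [e, map_sub]
    refine (norm_sub_le _ _).trans ((add_le_add (hΔ s hs) h8).trans (le_of_eq ?_))
    rw [hC]; ring

end Bounds

/-! ### Differential estimates near a window -/

section Calculus

/-- Uniform continuity at the points of a compact set `K`; the second point may lie outside `K`. -/
lemma exists_uniform_near {α β : Type*} [PseudoMetricSpace α] [PseudoMetricSpace β] {f : α → β}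
    {D K : Set α} (hf : ContinuousOn f D) (hK : IsCompact K) (hKD : K ⊆ D) {κ : ℝ} (hκ : 0 < κ) :
    ∃ ρ > 0, ∀ p ∈ K, ∀ q ∈ D, dist p q < ρ → dist (f p) (f q) < κ := by
  have hK' : IsCompact ((↑) ⁻¹' K : Set D) :=
    Topology.IsInducing.subtypeVal.isCompact_preimage_iff (by simpa using hKD) |>.2 hK
  have h := hK'.uniformContinuousAt_of_continuousAt (D.domRestrict f)
    (fun a _ => (continuousOn_iff_continuous_domRestrict.1 hf).continuousAt)
    (Metric.dist_mem_uniformity hκ)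
  obtain ⟨ρ, hρ, h'⟩ := Metric.mem_uniformity_dist.1 h
  exact ⟨ρ, hρ, fun p hp q hq hpq => h' (a := ⟨p, hKD hp⟩) (b := ⟨q, hq⟩) hpq hp⟩

variable {T : ℝ} [hT : Fact (0 < T)]

lemma isCompact_windows (g : C(ℝ, ℝ)) (t : ℝ) :
    IsCompact ((fun s => (s, windowOf T g s)) '' Icc 0 t) :=
  isCompact_Icc.image (continuous_id.prodMk (continuous_windowOf g))

variable {σ : ℝ} {u : ℝ → PathSpace T → ℝ} {S : ℝ → PathSpace T → Chi0 T} {g : C(ℝ, ℝ)} {t : ℝ}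

/-- Near a window, the second derivative is close to that at the window, in the norm of bilinear
forms bounded for `hilbertNorm`. This holds at all points of a ball, although the second derivative
is only assumed to belong to `χ₀` on `V_{2,ψ}`: this set is dense, and for fixed arguments the
second derivative is continuous. -/
lemma exists_form_near (hu : IsC12 u)
    (hS : ∀ t ∈ Ico 0 T, ∀ η ∈ qvSpace T (fun t => σ ^ 2 * t) t, ∀ f g : PathSpace T,
      fderiv ℝ (fderiv ℝ (u t)) η f g = (S t η).form f g)
    (hSc : ContinuousOn (fun p : ℝ × PathSpace T => S p.1 p.2)
      {p | p.1 ∈ Ico 0 T ∧ p.2 ∈ qvSpace T (fun t => σ ^ 2 * t) p.1})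
    (hg : HasQV T σ g) (ht : t ∈ Ico 0 T) {κ : ℝ} (hκ : 0 < κ) :
    ∃ ρ > 0, ∀ s ∈ Icc 0 t, ∀ ζ, ‖ζ - windowOf T g s‖ < ρ → ∀ f h : PathSpace T,
      |fderiv ℝ (fderiv ℝ (u s)) ζ f h - (S s (windowOf T g s)).form f h| ≤
        κ * (hilbertNorm f * hilbertNorm h) := by
  have hst : ∀ s ∈ Icc 0 t, s ∈ Ico 0 T ∧ windowOf T g s ∈ qvSpace T (fun t => σ ^ 2 * t) s :=
    fun s hs => ⟨⟨hs.1, hs.2.trans_lt ht.2⟩, hg.windowOf_mem ⟨hs.1, hs.2.trans ht.2.le⟩⟩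
  obtain ⟨ρ, hρ, h⟩ := exists_uniform_near hSc (isCompact_windows g t) (by
    rintro _ ⟨s, hs, rfl⟩; exact hst s hs) (half_pos hκ)
  refine ⟨ρ, hρ, fun s hs ζ hζ f h' => ?_⟩
  obtain ⟨hs1, hs2⟩ := hst s hs
  -- `ζ` is a limit of points of `V_{2,ψ}` that stay in the ball
  have hd : ∀ n : ℕ, ∃ ζ' ∈ qvSpace T (fun t => σ ^ 2 * t) s,
      ‖ζ' - ζ‖ < min (1 / ((n : ℝ) + 1)) (ρ - ‖ζ - windowOf T g s‖) := fun n =>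
    exists_mem_qvSpace_near hs2 ζ (lt_min (by positivity) (by linarith))
  choose z hz hz' using hd
  have hlim : Tendsto z atTop (𝓝 ζ) := by
    rw [tendsto_iff_norm_sub_tendsto_zero]
    exact squeeze_zero (fun _ => norm_nonneg _) (fun n => ((hz' n).trans_le (min_le_left _ _)).le)
      tendsto_one_div_add_atTop_nhds_zero_nat
  have hc : Continuous fun ζ => fderiv ℝ (fderiv ℝ (u s)) ζ := by
    have := hu.continuousOn_fderiv_fderiv.comp_continuous (f := fun ζ : PathSpace T => (s, ζ))
      (by fun_prop) fun ζ => ⟨hs1, mem_univ _⟩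
    exact this
  have hc2 : Continuous fun ζ => fderiv ℝ (fderiv ℝ (u s)) ζ f h' := by fun_prop
  have h1 : Tendsto (fun n => |fderiv ℝ (fderiv ℝ (u s)) (z n) f h' -
      (S s (windowOf T g s)).form f h'|) atTop (𝓝 (|fderiv ℝ (fderiv ℝ (u s)) ζ f h' -
      (S s (windowOf T g s)).form f h'|)) :=
    (((hc2.tendsto ζ).comp hlim).sub_const _).abs
  refine le_of_tendsto h1 (.of_forall fun n => ?_)
  rw [hS s hs1 _ (hz n), ← form_sub]
  refine (abs_form_le _ _ _).trans ?_
  have h2 := h _ ⟨s, hs, rfl⟩ (s, z n) ⟨hs1, hz n⟩ (by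
    rw [dist_comm, Prod.dist_eq, dist_self, dist_eq_norm]
    refine max_lt hρ ?_
    calc ‖z n - windowOf T g s‖ ≤ ‖z n - ζ‖ + ‖ζ - windowOf T g s‖ := by
          rw [show z n - windowOf T g s = (z n - ζ) + (ζ - windowOf T g s) by abel]
          exact norm_add_le _ _
      _ < ρ := by linarith [(hz' n).trans_le (min_le_right _ _)])
  rw [dist_comm, dist_eq_norm] at h2
  have := mul_nonneg (hilbertNorm_nonneg f) (hilbertNorm_nonneg h')
  exact mul_le_mul_of_nonneg_right (by linarith) this

lemma hasDerivAt_fderiv_line {F : PathSpace T → ℝ} (hF : Differentiable ℝ F)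
    (ζ φ : PathSpace T) (θ : ℝ) :
    HasDerivAt (fun θ : ℝ => F (ζ + θ • φ)) (fderiv ℝ F (ζ + θ • φ) φ) θ := by
  have h1 : HasDerivAt (fun θ : ℝ => ζ + θ • φ) φ θ := by
    simpa using ((hasDerivAt_id θ).smul_const φ).const_add ζ
  exact (hF _).hasFDerivAt.comp_hasDerivAt θ h1

lemma hasDerivAt_fderiv_fderiv_line {F : PathSpace T → ℝ} (hF : Differentiable ℝ (fderiv ℝ F))
    (ζ φ ψ : PathSpace T) (θ : ℝ) :
    HasDerivAt (fun θ : ℝ => fderiv ℝ F (ζ + θ • φ) ψ)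
      (fderiv ℝ (fderiv ℝ F) (ζ + θ • φ) φ ψ) θ := by
  have h1 : HasDerivAt (fun θ : ℝ => ζ + θ • φ) φ θ := by
    simpa using ((hasDerivAt_id θ).smul_const φ).const_add ζ
  have h2 := HasFDerivAt.comp_hasDerivAt (l := fderiv ℝ F) (f := fun θ : ℝ => ζ + θ • φ) θ
    (hF (ζ + θ • φ)).hasFDerivAt h1
  exact h2.clm_apply (hasDerivAt_const θ ψ) |>.congr_deriv (by simp)

lemma abs_sub_le_of_deriv {f f' : ℝ → ℝ} {C : ℝ} (hf : ∀ θ, HasDerivAt f (f' θ) θ)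
    (hC : ∀ θ ∈ Icc (0 : ℝ) 1, |f' θ| ≤ C) {τ : ℝ} (hτ : τ ∈ Icc (0 : ℝ) 1) :
    |f τ - f 0| ≤ C * τ := by
  have := (convex_Icc (0 : ℝ) 1).norm_image_sub_le_of_norm_hasDerivWithin_le
    (fun x _ => (hf x).hasDerivWithinAt) hC ⟨le_rfl, zero_le_one⟩ hτ
  simpa [abs_of_nonneg hτ.1] using this

lemma norm_line_sub_lt {η ζ φ : PathSpace T} {ρ : ℝ} (h0 : ‖ζ - η‖ < ρ) (h1 : ‖ζ + φ - η‖ < ρ)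
    {θ : ℝ} (hθ : θ ∈ Icc (0 : ℝ) 1) : ‖ζ + θ • φ - η‖ < ρ := by
  have hc := (convex_ball η ρ) (mem_ball_iff_norm.2 h0) (mem_ball_iff_norm.2 h1)
    (sub_nonneg.2 hθ.2) hθ.1 (by ring)
  rwa [mem_ball_iff_norm, smul_add, ← add_assoc, ← add_smul, sub_add_cancel, one_smul] at hc

/-- Near the windows of a path, the derivative is Lipschitz and the first order Taylor remainder is
quadratic, both for `hilbertNorm` in place of the supremum norm. In mean square over time, the
increments of the windows are of order `√ε` for the former, but not for the latter. -/
lemma exists_taylor_bounds (hu : IsC12 u)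
    (hS : ∀ t ∈ Ico 0 T, ∀ η ∈ qvSpace T (fun t => σ ^ 2 * t) t, ∀ f g : PathSpace T,
      fderiv ℝ (fderiv ℝ (u t)) η f g = (S t η).form f g)
    (hSc : ContinuousOn (fun p : ℝ × PathSpace T => S p.1 p.2)
      {p | p.1 ∈ Ico 0 T ∧ p.2 ∈ qvSpace T (fun t => σ ^ 2 * t) p.1})
    (hg : HasQV T σ g) (ht : t ∈ Ico 0 T) :
    ∃ C > 0, ∃ ρ > 0, ∀ s ∈ Icc 0 t, ∀ ζ φ : PathSpace T, ‖ζ - windowOf T g s‖ < ρ →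
      ‖ζ + φ - windowOf T g s‖ < ρ →
      (∀ h, |fderiv ℝ (u s) (ζ + φ) h - fderiv ℝ (u s) ζ h| ≤
        C * (hilbertNorm φ * hilbertNorm h)) ∧
      |u s (ζ + φ) - u s ζ - fderiv ℝ (u s) ζ φ| ≤ C * hilbertNorm φ ^ 2 := by
  obtain ⟨ρ, hρ, h⟩ := exists_form_near hu hS hSc hg ht one_pos
  have hKc : ContinuousOn (fun s => S s (windowOf T g s)) (Icc 0 t) := by
    refine hSc.comp (f := fun s => (s, windowOf T g s))
      (continuous_id.prodMk (continuous_windowOf g)).continuousOn fun s hs => ?_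
    exact ⟨⟨hs.1, hs.2.trans_lt ht.2⟩, hg.windowOf_mem ⟨hs.1, hs.2.trans ht.2.le⟩⟩
  obtain ⟨M, hM⟩ := isCompact_Icc.exists_bound_of_continuousOn hKc
  have hM0 : 0 ≤ M := (norm_nonneg _).trans (hM 0 ⟨le_rfl, ht.1⟩)
  refine ⟨2 * M + 1, by positivity, ρ, hρ, fun s hs ζ φ h0 h1 => ?_⟩
  have hsT : s ∈ Ico 0 T := ⟨hs.1, hs.2.trans_lt ht.2⟩
  have hD2 : ∀ θ ∈ Icc (0 : ℝ) 1, ∀ f k : PathSpace T,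
      |fderiv ℝ (fderiv ℝ (u s)) (ζ + θ • φ) f k| ≤
        (2 * M + 1) * (hilbertNorm f * hilbertNorm k) := by
    intro θ hθ f k
    have a := h s hs _ (norm_line_sub_lt h0 h1 hθ) f k
    have b := abs_form_le (S s (windowOf T g s)) f k
    have c := hM s hs
    have d := mul_nonneg (hilbertNorm_nonneg f) (hilbertNorm_nonneg k)
    have e : |fderiv ℝ (fderiv ℝ (u s)) (ζ + θ • φ) f k| ≤
        |fderiv ℝ (fderiv ℝ (u s)) (ζ + θ • φ) f k - (S s (windowOf T g s)).form f k| +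
        |(S s (windowOf T g s)).form f k| := by
      refine le_trans (le_of_eq ?_) (abs_add_le _ _)
      congr 1; ring
    nlinarith
  have first : ∀ τ ∈ Icc (0 : ℝ) 1, ∀ k, |fderiv ℝ (u s) (ζ + τ • φ) k - fderiv ℝ (u s) ζ k| ≤
      (2 * M + 1) * (hilbertNorm φ * hilbertNorm k) * τ := by
    intro τ hτ k
    have := abs_sub_le_of_deriv
      (fun θ => hasDerivAt_fderiv_fderiv_line (hu.differentiable_fderiv s hsT) ζ φ k θ)
      (fun θ hθ => hD2 θ hθ φ k) hτ
    simpa using this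
  have hone : (1 : ℝ) ∈ Icc (0 : ℝ) 1 := ⟨zero_le_one, le_rfl⟩
  refine ⟨fun k => by simpa using first 1 hone k, ?_⟩
  have := abs_sub_le_of_deriv (f := fun θ : ℝ => u s (ζ + θ • φ) - θ * fderiv ℝ (u s) ζ φ)
    (f' := fun θ => fderiv ℝ (u s) (ζ + θ • φ) φ - 1 * fderiv ℝ (u s) ζ φ)
    (C := (2 * M + 1) * hilbertNorm φ ^ 2)
    (fun θ => (hasDerivAt_fderiv_line (hu.differentiable_space s hsT) ζ φ θ).sub
      ((hasDerivAt_id θ).mul_const _))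
    (fun θ hθ => by
      rw [one_mul]
      refine (first θ hθ φ).trans ?_
      rw [sq]
      have : 0 ≤ (2 * M + 1) * (hilbertNorm φ * hilbertNorm φ) := by
        have := hilbertNorm_nonneg φ; positivity
      nlinarith [hθ.2]) hone
  simp only [one_smul, one_mul, zero_smul, add_zero, zero_mul, sub_zero, mul_one] at this
  rwa [sub_right_comm] at this

/-- Second order Taylor formula at the windows of a path, with a remainder controlled by the
`χ₀`-modulus of continuity of the second derivative. -/
lemma exists_taylor_second (hu : IsC12 u)
    (hS : ∀ t ∈ Ico 0 T, ∀ η ∈ qvSpace T (fun t => σ ^ 2 * t) t, ∀ f g : PathSpace T,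
      fderiv ℝ (fderiv ℝ (u t)) η f g = (S t η).form f g)
    (hSc : ContinuousOn (fun p : ℝ × PathSpace T => S p.1 p.2)
      {p | p.1 ∈ Ico 0 T ∧ p.2 ∈ qvSpace T (fun t => σ ^ 2 * t) p.1})
    (hg : HasQV T σ g) (ht : t ∈ Ico 0 T) {κ : ℝ} (hκ : 0 < κ) :
    ∃ ρ > 0, ∀ s ∈ Icc 0 t, ∀ φ : PathSpace T, ‖φ‖ < ρ →
      |u s (windowOf T g s + φ) - u s (windowOf T g s) - fderiv ℝ (u s) (windowOf T g s) φ -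
        (S s (windowOf T g s)).form φ φ / 2| ≤ κ * hilbertNorm φ ^ 2 := by
  obtain ⟨ρ, hρ, h⟩ := exists_form_near hu hS hSc hg ht hκ
  refine ⟨ρ, hρ, fun s hs φ hφ => ?_⟩
  have hsT : s ∈ Ico 0 T := ⟨hs.1, hs.2.trans_lt ht.2⟩
  set η := windowOf T g s
  set c := (S s η).form φ φ
  have first : ∀ τ ∈ Icc (0 : ℝ) 1,
      |fderiv ℝ (u s) (η + τ • φ) φ - fderiv ℝ (u s) η φ - τ * c| ≤ κ * hilbertNorm φ ^ 2 * τ := by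
    intro τ hτ
    have := abs_sub_le_of_deriv (f := fun θ : ℝ => fderiv ℝ (u s) (η + θ • φ) φ - θ * c)
      (f' := fun θ => fderiv ℝ (fderiv ℝ (u s)) (η + θ • φ) φ φ - 1 * c)
      (C := κ * hilbertNorm φ ^ 2)
      (fun θ => (hasDerivAt_fderiv_fderiv_line (hu.differentiable_fderiv s hsT) η φ φ θ).sub
        ((hasDerivAt_id θ).mul_const _))
      (fun θ hθ => by
        rw [one_mul, sq]
        exact h s hs _ (norm_line_sub_lt (by rwa [sub_self, norm_zero])
          (by rwa [add_sub_cancel_left]) hθ) φ φ) hτ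
    simp only [zero_smul, add_zero, zero_mul, sub_zero] at this
    rwa [sub_right_comm] at this
  have := abs_sub_le_of_deriv
    (f := fun θ : ℝ => u s (η + θ • φ) - θ * fderiv ℝ (u s) η φ - θ ^ 2 * (c / 2))
    (f' := fun θ => fderiv ℝ (u s) (η + θ • φ) φ - 1 * fderiv ℝ (u s) η φ - θ * c)
    (C := κ * hilbertNorm φ ^ 2)
    (fun θ => (((hasDerivAt_fderiv_line (hu.differentiable_space s hsT) η φ θ).sub
      ((hasDerivAt_id θ).mul_const _)).sub ((hasDerivAt_pow 2 θ).mul_const _)).congr_deriv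
        (by push_cast; ring))
    (fun θ hθ => by
      rw [one_mul]
      refine (first θ hθ).trans ?_
      have : 0 ≤ κ * hilbertNorm φ ^ 2 := by positivity
      nlinarith [hθ.2]) ⟨zero_le_one, le_rfl⟩
  simp only [one_smul, one_mul, zero_smul, add_zero, zero_mul, sub_zero, mul_one, one_pow, ne_eq,
    OfNat.ofNat_ne_zero, not_false_eq_true, zero_pow] at this
  convert this using 2
  ring

end Calculus

/-! ### Consequences of condition (C) along a path -/

section ConditionC

variable {T : ℝ} [hT : Fact (0 < T)]

lemma continuous_cut (n : ℕ) : Continuous fun s => cut T s n := by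
  refine ContinuousMap.continuous_of_continuous_uncurry _ ?_
  change Continuous fun p : ℝ × Icc (-T) (0 : ℝ) =>
    max 0 (min 1 (n * ((p.2 : ℝ) + p.1))) * (1 - max 0 (1 + n * (p.2 : ℝ)))
  fun_prop

lemma integrableOn_rightPart {t : ℝ} {L : ℝ → PathSpace T →L[ℝ] ℝ} {F : ℝ → PathSpace T}
    (hL : ContinuousOn L (Icc 0 t)) (hF : ContinuousOn F (Icc 0 t)) :
    IntegrableOn (fun s => rightPart (L s) s (F s)) (Icc 0 t) := by
  have hLn : ContinuousOn (fun s => ‖L s‖) (Icc 0 t) :=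
    (continuous_norm (E := PathSpace T →L[ℝ] ℝ)).comp_continuousOn hL
  obtain ⟨M, hM⟩ := isCompact_Icc.exists_bound_of_continuousOn hLn
  replace hM : ∀ s ∈ Icc 0 t, ‖L s‖ ≤ M := fun s hs => (le_abs_self _).trans (hM s hs)
  obtain ⟨M', hM'⟩ := isCompact_Icc.exists_bound_of_continuousOn hF
  have hm : AEStronglyMeasurable (fun s => rightPart (L s) s (F s))
      (volume.restrict (Icc 0 t)) := by
    refine aestronglyMeasurable_of_tendsto_ae atTop (f := fun n s => L s (cut T s n * F s))
      (fun n => ?_) (.of_forall fun s => tendsto_cut_rightPart (L s) s (F s))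
    refine ContinuousOn.aestronglyMeasurable ?_ measurableSet_Icc
    exact hL.clm_apply ((continuous_cut n).continuousOn.mul hF)
  refine Integrable.of_bound hm (M * M') ?_
  filter_upwards [ae_restrict_mem measurableSet_Icc] with s hs
  refine (abs_rightPart_le _ _ _).trans ?_
  exact mul_le_mul (hM s hs) (hM' s hs) (norm_nonneg _)
    ((norm_nonneg (L s)).trans (hM s hs))

lemma norm_toL2_mono {f h : PathSpace T} (hfh : ∀ x, |f x| ≤ |h x|) : ‖toL2 f‖ ≤ ‖toL2 h‖ := by
  refine le_of_sq_le_sq ?_ (norm_nonneg _)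
  rw [norm_toL2_sq, norm_toL2_sq]
  refine integral_mono (by simpa [sq] using integrable_leb_mul f f)
    (by simpa [sq] using integrable_leb_mul h h) fun x => ?_
  exact sq_le_sq.2 (hfh x)

/-- A functional bounded for the Hilbertian seminorm has a right part bounded in `L²`. -/
lemma abs_rightPart_le_of_bound {L : PathSpace T →L[ℝ] ℝ} {M : ℝ}
    (hL : ∀ h, |L h| ≤ M * hilbertNorm h) (hM : 0 ≤ M) (s : ℝ) (F : PathSpace T) :
    |rightPart L s F| ≤ M * ‖toL2 F‖ := by
  refine le_of_tendsto (tendsto_cut_rightPart L s F).abs (.of_forall fun n => ?_)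
  refine (hL _).trans (mul_le_mul_of_nonneg_left ?_ hM)
  unfold hilbertNorm
  simp only [ContinuousMap.coe_mul, Pi.mul_apply, cut_zero, zero_mul, abs_zero, zero_add]
  refine norm_toL2_mono fun x => ?_
  rw [ContinuousMap.coe_mul, Pi.mul_apply, abs_mul, abs_of_nonneg (cut_mem s n x).1]
  exact mul_le_of_le_one_left (abs_nonneg _) (cut_mem s n x).2

lemma norm_toL2_extIncr_le {ε : ℝ} (hε : 0 ≤ ε) (hε1 : ε ≤ 1) (φ : PathSpace T) :
    ‖toL2 (extIncr ε φ)‖ ≤ 2 * hilbertNorm φ := by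
  have hT' := hT.out
  have hc := continuous_extend φ
  let τ : PathSpace T := ⟨fun x => extend φ (x + ε), by fun_prop⟩
  have e : extIncr ε φ = τ - φ := by
    ext x
    rw [extIncr_apply]; rfl
  have hi : ∀ a b, IntervalIntegrable (fun x => extend φ x ^ 2) volume a b :=
    fun a b => Continuous.intervalIntegrable (by fun_prop) _ _
  have h1 : ‖toL2 τ‖ ≤ hilbertNorm φ := by
    refine le_of_sq_le_sq ?_ (hilbertNorm_nonneg φ)
    rw [norm_toL2_sq_eq τ (fun x => extend φ (x + ε)) (fun x => rfl),
      intervalIntegral.integral_comp_add_right (fun x => extend φ x ^ 2)]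
    have h2 : ∫ x in (-T + ε)..(0 + ε), extend φ x ^ 2 ≤ ∫ x in (-T)..(0 + ε), extend φ x ^ 2 :=
      intervalIntegral.integral_mono_interval (by linarith) (by linarith) le_rfl
        (.of_forall fun _ => sq_nonneg _) (hi _ _)
    have h3 : ∫ x in (0 : ℝ)..(0 + ε), extend φ x ^ 2 = φ zeroPt ^ 2 * ε := by
      rw [intervalIntegral.integral_congr (g := fun _ => φ zeroPt ^ 2)]
      · simp [mul_comm]
      · intro x hx
        rw [uIcc_of_le (by linarith)] at hx
        simp only [extend_of_nonneg φ hx.1]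
    rw [(intervalIntegral.integral_add_adjacent_intervals (hi (-T) 0) (hi 0 (0 + ε))).symm, h3,
      ← norm_toL2_sq_eq φ (extend φ) (fun x => (extend_coe φ x).symm)] at h2
    refine h2.trans ?_
    unfold hilbertNorm
    have h4 := sq_abs (φ zeroPt)
    have h5 : φ zeroPt ^ 2 * ε ≤ φ zeroPt ^ 2 := mul_le_of_le_one_right (sq_nonneg _) hε1
    nlinarith [mul_nonneg (abs_nonneg (φ zeroPt)) (norm_nonneg (toL2 φ))]
  rw [e, map_sub]
  refine (norm_sub_le _ _).trans ?_
  linarith [norm_toL2_le φ]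

variable {σ : ℝ} {u : ℝ → PathSpace T → ℝ} {S : ℝ → PathSpace T → Chi0 T} {g : C(ℝ, ℝ)} {t : ℝ}

lemma continuousOn_fderiv_along (hu : IsC12 u) (ht : t ∈ Ico 0 T) {ζ : ℝ → PathSpace T}
    (hζ : ContinuousOn ζ (Icc 0 t)) : ContinuousOn (fun s => fderiv ℝ (u s) (ζ s)) (Icc 0 t) :=
  hu.continuousOn_fderiv.comp (f := fun s => (s, ζ s)) (continuousOn_id.prodMk hζ)
    fun _ hs => ⟨⟨hs.1, hs.2.trans_lt ht.2⟩, mem_univ _⟩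

/-- Condition (C): the approximate forward integrals along functions taking values in a compact
family are bounded in `L¹` of time. -/
lemma exists_lintegral_bound (hC : ConditionC (fun t => σ ^ 2 * t) u) (ht : t ∈ Ico 0 T)
    {K : Set (ℝ × PathSpace T)} (hK : IsCompact K)
    (hKV : ∀ p ∈ K, p.1 ∈ Icc 0 T ∧ p.2 ∈ qvSpace T (fun t => σ ^ 2 * t) p.1) :
    ∃ J : ℝ → ℝ≥0∞, ∫⁻ s in Icc 0 t, J s < ∞ ∧ ∀ ε > 0, ∀ s ∈ Icc 0 t, ∀ η, (s, η) ∈ K →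
      ENNReal.ofReal |detForwardApprox (gradPerp u s η) s η ε| ≤ J s := by
  obtain ⟨-, J, hJ, hJK⟩ := hC
  refine ⟨fun s => ⨆ η ∈ {η | (s, η) ∈ K}, (J s η : ℝ≥0∞), ?_, fun ε hε s hs η hη => ?_⟩
  · refine (lintegral_mono_set ?_).trans_lt (hJK K hK hKV)
    exact fun s hs => ⟨hs.1, hs.2.trans_lt ht.2⟩
  · have h1 := hJ ε hε s ⟨hs.1, hs.2.trans_lt ht.2⟩ η (hKV _ hη).2
    refine le_trans ?_ (le_iSup₂ (f := fun η (_ : η ∈ {η | (s, η) ∈ K}) => (J s η : ℝ≥0∞)) η hη)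
    rw [← ENNReal.ofReal_coe_nnreal]
    exact ENNReal.ofReal_le_ofReal h1

lemma integrableOn_detForwardApprox (hu : IsC12 u) (ht : t ∈ Ico 0 T) {ζ : ℝ → PathSpace T}
    (hζ : ContinuousOn ζ (Icc 0 t)) (ε : ℝ) :
    IntegrableOn (fun s => detForwardApprox (gradPerp u s (ζ s)) s (ζ s) ε) (Icc 0 t) := by
  simp only [detForwardApprox_eq]
  exact (integrableOn_rightPart (continuousOn_fderiv_along hu ht hζ)
    ((continuous_extIncr ε).comp_continuousOn hζ)).const_mul _

/-- Along the windows of a path, the approximate forward integrals converge in mean. -/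
lemma tendsto_integral_detForward (hu : IsC12 u) (hC : ConditionC (fun t => σ ^ 2 * t) u)
    (hg : HasQV T σ g) (ht : t ∈ Ico 0 T) {ε : ℕ → ℝ} (hε : ∀ n, 0 < ε n)
    (hε0 : Tendsto ε atTop (𝓝 0)) :
    Tendsto (fun n => ∫ s in (0 : ℝ)..t,
        (ε n)⁻¹ * rightPart (fderiv ℝ (u s) (windowOf T g s)) s (extIncr (ε n) (windowOf T g s)))
      atTop (𝓝 (∫ s in (0 : ℝ)..t, horizontalTerm u s (windowOf T g s))) := by
  have hV : ∀ s ∈ Icc 0 t, windowOf T g s ∈ qvSpace T (fun t => σ ^ 2 * t) s :=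
    fun s hs => hg.windowOf_mem ⟨hs.1, hs.2.trans ht.2.le⟩
  obtain ⟨J, hJ, hJb⟩ := exists_lintegral_bound hC ht (isCompact_windows g t) (by
    rintro _ ⟨s, hs, rfl⟩
    exact ⟨⟨hs.1, hs.2.trans ht.2.le⟩, hV s hs⟩)
  have hint := fun n => integrableOn_detForwardApprox hu ht
    (continuous_windowOf (T := T) g).continuousOn (ε n)
  simp only [← detForwardApprox_eq]
  set I : ℕ → ℝ → ℝ := fun n s =>
    detForwardApprox (gradPerp u s (windowOf T g s)) s (windowOf T g s) (ε n) with hI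
  -- a measurable dominating function: `J` itself need not be measurable
  set H : ℝ → ℝ≥0∞ := fun s => ⨆ n, ENNReal.ofReal |I n s| with hH
  have hHm : AEMeasurable H (volume.restrict (Icc 0 t)) :=
    AEMeasurable.iSup fun n => (hint n).abs.aestronglyMeasurable.aemeasurable.ennreal_ofReal
  have hHJ : ∫⁻ s in Icc 0 t, H s < ∞ := by
    refine lt_of_le_of_lt (setLIntegral_mono' measurableSet_Icc fun s hs => ?_) hJ
    exact iSup_le fun n => hJb (ε n) (hε n) s hs _ ⟨s, hs, rfl⟩
  have hfin : ∀ᵐ s ∂volume.restrict (Icc 0 t), H s < ∞ := ae_lt_top' hHm hHJ.ne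
  simp only [intervalIntegral.integral_of_le ht.1, ← integral_Icc_eq_integral_Ioc]
  refine tendsto_integral_of_dominated_convergence (fun s => (H s).toReal)
    (fun n => (hint n).aestronglyMeasurable) (integrable_toReal_of_lintegral_ne_top hHm hHJ.ne)
    (fun n => ?_) ?_
  · filter_upwards [hfin] with s hs
    rw [Real.norm_eq_abs, ← ENNReal.toReal_ofReal (abs_nonneg (I n s))]
    exact ENNReal.toReal_mono hs.ne (le_iSup (fun n => ENNReal.ofReal |I n s|) n)
  · filter_upwards [ae_restrict_mem measurableSet_Icc] with s hs
    obtain ⟨l, hl⟩ := hC.1 s ⟨hs.1, hs.2.trans_lt ht.2⟩ _ (hV s hs)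
    have h1 : horizontalTerm u s (windowOf T g s) = l := hl.limUnder_eq
    rw [h1]
    exact hl.comp (tendsto_nhdsWithin_iff.2 ⟨hε0, .of_forall hε⟩)

lemma integral_abs_le_toReal {I : ℝ → ℝ} {J : ℝ → ℝ≥0∞} (ht : 0 ≤ t)
    (hI : IntegrableOn I (Icc 0 t)) (hJ : ∫⁻ s in Icc 0 t, J s < ∞)
    (h : ∀ s ∈ Icc 0 t, ENNReal.ofReal |I s| ≤ J s) :
    ∫ s in (0 : ℝ)..t, |I s| ≤ (∫⁻ s in Icc 0 t, J s).toReal := by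
  rw [intervalIntegral.integral_of_le ht, ← integral_Icc_eq_integral_Ioc,
    integral_eq_lintegral_of_nonneg_ae (.of_forall fun _ => abs_nonneg _)
      hI.abs.aestronglyMeasurable]
  exact ENNReal.toReal_mono hJ.ne (setLIntegral_mono' measurableSet_Icc h)

/-- The set of all `(s, η)`, `s ∈ [0, t]`, on the curves of a uniformly convergent sequence. -/
lemma isCompact_curves {y : ℕ → C(Icc (0 : ℝ) t, PathSpace T)} {y₀ : C(Icc (0 : ℝ) t, PathSpace T)}
    (h : Tendsto y atTop (𝓝 y₀)) :
    IsCompact ((fun p : C(Icc (0 : ℝ) t, PathSpace T) × Icc (0 : ℝ) t => ((p.2 : ℝ), p.1 p.2)) ''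
      (insert y₀ (range y) ×ˢ univ)) :=
  (h.isCompact_insert_range.prod isCompact_univ).image (by fun_prop)

end ConditionC

section SmallPerturbation

variable {T : ℝ} [hT : Fact (0 < T)] {σ : ℝ} {u : ℝ → PathSpace T → ℝ}
  {S : ℝ → PathSpace T → Chi0 T} {g : C(ℝ, ℝ)} {t : ℝ}

lemma rightPart_extIncr_decomp (L L' : PathSpace T →L[ℝ] ℝ) (s ε c : ℝ) (η φ : PathSpace T) :
    c * rightPart L s (extIncr ε φ) = rightPart L' s (extIncr ε (η + c • φ)) -
      rightPart L s (extIncr ε η) - rightPart (L' - L) s (extIncr ε (η + c • φ)) := by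
  have e1 : rightPart L s (extIncr ε (η + c • φ)) =
      rightPart L s (extIncr ε η) + c * rightPart L s (extIncr ε φ) := by
    rw [extIncr_add, extIncr_smul, ← rightPart_smul, ← rightPart_add]
  rw [rightPart_sub_left, e1]
  ring

lemma le_add_inv_mul_sq {r : ℝ} (hr : 0 < r) (x : ℝ) : x ≤ r + r⁻¹ * x ^ 2 := by
  have h1 : r + r⁻¹ * x ^ 2 - x = r⁻¹ * ((r - x / 2) ^ 2 + 3 / 4 * x ^ 2) := by
    field_simp; ring
  have : 0 ≤ r⁻¹ * ((r - x / 2) ^ 2 + 3 / 4 * x ^ 2) := by positivity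
  linarith

/-- Condition (C) makes the forward integrals of small Lipschitz functions negligible. The
functions are added to the windows after multiplication by a factor tending to infinity so slowly
that the sum still converges; the approximate integrals of the sum are bounded by condition (C), and
dividing by the factor gives the result. -/
lemma tendsto_integral_rightPart_extIncr (hu : IsC12 u)
    (hS : ∀ t ∈ Ico 0 T, ∀ η ∈ qvSpace T (fun t => σ ^ 2 * t) t, ∀ f g : PathSpace T,
      fderiv ℝ (fderiv ℝ (u t)) η f g = (S t η).form f g)
    (hSc : ContinuousOn (fun p : ℝ × PathSpace T => S p.1 p.2)
      {p | p.1 ∈ Ico 0 T ∧ p.2 ∈ qvSpace T (fun t => σ ^ 2 * t) p.1})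
    (hC : ConditionC (fun t => σ ^ 2 * t) u) (hg : HasQV T σ g) (ht : t ∈ Ico 0 T)
    {ε : ℕ → ℝ} (hε : ∀ n, 0 < ε n) (hε0 : Tendsto ε atTop (𝓝 0))
    {φ : ℕ → ℝ → PathSpace T} (hφc : ∀ n, ContinuousOn (φ n) (Icc 0 t))
    (hφL : ∀ n, ∀ s ∈ Icc 0 t, ∃ K, 0 ≤ K ∧ ∀ x y, |φ n s x - φ n s y| ≤ K * |(x : ℝ) - y|)
    {a : ℕ → ℝ} (ha : Tendsto a atTop (𝓝 0)) (hφa : ∀ n, ∀ s ∈ Icc 0 t, ‖φ n s‖ ≤ a n)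
    (hφN : Tendsto (fun n => (ε n)⁻¹ * ∫ s in (0 : ℝ)..t, hilbertNorm (φ n s) ^ 2) atTop (𝓝 0)) :
    Tendsto (fun n => (ε n)⁻¹ * ∫ s in (0 : ℝ)..t,
      |rightPart (fderiv ℝ (u s) (windowOf T g s)) s (extIncr (ε n) (φ n s))|) atTop (𝓝 0) := by
  have ht0 := ht.1
  set b : ℕ → ℝ := fun n => (ε n)⁻¹ * ∫ s in (0 : ℝ)..t, hilbertNorm (φ n s) ^ 2 with hb
  have hb0 : ∀ n, 0 ≤ b n := fun n => mul_nonneg (inv_nonneg.2 (hε n).le)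
    (intervalIntegral.integral_nonneg ht0 fun _ _ => sq_nonneg _)
  have ha0 : ∀ n, 0 ≤ a n := fun n => (norm_nonneg _).trans (hφa n 0 ⟨le_rfl, ht0⟩)
  -- the inverse of the factor: it tends to `0`, but slowly compared with `a` and `b`
  set r : ℕ → ℝ := fun n => √(a n + b n + 1 / ((n : ℝ) + 1)) with hr
  have hd : ∀ n, 0 < a n + b n + 1 / ((n : ℝ) + 1) := fun n => by
    have := ha0 n; have := hb0 n; positivity
  have hr0 : ∀ n, 0 < r n := fun n => Real.sqrt_pos.2 (hd n)
  have hr2 : ∀ n, r n ^ 2 = a n + b n + 1 / ((n : ℝ) + 1) := fun n => Real.sq_sqrt (hd n).le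
  have hrlim : Tendsto r atTop (𝓝 0) := by
    have := ((ha.add hφN).add tendsto_one_div_add_atTop_nhds_zero_nat).sqrt
    rwa [add_zero, add_zero, Real.sqrt_zero] at this
  have hra : ∀ n, (r n)⁻¹ * a n ≤ r n := fun n => by
    rw [inv_mul_le_iff₀ (hr0 n), ← sq, hr2]
    have := hb0 n
    have : 0 < 1 / ((n : ℝ) + 1) := by positivity
    linarith
  have hrb : ∀ n, (r n)⁻¹ * b n ≤ r n := fun n => by
    rw [inv_mul_le_iff₀ (hr0 n), ← sq, hr2]
    have := ha0 n
    have : 0 < 1 / ((n : ℝ) + 1) := by positivity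
    linarith
  set η : ℝ → PathSpace T := fun s => windowOf T g s with hη
  have hηc : Continuous η := continuous_windowOf g
  set ζ : ℕ → ℝ → PathSpace T := fun n s => η s + (r n)⁻¹ • φ n s with hζ
  have hζc : ∀ n, ContinuousOn (ζ n) (Icc 0 t) := fun n => by
    have := hφc n
    fun_prop
  have hζη : ∀ n, ∀ s ∈ Icc 0 t, ‖ζ n s - η s‖ ≤ r n := fun n s hs => by
    simp only [hζ, add_sub_cancel_left, norm_smul, norm_inv, Real.norm_eq_abs, abs_of_pos (hr0 n)]
    exact (mul_le_mul_of_nonneg_left (hφa n s hs) (inv_nonneg.2 (hr0 n).le)).trans (hra n)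
  -- the compact set to which condition (C) is applied
  set y : ℕ → C(Icc (0 : ℝ) t, PathSpace T) := fun n =>
    ⟨(Icc 0 t).domRestrict (ζ n), (hζc n).domRestrict⟩ with hy
  set y₀ : C(Icc (0 : ℝ) t, PathSpace T) := ⟨fun s => η s, by fun_prop⟩ with hy₀
  have hylim : Tendsto y atTop (𝓝 y₀) := by
    have h : Tendsto (fun n => dist (y n) y₀) atTop (𝓝 0) := by
      refine squeeze_zero (fun _ => dist_nonneg) (fun n => ?_) hrlim
      refine (ContinuousMap.dist_le (hr0 n).le).2 fun s => ?_
      rw [dist_eq_norm]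
      exact hζη n s s.2
    exact tendsto_iff_dist_tendsto_zero.2 h
  have hsT : ∀ s ∈ Icc 0 t, s ∈ Icc 0 T := fun s hs => ⟨hs.1, hs.2.trans ht.2.le⟩
  obtain ⟨J, hJ, hJb⟩ := exists_lintegral_bound hC ht (isCompact_curves hylim) (by
    rintro _ ⟨⟨z, s⟩, ⟨hz, -⟩, rfl⟩
    refine ⟨hsT s s.2, ?_⟩
    have hV := hg.windowOf_mem (hsT s s.2)
    rcases hz with rfl | ⟨n, rfl⟩
    · exact hV
    · obtain ⟨K, hK, hKL⟩ := hφL n s s.2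
      refine add_mem_qvSpace hV (K := (r n)⁻¹ * K)
        (mul_nonneg (inv_nonneg.2 (hr0 n).le) hK) fun x x' => ?_
      simp only [ContinuousMap.smul_apply, smul_eq_mul, ← mul_sub]
      rw [abs_mul, abs_of_pos (inv_pos.2 (hr0 n)), mul_assoc]
      exact mul_le_mul_of_nonneg_left (hKL x x') (inv_nonneg.2 (hr0 n).le))
  -- `M` bounds the approximate integrals of the windows and of the perturbed windows
  set M := (∫⁻ s in Icc 0 t, J s).toReal with hM
  obtain ⟨C, hC0, ρ, hρ, hT1⟩ := exists_taylor_bounds hu hS hSc hg ht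
  obtain ⟨C', hC'0, ε₀, hε₀, hbd⟩ := hg.exists_bounds
  have hlim : Tendsto (fun n => r n * (2 * M + C * C' * (t + 1) + 2 * C)) atTop (𝓝 0) := by
    simpa using hrlim.mul_const (2 * M + C * C' * (t + 1) + 2 * C)
  refine squeeze_zero' (.of_forall fun n => mul_nonneg (inv_nonneg.2 (hε n).le)
    (intervalIntegral.integral_nonneg ht0 fun _ _ => abs_nonneg _)) ?_ hlim
  filter_upwards [hrlim.eventually (gt_mem_nhds hρ),
    hε0.eventually (gt_mem_nhds (lt_min hε₀ one_pos))] with n hn1 hn2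
  have hεn := hε n
  have hrn := hr0 n
  set L : ℝ → PathSpace T →L[ℝ] ℝ := fun s => fderiv ℝ (u s) (η s) with hL
  set I : ℝ → ℝ := fun s => detForwardApprox (gradPerp u s (ζ n s)) s (ζ n s) (ε n) with hI
  set I₀ : ℝ → ℝ := fun s => detForwardApprox (gradPerp u s (η s)) s (η s) (ε n) with hI₀
  have hIi : IntegrableOn I (Icc 0 t) := integrableOn_detForwardApprox hu ht (hζc n) _
  have hI₀i : IntegrableOn I₀ (Icc 0 t) :=
    integrableOn_detForwardApprox hu ht hηc.continuousOn _
  have hIM : ∫ s in (0 : ℝ)..t, |I s| ≤ M := integral_abs_le_toReal ht0 hIi hJ fun s hs =>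
    hJb _ hεn s hs _ ⟨(y n, ⟨s, hs⟩), ⟨Or.inr ⟨n, rfl⟩, mem_univ _⟩, rfl⟩
  have hI₀M : ∫ s in (0 : ℝ)..t, |I₀ s| ≤ M := integral_abs_le_toReal ht0 hI₀i hJ fun s hs =>
    hJb _ hεn s hs _ ⟨(y₀, ⟨s, hs⟩), ⟨Or.inl rfl, mem_univ _⟩, rfl⟩
  have hpt : ∀ s ∈ Icc 0 t, (ε n)⁻¹ * |rightPart (L s) s (extIncr (ε n) (φ n s))| ≤
      r n * (|I s| + |I₀ s|) + (C * C' * r n +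
        (C * C' + 2 * C) * (r n)⁻¹ * ((ε n)⁻¹ * hilbertNorm (φ n s) ^ 2)) := by
    intro s hs
    set N := hilbertNorm (φ n s)
    have hN : 0 ≤ N := hilbertNorm_nonneg _
    have hA : hilbertNorm ((r n)⁻¹ • φ n s) = (r n)⁻¹ * N := by
      rw [hilbertNorm_smul, abs_of_pos (inv_pos.2 hrn)]
    set L' := fderiv ℝ (u s) (ζ n s) with hL'
    have h1 := (hT1 s hs (η s) ((r n)⁻¹ • φ n s) (by simpa [hη] using hρ)
      ((hζη n s hs).trans_lt hn1)).1
    rw [hA] at h1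
    have h2 : |rightPart (L' - L s) s (extIncr (ε n) (ζ n s))| ≤
        C * ((r n)⁻¹ * N) * ‖toL2 (extIncr (ε n) (ζ n s))‖ :=
      abs_rightPart_le_of_bound (fun h => by simpa [mul_assoc] using h1 h) (by positivity) _ _
    have h3 : ‖toL2 (extIncr (ε n) (ζ n s))‖ ≤ C' * √(ε n) + 2 * ((r n)⁻¹ * N) := by
      simp only [hζ]
      rw [extIncr_add, map_add, ← hA]
      exact (norm_add_le _ _).trans (add_le_add
        ((hbd _ hεn (hn2.le.trans (min_le_left _ _))).2 s (hsT s hs)).2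
        (norm_toL2_extIncr_le hεn.le (hn2.le.trans (min_le_right _ _)) _))
    -- the integral of the perturbation is the difference of the two integrals, up to the change of
    -- the derivative
    have h4 := rightPart_extIncr_decomp (L s) L' s (ε n) (r n)⁻¹ (η s) (φ n s)
    have e1 : rightPart L' s (extIncr (ε n) (ζ n s)) = ε n * I s := by
      simp only [hI, detForwardApprox_eq]
      rw [mul_inv_cancel_left₀ hεn.ne']
    have e2 : rightPart (L s) s (extIncr (ε n) (η s)) = ε n * I₀ s := by
      simp only [hI₀, detForwardApprox_eq]
      rw [mul_inv_cancel_left₀ hεn.ne']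
    rw [e2] at h4
    change _ = rightPart L' s (extIncr (ε n) (ζ n s)) - _ -
      rightPart (L' - L s) s (extIncr (ε n) (ζ n s)) at h4
    rw [e1] at h4
    set R := rightPart (L s) s (extIncr (ε n) (φ n s))
    set Q := rightPart (L' - L s) s (extIncr (ε n) (ζ n s))
    have h5 : (ε n)⁻¹ * R = r n * (I s - I₀ s - (ε n)⁻¹ * Q) := by
      have : R = r n * ((r n)⁻¹ * R) := by field_simp
      rw [this, h4]
      field_simp
    have h6 : (ε n)⁻¹ * |R| ≤ r n * (|I s| + |I₀ s| + (ε n)⁻¹ * |Q|) := by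
      rw [← abs_of_pos (inv_pos.2 hεn), ← abs_mul, h5, abs_mul, abs_of_pos hrn,
        abs_of_pos (inv_pos.2 hεn)]
      refine mul_le_mul_of_nonneg_left ?_ hrn.le
      refine (abs_sub _ _).trans (add_le_add (abs_sub _ _) ?_)
      rw [abs_mul, abs_of_pos (inv_pos.2 hεn)]
    have h7 : r n * ((ε n)⁻¹ * |Q|) ≤
        C * C' * ((√(ε n))⁻¹ * N) + 2 * C * (r n)⁻¹ * ((ε n)⁻¹ * N ^ 2) := by
      calc r n * ((ε n)⁻¹ * |Q|)
          ≤ r n * ((ε n)⁻¹ * (C * ((r n)⁻¹ * N) * (C' * √(ε n) + 2 * ((r n)⁻¹ * N)))) := by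
            gcongr
            exact h2.trans (by gcongr)
        _ = C * C' * (((ε n)⁻¹ * √(ε n)) * N) + 2 * C * (r n)⁻¹ * ((ε n)⁻¹ * N ^ 2) := by
            field_simp
        _ = _ := by
            congr 4
            rw [inv_mul_eq_div, Real.sqrt_div_self', one_div]
    -- the mixed term is absorbed by Young's inequality
    have h8 := le_add_inv_mul_sq hrn ((√(ε n))⁻¹ * N)
    have e3 : ((√(ε n))⁻¹ * N) ^ 2 = (ε n)⁻¹ * N ^ 2 := by
      rw [mul_pow, inv_pow, Real.sq_sqrt hεn.le]
    rw [e3] at h8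
    have h9 := mul_le_mul_of_nonneg_left h8 (by positivity : 0 ≤ C * C')
    rw [mul_add] at h6
    linarith
  have hi1 : IntervalIntegrable (fun s => |rightPart (L s) s (extIncr (ε n) (φ n s))|)
      volume 0 t := by
    rw [intervalIntegrable_iff_integrableOn_Icc_of_le ht0]
    exact (integrableOn_rightPart (continuousOn_fderiv_along hu ht hηc.continuousOn)
      ((continuous_extIncr _).comp_continuousOn (hφc n))).abs
  have hi2 : IntervalIntegrable (fun s => |I s| + |I₀ s|) volume 0 t := by
    rw [intervalIntegrable_iff_integrableOn_Icc_of_le ht0]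
    exact hIi.abs.add hI₀i.abs
  have hi3 : IntervalIntegrable (fun s => hilbertNorm (φ n s) ^ 2) volume 0 t := by
    refine ContinuousOn.intervalIntegrable ?_
    rw [uIcc_of_le ht0]
    exact (continuous_hilbertNorm.comp_continuousOn (hφc n)).pow 2
  rw [← intervalIntegral.integral_const_mul]
  refine (intervalIntegral.integral_mono_on ht0 (hi1.const_mul _) ((hi2.const_mul _).add
    (intervalIntegrable_const.add ((hi3.const_mul _).const_mul _))) hpt).trans ?_
  rw [intervalIntegral.integral_add (hi2.const_mul _)
    (intervalIntegrable_const.add ((hi3.const_mul _).const_mul _)),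
    intervalIntegral.integral_add intervalIntegrable_const ((hi3.const_mul _).const_mul _),
    intervalIntegral.integral_const_mul, intervalIntegral.integral_const_mul,
    intervalIntegral.integral_const_mul, intervalIntegral.integral_const_mul,
    intervalIntegral.integral_const, smul_eq_mul, sub_zero,
    intervalIntegral.integral_add, mul_assoc (C * C' + 2 * C)]
  · have h1 := mul_le_mul_of_nonneg_left (add_le_add hIM hI₀M) hrn.le
    have h2 := mul_le_mul_of_nonneg_left (hrb n) (by positivity : 0 ≤ C * C' + 2 * C)
    simp only [hb] at h2
    linarith
  · rw [intervalIntegrable_iff_integrableOn_Icc_of_le ht0]; exact hIi.abs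
  · rw [intervalIntegrable_iff_integrableOn_Icc_of_le ht0]; exact hI₀i.abs

end SmallPerturbation

/-! ### The contribution of the future at the right end of the window -/

section Spread

lemma abs_sum_le_of_disjoint {ι : Type*} {s : Finset ι} {a : ι → ℝ} {M : ℝ} (hM : 0 ≤ M)
    (h : ∀ i ∈ s, |a i| ≤ M) (hd : ∀ i ∈ s, ∀ j ∈ s, a i ≠ 0 → a j ≠ 0 → i = j) :
    |∑ i ∈ s, a i| ≤ M := by
  by_cases h0 : ∀ i ∈ s, a i = 0
  · rwa [Finset.sum_eq_zero h0, abs_zero]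
  · push Not at h0
    obtain ⟨i, hi, hai⟩ := h0
    rw [Finset.sum_eq_single_of_mem i hi fun j hj hji => ?_]
    · exact h i hi
    · by_contra haj
      exact hji (hd j hj i hi haj hai)

lemma sq_sum_of_disjoint {ι : Type*} {s : Finset ι} {a : ι → ℝ}
    (hd : ∀ i ∈ s, ∀ j ∈ s, a i ≠ 0 → a j ≠ 0 → i = j) :
    (∑ i ∈ s, a i) ^ 2 = ∑ i ∈ s, a i ^ 2 := by
  by_cases h0 : ∀ i ∈ s, a i = 0
  · rw [Finset.sum_eq_zero h0, Finset.sum_eq_zero fun i hi => by rw [h0 i hi]; simp]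
    simp
  · push Not at h0
    obtain ⟨i, hi, hai⟩ := h0
    have h1 : ∀ j ∈ s, j ≠ i → a j = 0 := fun j hj hji => by
      by_contra haj
      exact hji (hd j hj i hi haj hai)
    rw [Finset.sum_eq_single_of_mem i hi h1,
      Finset.sum_eq_single_of_mem i hi fun j hj hji => by rw [h1 j hj hji]; simp]

variable {T : ℝ} [hT : Fact (0 < T)]

/-- The restriction to `[-T, 0]` of a function on the line. -/
def restr (T : ℝ) (f : C(ℝ, ℝ)) : PathSpace T := ⟨fun x => f x, by fun_prop⟩

/-- The function `-∑_{j < N} (1 - j / N) f(· + j ε)` on `[-T, 0]`. If `f` vanishes outside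
`]-ε, 0[`, then its increment at scale `ε` is `f`, up to an average of `N` translates of `f` with
disjoint supports. -/
noncomputable def spread (T ε : ℝ) (N : ℕ) (f : C(ℝ, ℝ)) : PathSpace T :=
  ⟨fun x => -∑ j ∈ Finset.range N, (1 - j / N : ℝ) * f (x + j * ε), by fun_prop⟩

/-- The average of the translates `f(· + (j + 1) ε)`, `j < N`. -/
noncomputable def translateMean (T ε : ℝ) (N : ℕ) (f : C(ℝ, ℝ)) : PathSpace T :=
  ⟨fun x => (N : ℝ)⁻¹ * ∑ j ∈ Finset.range N, f (x + (j + 1 : ℕ) * ε), by fun_prop⟩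

variable {ε : ℝ} {N : ℕ} {f : C(ℝ, ℝ)}

lemma eq_of_shift_ne_zero (hε : 0 < ε) (hf : ∀ y, y ∉ Ioo (-ε) 0 → f y = 0) {x : ℝ} {i j : ℕ}
    (hi : f (x + i * ε) ≠ 0) (hj : f (x + j * ε) ≠ 0) : i = j := by
  have hi' : x + i * ε ∈ Ioo (-ε) 0 := by by_contra h; exact hi (hf _ h)
  have hj' : x + j * ε ∈ Ioo (-ε) 0 := by by_contra h; exact hj (hf _ h)
  have h1 : (i : ℝ) < j + 1 := by
    by_contra h
    push Not at h
    nlinarith [hi'.2, hj'.1, mul_le_mul_of_nonneg_right h hε.le]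
  have h2 : (j : ℝ) < i + 1 := by
    by_contra h
    push Not at h
    nlinarith [hj'.2, hi'.1, mul_le_mul_of_nonneg_right h hε.le]
  have h3 : i < j + 1 := by exact_mod_cast h1
  have h4 : j < i + 1 := by exact_mod_cast h2
  omega

lemma weight_mem {j : ℕ} (hj : j ∈ Finset.range N) : 0 ≤ (1 - j / N : ℝ) ∧ (1 - j / N : ℝ) ≤ 1 := by
  have h1 : (j : ℝ) ≤ N := by exact_mod_cast (Finset.mem_range.1 hj).le
  have h2 : (j : ℝ) / N ≤ 1 := div_le_one_of_le₀ h1 (by positivity)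
  have h3 : 0 ≤ (j : ℝ) / N := by positivity
  constructor <;> linarith

lemma norm_spread_le (hε : 0 < ε) (hf : ∀ y, y ∉ Ioo (-ε) 0 → f y = 0) {M : ℝ}
    (hM : ∀ y, |f y| ≤ M) : ‖spread T ε N f‖ ≤ M := by
  have hM0 : 0 ≤ M := (abs_nonneg _).trans (hM 0)
  refine (ContinuousMap.norm_le _ hM0).2 fun x => ?_
  change |-∑ j ∈ Finset.range N, (1 - j / N : ℝ) * f (x + j * ε)| ≤ M
  rw [abs_neg]
  refine abs_sum_le_of_disjoint hM0 (fun j hj => ?_) fun i _ j _ hi hj =>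
    eq_of_shift_ne_zero hε hf (right_ne_zero_of_mul hi) (right_ne_zero_of_mul hj)
  rw [abs_mul, abs_of_nonneg (weight_mem hj).1]
  exact (mul_le_of_le_one_left (abs_nonneg _) (weight_mem hj).2).trans (hM _)

lemma norm_translateMean_le (hε : 0 < ε) (hf : ∀ y, y ∉ Ioo (-ε) 0 → f y = 0) {M : ℝ}
    (hM : ∀ y, |f y| ≤ M) : ‖translateMean T ε N f‖ ≤ (N : ℝ)⁻¹ * M := by
  have hM0 : 0 ≤ M := (abs_nonneg _).trans (hM 0)
  refine (ContinuousMap.norm_le _ (by positivity)).2 fun x => ?_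
  change |(N : ℝ)⁻¹ * ∑ j ∈ Finset.range N, f (x + (j + 1 : ℕ) * ε)| ≤ _
  rw [abs_mul, abs_of_nonneg (by positivity : 0 ≤ (N : ℝ)⁻¹)]
  refine mul_le_mul_of_nonneg_left ?_ (by positivity)
  refine abs_sum_le_of_disjoint hM0 (fun j _ => hM _) fun i _ j _ hi hj => ?_
  exact Nat.succ_injective (eq_of_shift_ne_zero hε hf hi hj)

lemma extend_spread (hε : 0 < ε) (hf : ∀ y, y ∉ Ioo (-ε) 0 → f y = 0) {y : ℝ} (hy : -T ≤ y) :
    extend (spread T ε N f) y = -∑ j ∈ Finset.range N, (1 - j / N : ℝ) * f (y + j * ε) := by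
  rcases le_total y 0 with h | h
  · exact extend_coe (spread T ε N f) ⟨y, hy, h⟩
  · rw [extend_of_nonneg _ h]
    have h0 : ∀ z : ℝ, 0 ≤ z → ∀ j : ℕ, f (z + j * ε) = 0 := fun z hz j => hf _ fun h' => by
      have : 0 ≤ z + j * ε := by positivity
      linarith [h'.2]
    change -∑ j ∈ Finset.range N, (1 - j / N : ℝ) * f (0 + j * ε) = _
    simp only [h0 0 le_rfl, h0 y h]

lemma extIncr_spread (hε : 0 < ε) (hN : N ≠ 0) (hf : ∀ y, y ∉ Ioo (-ε) 0 → f y = 0) :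
    extIncr ε (spread T ε N f) = restr T f - translateMean T ε N f := by
  ext x
  have hx := x.2.1
  rw [extIncr_apply, ← extend_coe, extend_spread hε hf (by linarith), extend_spread hε hf hx]
  change _ = f x - (N : ℝ)⁻¹ * ∑ j ∈ Finset.range N, f (x + (j + 1 : ℕ) * ε)
  have h1 := Finset.sum_range_sub (fun j : ℕ => (1 - j / N : ℝ) * f (x + j * ε)) N
  have hN' : (N : ℝ) ≠ 0 := by exact_mod_cast hN
  simp only [div_self hN', sub_self, zero_mul, Nat.cast_zero, zero_div, sub_zero, one_mul,
    add_zero] at h1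
  have h2 : ∀ j ∈ Finset.range N, (1 - j / N : ℝ) * f (x + ε + j * ε) =
      ((1 - (j + 1 : ℕ) / N : ℝ) * f (x + (j + 1 : ℕ) * ε) - (1 - j / N : ℝ) * f (x + j * ε)) +
        ((1 - j / N : ℝ) * f (x + j * ε) + (N : ℝ)⁻¹ * f (x + (j + 1 : ℕ) * ε)) := by
    intro j _
    rw [show (x : ℝ) + ε + j * ε = x + (j + 1 : ℕ) * ε by push_cast; ring]
    push_cast
    field_simp
    ring
  rw [Finset.sum_congr rfl h2, Finset.sum_add_distrib, h1, Finset.sum_add_distrib,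
    ← Finset.mul_sum]
  ring

lemma integral_sq_shift_le {a b : ℝ} (hab : a ≤ b) (hf : ∀ y, y ∉ Ioo a b → f y = 0) (c : ℝ) :
    ∫ x in (-T)..0, f (x + c) ^ 2 ≤ ∫ y in a..b, f y ^ 2 := by
  have hT' := hT.out
  rw [intervalIntegral.integral_comp_add_right (fun y => f y ^ 2)]
  have hfc := f.continuous
  have hcs : HasCompactSupport fun y => f y ^ 2 :=
    HasCompactSupport.intro (isCompact_Icc (a := a) (b := b)) fun y hy => by
      rw [hf y fun h => hy ⟨h.1.le, h.2.le⟩]; simp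
  have hi : Integrable fun y => f y ^ 2 := Continuous.integrable_of_hasCompactSupport
    (by fun_prop) hcs
  rw [intervalIntegral.integral_of_le (by linarith), intervalIntegral.integral_of_le hab,
    setIntegral_eq_integral_of_forall_compl_eq_zero (s := Ioc a b) fun y hy => by
      rw [hf y fun h => hy ⟨h.1, h.2.le⟩]; simp]
  exact setIntegral_le_integral hi (.of_forall fun _ => sq_nonneg _)

lemma hilbertNorm_spread_le (hε : 0 < ε) (hf : ∀ y, y ∉ Ioo (-ε) 0 → f y = 0) :
    hilbertNorm (spread T ε N f) ^ 2 ≤ N * ∫ y in (-ε)..0, f y ^ 2 := by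
  have h0 : spread T ε N f zeroPt = 0 := by
    change -∑ j ∈ Finset.range N, (1 - j / N : ℝ) * f (0 + j * ε) = 0
    rw [Finset.sum_eq_zero, neg_zero]
    intro j _
    rw [hf _ fun h' => ?_, mul_zero]
    have : 0 ≤ 0 + j * ε := by positivity
    linarith [h'.2]
  unfold hilbertNorm
  have hT' := hT.out
  rw [h0, abs_zero, zero_add, norm_toL2_sq_eq _
    (fun x => -∑ j ∈ Finset.range N, (1 - j / N : ℝ) * f (x + j * ε)) fun x => rfl]
  calc ∫ x in (-T)..0, (-∑ j ∈ Finset.range N, (1 - j / N : ℝ) * f (x + j * ε)) ^ 2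
      ≤ ∫ x in (-T)..0, ∑ j ∈ Finset.range N, f (x + j * ε) ^ 2 := by
        refine intervalIntegral.integral_mono_on (by linarith)
          (Continuous.intervalIntegrable (by fun_prop) _ _)
          (Continuous.intervalIntegrable (by fun_prop) _ _) fun x _ => ?_
        rw [neg_sq, sq_sum_of_disjoint fun i _ j _ hi hj => eq_of_shift_ne_zero hε hf
          (right_ne_zero_of_mul hi) (right_ne_zero_of_mul hj)]
        refine Finset.sum_le_sum fun j hj => ?_
        rw [mul_pow]
        exact mul_le_of_le_one_left (sq_nonneg _)
          (pow_le_one₀ (weight_mem hj).1 (weight_mem hj).2)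
    _ = ∑ j ∈ Finset.range N, ∫ x in (-T)..0, f (x + j * ε) ^ 2 :=
        intervalIntegral.integral_finsetSum fun j _ =>
          Continuous.intervalIntegrable (by fun_prop) _ _
    _ ≤ ∑ j ∈ Finset.range N, ∫ y in (-ε)..0, f y ^ 2 :=
        Finset.sum_le_sum fun j _ => integral_sq_shift_le (by linarith) hf _
    _ = _ := by simp

lemma abs_spread_sub_le {K : ℝ} (hK : ∀ x y, |f x - f y| ≤ K * |x - y|)
    (x y : Icc (-T) (0 : ℝ)) :
    |spread T ε N f x - spread T ε N f y| ≤ N * K * |(x : ℝ) - y| := by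
  change |-∑ j ∈ Finset.range N, (1 - j / N : ℝ) * f (x + j * ε) -
    -∑ j ∈ Finset.range N, (1 - j / N : ℝ) * f (y + j * ε)| ≤ _
  rw [neg_sub_neg, ← Finset.sum_sub_distrib]
  refine (Finset.abs_sum_le_sum_abs _ _).trans ?_
  calc ∑ j ∈ Finset.range N, |(1 - j / N : ℝ) * f (y + j * ε) - (1 - j / N : ℝ) * f (x + j * ε)|
      ≤ ∑ j ∈ Finset.range N, K * |(x : ℝ) - y| := by
        refine Finset.sum_le_sum fun j hj => ?_
        rw [← mul_sub, abs_mul, abs_of_nonneg (weight_mem hj).1]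
        refine (mul_le_of_le_one_left (abs_nonneg _) (weight_mem hj).2).trans ?_
        have := hK (y + j * ε) (x + j * ε)
        rwa [add_sub_add_right_eq_sub, abs_sub_comm (y : ℝ)] at this
    _ = _ := by simp [mul_assoc]

variable {σ : ℝ} {u : ℝ → PathSpace T → ℝ} {S : ℝ → PathSpace T → Chi0 T} {g : C(ℝ, ℝ)} {t : ℝ}

lemma exists_bound_fderiv_along (hu : IsC12 u) (ht : t ∈ Ico 0 T) {ζ : ℝ → PathSpace T}
    (hζ : ContinuousOn ζ (Icc 0 t)) : ∃ B, 0 ≤ B ∧ ∀ s ∈ Icc 0 t, ‖fderiv ℝ (u s) (ζ s)‖ ≤ B := by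
  have hLn : ContinuousOn (fun s => ‖fderiv ℝ (u s) (ζ s)‖) (Icc 0 t) :=
    (continuous_norm (E := PathSpace T →L[ℝ] ℝ)).comp_continuousOn
      (continuousOn_fderiv_along hu ht hζ)
  obtain ⟨B, hB⟩ := isCompact_Icc.exists_bound_of_continuousOn hLn
  exact ⟨B, (norm_nonneg _).trans (hB 0 ⟨le_rfl, ht.1⟩), fun s hs => (le_abs_self _).trans (hB s hs)⟩

/-- Functions concentrated on `]-ε, 0[` give a negligible contribution: such a function is, up to a
small average of its translates, the increment at scale `ε` of the function `spread`, to which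
`tendsto_integral_rightPart_extIncr` applies. -/
lemma tendsto_integral_rightPart_of_local (hu : IsC12 u)
    (hS : ∀ t ∈ Ico 0 T, ∀ η ∈ qvSpace T (fun t => σ ^ 2 * t) t, ∀ f g : PathSpace T,
      fderiv ℝ (fderiv ℝ (u t)) η f g = (S t η).form f g)
    (hSc : ContinuousOn (fun p : ℝ × PathSpace T => S p.1 p.2)
      {p | p.1 ∈ Ico 0 T ∧ p.2 ∈ qvSpace T (fun t => σ ^ 2 * t) p.1})
    (hC : ConditionC (fun t => σ ^ 2 * t) u) (hg : HasQV T σ g) (ht : t ∈ Ico 0 T)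
    {ε : ℕ → ℝ} (hε : ∀ n, 0 < ε n) (hε0 : Tendsto ε atTop (𝓝 0))
    {f : ℕ → ℝ → C(ℝ, ℝ)} (hfc : ∀ n, Continuous fun p : ℝ × ℝ => f n p.1 p.2)
    (hfv : ∀ n s y, y ∉ Ioo (-ε n) 0 → f n s y = 0)
    (hfL : ∀ n s, ∃ K, 0 ≤ K ∧ ∀ x y, |f n s x - f n s y| ≤ K * |x - y|)
    {M : ℕ → ℝ} (hM : Tendsto M atTop (𝓝 0)) (hfM : ∀ n s y, |f n s y| ≤ M n) {C : ℝ}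
    (hf2 : ∀ᶠ n in atTop,
      ∫ s in (0 : ℝ)..t, ∫ y in (-ε n)..0, f n s y ^ 2 ≤ C * ε n ^ 2) :
    Tendsto (fun n => (ε n)⁻¹ * ∫ s in (0 : ℝ)..t,
      |rightPart (fderiv ℝ (u s) (windowOf T g s)) s (restr T (f n s))|) atTop (𝓝 0) := by
  have ht0 := ht.1
  have hM0 : ∀ n, 0 ≤ M n := fun n => (abs_nonneg _).trans (hfM n 0 0)
  -- the number `N` of translates: `N ε` tends to `0`, but `M / (N ε)` does so as well
  set m : ℕ → ℝ := fun n => √(M n + ε n) with hm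
  have hm2 : ∀ n, m n ^ 2 = M n + ε n := fun n => Real.sq_sqrt (add_nonneg (hM0 n) (hε n).le)
  have hmpos : ∀ n, 0 < m n := fun n => Real.sqrt_pos.2 (add_pos_of_nonneg_of_pos (hM0 n) (hε n))
  have hmlim : Tendsto m atTop (𝓝 0) := by
    have := (hM.add hε0).sqrt
    rwa [add_zero, Real.sqrt_zero] at this
  set N : ℕ → ℕ := fun n => ⌈m n / ε n⌉₊ with hN
  have hN1 : ∀ n, m n ≤ N n * ε n := fun n => (div_le_iff₀ (hε n)).1 (Nat.le_ceil _)
  have hN2 : ∀ n, N n * ε n ≤ m n + ε n := fun n => by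
    have h1 := (Nat.ceil_lt_add_one (div_nonneg (hmpos n).le (hε n).le)).le
    have h2 := mul_le_mul_of_nonneg_right h1 (hε n).le
    rwa [add_mul, div_mul_cancel₀ _ (hε n).ne', one_mul] at h2
  have hNpos : ∀ n, 0 < (N n : ℝ) := fun n =>
    pos_of_mul_pos_left ((hmpos n).trans_le (hN1 n)) (hε n).le
  set φ : ℕ → ℝ → PathSpace T := fun n s => spread T (ε n) (N n) (f n s) with hφ
  have hφc : ∀ n, Continuous (φ n) := fun n => by
    refine ContinuousMap.continuous_of_continuous_uncurry _ ?_
    change Continuous fun p : ℝ × Icc (-T) (0 : ℝ) =>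
      -∑ j ∈ Finset.range (N n), (1 - j / N n : ℝ) * f n p.1 (p.2 + j * ε n)
    have := hfc n
    refine Continuous.neg (continuous_finsetSum _ fun j _ => continuous_const.mul ?_)
    exact this.comp (f := fun p : ℝ × Icc (-T) (0 : ℝ) => (p.1, (p.2 : ℝ) + j * ε n)) (by fun_prop)
  have hrc : ∀ n, Continuous fun s => restr T (f n s) := fun n => by
    refine ContinuousMap.continuous_of_continuous_uncurry _ ?_
    exact (hfc n).comp (f := fun p : ℝ × Icc (-T) (0 : ℝ) => (p.1, (p.2 : ℝ))) (by fun_prop)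
  have hfi : ∀ n, Continuous fun s => ∫ y in (-ε n)..0, f n s y ^ 2 := fun n =>
    intervalIntegral.continuous_parametric_intervalIntegral_of_continuous'
      (f := fun s y => f n s y ^ 2)
      (show Continuous fun p : ℝ × ℝ => f n p.1 p.2 ^ 2 from (hfc n).pow 2) _ _
  have hφN : Tendsto (fun n => (ε n)⁻¹ * ∫ s in (0 : ℝ)..t, hilbertNorm (φ n s) ^ 2) atTop
      (𝓝 0) := by
    have hlim : Tendsto (fun n => C * (m n + ε n)) atTop (𝓝 0) := by
      simpa using (hmlim.add hε0).const_mul C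
    refine squeeze_zero' (.of_forall fun n => mul_nonneg (inv_nonneg.2 (hε n).le)
      (intervalIntegral.integral_nonneg ht0 fun _ _ => sq_nonneg _)) ?_ hlim
    filter_upwards [hf2] with n hn
    have hεn := hε n
    have h0 : 0 ≤ ∫ s in (0 : ℝ)..t, ∫ y in (-ε n)..0, f n s y ^ 2 :=
      intervalIntegral.integral_nonneg ht0 fun s _ =>
        intervalIntegral.integral_nonneg (by linarith) fun _ _ => sq_nonneg _
    have hC0 : 0 ≤ C := by
      by_contra h
      push Not at h
      nlinarith [pow_pos hεn 2]
    have h1 : ∫ s in (0 : ℝ)..t, hilbertNorm (φ n s) ^ 2 ≤ N n * (C * ε n ^ 2) := by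
      calc ∫ s in (0 : ℝ)..t, hilbertNorm (φ n s) ^ 2
          ≤ ∫ s in (0 : ℝ)..t, N n * ∫ y in (-ε n)..0, f n s y ^ 2 := by
            refine intervalIntegral.integral_mono_on ht0 ?_
              (Continuous.intervalIntegrable (continuous_const.mul (hfi n)) _ _)
              fun s _ => hilbertNorm_spread_le hεn (hfv n s)
            exact Continuous.intervalIntegrable ((continuous_hilbertNorm.comp (hφc n)).pow 2) _ _
        _ ≤ _ := by
            rw [intervalIntegral.integral_const_mul]
            exact mul_le_mul_of_nonneg_left hn (hNpos n).le
    calc (ε n)⁻¹ * ∫ s in (0 : ℝ)..t, hilbertNorm (φ n s) ^ 2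
        ≤ (ε n)⁻¹ * (N n * (C * ε n ^ 2)) := by gcongr
      _ = C * (N n * ε n) := by field_simp
      _ ≤ _ := mul_le_mul_of_nonneg_left (hN2 n) hC0
  have hJ := tendsto_integral_rightPart_extIncr hu hS hSc hC hg ht hε hε0
    (fun n => (hφc n).continuousOn) (fun n s _ => by
      obtain ⟨K, hK, hKL⟩ := hfL n s
      exact ⟨N n * K, by positivity, fun x y => abs_spread_sub_le hKL x y⟩) hM
    (fun n s _ => norm_spread_le (hε n) (hfv n s) (hfM n s)) hφN
  obtain ⟨B, hB0, hB⟩ := exists_bound_fderiv_along hu ht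
    (continuous_windowOf (T := T) g).continuousOn
  have hlim := hJ.add ((hmlim.const_mul (B * t)))
  rw [mul_zero, add_zero] at hlim
  refine squeeze_zero (fun n => mul_nonneg (inv_nonneg.2 (hε n).le)
    (intervalIntegral.integral_nonneg ht0 fun _ _ => abs_nonneg _)) (fun n => ?_) hlim
  have hεn := hε n
  have hL := continuousOn_fderiv_along hu ht (continuous_windowOf (T := T) g).continuousOn
  have hi1 : IntervalIntegrable (fun s =>
      |rightPart (fderiv ℝ (u s) (windowOf T g s)) s (restr T (f n s))|) volume 0 t := by
    rw [intervalIntegrable_iff_integrableOn_Icc_of_le ht0]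
    exact (integrableOn_rightPart hL (hrc n).continuousOn).abs
  have hi2 : IntervalIntegrable (fun s =>
      |rightPart (fderiv ℝ (u s) (windowOf T g s)) s (extIncr (ε n) (φ n s))|) volume 0 t := by
    rw [intervalIntegrable_iff_integrableOn_Icc_of_le ht0]
    exact (integrableOn_rightPart hL ((continuous_extIncr _).comp (hφc n)).continuousOn).abs
  have h1 : ∫ s in (0 : ℝ)..t, |rightPart (fderiv ℝ (u s) (windowOf T g s)) s (restr T (f n s))| ≤
      ∫ s in (0 : ℝ)..t,
        (|rightPart (fderiv ℝ (u s) (windowOf T g s)) s (extIncr (ε n) (φ n s))| +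
          B * ((N n : ℝ)⁻¹ * M n)) := by
    refine intervalIntegral.integral_mono_on ht0 hi1 (hi2.add intervalIntegrable_const)
      fun s hs => ?_
    have e : restr T (f n s) = extIncr (ε n) (φ n s) + translateMean T (ε n) (N n) (f n s) := by
      simp only [hφ]
      rw [extIncr_spread hεn (by exact_mod_cast (hNpos n).ne') (hfv n s), sub_add_cancel]
    rw [e, rightPart_add]
    refine (abs_add_le _ _).trans (add_le_add le_rfl ((abs_rightPart_le _ _ _).trans ?_))
    exact mul_le_mul (hB s hs) (norm_translateMean_le hεn (hfv n s) (hfM n s)) (norm_nonneg _) hB0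
  rw [intervalIntegral.integral_add hi2 intervalIntegrable_const,
    intervalIntegral.integral_const, smul_eq_mul, sub_zero] at h1
  refine (mul_le_mul_of_nonneg_left h1 (inv_nonneg.2 hεn.le)).trans ?_
  rw [mul_add]
  refine add_le_add le_rfl ?_
  have h2 : (ε n)⁻¹ * ((N n : ℝ)⁻¹ * M n) ≤ m n := by
    rw [← mul_assoc, ← mul_inv, mul_comm (ε n), inv_mul_le_iff₀ (mul_pos (hNpos n) hεn)]
    have := mul_le_mul_of_nonneg_right (hN1 n) (hmpos n).le
    nlinarith [hm2 n]
  calc (ε n)⁻¹ * (t * (B * ((N n : ℝ)⁻¹ * M n))) =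
        B * t * ((ε n)⁻¹ * ((N n : ℝ)⁻¹ * M n)) := by ring
    _ ≤ _ := by gcongr

end Spread

section Future

lemma integral_integral_swap_of_continuous {F : ℝ → ℝ → ℝ}
    (hF : Continuous fun p : ℝ × ℝ => F p.1 p.2) (a b c d : ℝ) :
    ∫ x in a..b, ∫ y in c..d, F x y = ∫ y in c..d, ∫ x in a..b, F x y := by
  refine intervalIntegral_intervalIntegral_swap ?_
  refine (hF.continuousOn.integrableOn_compact
    (isCompact_uIcc.prod isCompact_uIcc : IsCompact (uIcc a b ×ˢ uIcc c d))).mono_set ?_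
  exact prod_mono uIoc_subset_uIcc uIoc_subset_uIcc

/-- A cutoff equal to `1` on `]-∞, -1/k]` and to `0` on `[0, ∞[`. -/
noncomputable def negCut (k : ℕ) (y : ℝ) : ℝ := max 0 (min 1 (-(k * y)))

lemma continuous_negCut (k : ℕ) : Continuous (negCut k) := by unfold negCut; fun_prop

lemma negCut_mem (k : ℕ) (y : ℝ) : 0 ≤ negCut k y ∧ negCut k y ≤ 1 :=
  ⟨le_max_left _ _, max_le zero_le_one (min_le_left _ _)⟩

lemma negCut_of_nonneg (k : ℕ) {y : ℝ} (hy : 0 ≤ y) : negCut k y = 0 := by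
  have : 0 ≤ k * y := by positivity
  exact max_eq_left ((min_le_right _ _).trans (by linarith))

lemma abs_negCut_sub_le (k : ℕ) (x y : ℝ) : |negCut k x - negCut k y| ≤ k * |x - y| := by
  unfold negCut
  refine (abs_max_sub_max_le_max _ _ _ _).trans ?_
  rw [sub_self, abs_zero]
  refine max_le (by positivity) ((abs_min_sub_min_le_max _ _ _ _).trans ?_)
  rw [sub_self, abs_zero]
  refine max_le (by positivity) (le_of_eq ?_)
  rw [neg_sub_neg, ← mul_sub, abs_mul, Nat.abs_cast, abs_sub_comm]

lemma tendsto_negCut {y : ℝ} (hy : y < 0) : Tendsto (fun k => negCut k y) atTop (𝓝 1) := by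
  refine tendsto_const_nhds.congr' ?_
  obtain ⟨N, hN⟩ := exists_nat_gt (1 / -y)
  filter_upwards [eventually_ge_atTop N] with k hk
  have h1 : 1 / -y < k := hN.trans_le (by exact_mod_cast hk)
  rw [div_lt_iff₀ (by linarith)] at h1
  unfold negCut
  rw [min_eq_left (by linarith), max_eq_right zero_le_one]

variable {T : ℝ} [hT : Fact (0 < T)]

/-- The function `y ↦ p(s + (y + ε)⁺) - p(s)` of future increments, cut off near `0`. -/
noncomputable def localIncr (ε : ℝ) (k : ℕ) (p : C(ℝ, ℝ)) (s : ℝ) : C(ℝ, ℝ) :=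
  ⟨fun y => negCut k y * (p (s + max (y + ε) 0) - p s), by
    have := continuous_negCut k; fun_prop⟩

lemma localIncr_apply (ε : ℝ) (k : ℕ) (p : C(ℝ, ℝ)) (s y : ℝ) :
    localIncr ε k p s y = negCut k y * (p (s + max (y + ε) 0) - p s) := rfl

lemma continuous_localIncr (ε : ℝ) (k : ℕ) (p : C(ℝ, ℝ)) :
    Continuous fun z : ℝ × ℝ => localIncr ε k p z.1 z.2 := by
  have := continuous_negCut k
  simp only [localIncr_apply]
  fun_prop

lemma localIncr_of_notMem {ε : ℝ} {k : ℕ} {p : C(ℝ, ℝ)} {s y : ℝ} (hy : y ∉ Ioo (-ε) 0) :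
    localIncr ε k p s y = 0 := by
  rw [localIncr_apply]
  rcases le_or_gt 0 y with h | h
  · rw [negCut_of_nonneg k h, zero_mul]
  · have : y ≤ -ε := by by_contra h'; exact hy ⟨not_le.1 h', h⟩
    rw [max_eq_right (by linarith), add_zero, sub_self, mul_zero]

lemma abs_localIncr_le {ε : ℝ} {k : ℕ} {p : C(ℝ, ℝ)} {s y M : ℝ} (hM : 0 ≤ M)
    (h : y ∈ Ioo (-ε) 0 → |p (s + (y + ε)) - p s| ≤ M) : |localIncr ε k p s y| ≤ M := by
  by_cases hy : y ∈ Ioo (-ε) 0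
  · rw [localIncr_apply, abs_mul, abs_of_nonneg (negCut_mem k y).1,
      max_eq_left (by linarith [hy.1])]
    exact (mul_le_of_le_one_left (abs_nonneg _) (negCut_mem k y).2).trans (h hy)
  · rwa [localIncr_of_notMem hy, abs_zero]

lemma lipschitz_localIncr {p : C(ℝ, ℝ)} {K D : ℝ} (hp : ∀ x y, |p x - p y| ≤ K * |x - y|)
    (hK : 0 ≤ K) (hD : ∀ x, |p x| ≤ D) (ε : ℝ) (k : ℕ) (s x y : ℝ) :
    |localIncr ε k p s x - localIncr ε k p s y| ≤ (k * (D + D) + K) * |x - y| := by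
  simp only [localIncr_apply]
  set a := p (s + max (x + ε) 0)
  set b := p (s + max (y + ε) 0)
  have h1 : |a - b| ≤ K * |x - y| := by
    refine (hp _ _).trans (mul_le_mul_of_nonneg_left ?_ hK)
    rw [add_sub_add_left_eq_sub]
    refine (abs_max_sub_max_le_abs _ _ _).trans (le_of_eq ?_)
    rw [add_sub_add_right_eq_sub]
  have h2 : |a - p s| ≤ D + D := (abs_sub _ _).trans (add_le_add (hD _) (hD _))
  have e : negCut k x * (a - p s) - negCut k y * (b - p s) =
      (negCut k x - negCut k y) * (a - p s) + negCut k y * (a - b) := by ring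
  rw [e]
  refine (abs_add_le _ _).trans ?_
  rw [abs_mul, abs_mul, abs_of_nonneg (negCut_mem k y).1]
  have h3 := mul_le_mul (abs_negCut_sub_le k x y) h2 (abs_nonneg _) (by positivity)
  have h4 := (mul_le_of_le_one_left (abs_nonneg _) (negCut_mem k y).2).trans h1
  linarith

variable {σ : ℝ} {u : ℝ → PathSpace T → ℝ} {S : ℝ → PathSpace T → Chi0 T} {g : C(ℝ, ℝ)} {t : ℝ}

lemma continuous_restr_localIncr (ε : ℝ) (k : ℕ) (p : C(ℝ, ℝ)) :
    Continuous fun s => restr T (localIncr ε k p s) := by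
  refine ContinuousMap.continuous_of_continuous_uncurry _ ?_
  exact (continuous_localIncr ε k p).comp (f := fun z : ℝ × Icc (-T) (0 : ℝ) => (z.1, (z.2 : ℝ)))
    (by fun_prop)

lemma continuous_futureIncr (ε : ℝ) (p : C(ℝ, ℝ)) : Continuous (futureIncr T ε p) := by
  refine ContinuousMap.continuous_of_continuous_uncurry _ ?_
  change Continuous fun z : ℝ × Icc (-T) (0 : ℝ) => p (z.1 + max (z.2 + ε) 0) - p z.1
  fun_prop

/-- The measures `Du({· ≠ 0})` do not see the cutoff near `0`. -/
lemma tendsto_integral_cutoff (hu : IsC12 u) (ht : t ∈ Ico 0 T) (ε : ℝ) {p : C(ℝ, ℝ)} {D : ℝ}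
    (hD : ∀ x, |p x| ≤ D) :
    Tendsto (fun k => ∫ s in (0 : ℝ)..t, |rightPart (fderiv ℝ (u s) (windowOf T g s)) s
      (futureIncr T ε p s - restr T (localIncr ε k p s) : PathSpace T)|) atTop (𝓝 0) := by
  have ht0 := ht.1
  have hD0 : 0 ≤ D := (abs_nonneg _).trans (hD 0)
  have hL := continuousOn_fderiv_along hu ht (continuous_windowOf (T := T) g).continuousOn
  obtain ⟨B, hB0, hB⟩ := exists_bound_fderiv_along hu ht
    (continuous_windowOf (T := T) g).continuousOn
  have hval : ∀ k s (x : Icc (-T) (0 : ℝ)), (futureIncr T ε p s - restr T (localIncr ε k p s)) x =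
      (1 - negCut k x) * futureIncr T ε p s x := fun k s x => by
    change futureIncr T ε p s x - negCut k x * futureIncr T ε p s x = _
    ring
  have hb : ∀ k s (x : Icc (-T) (0 : ℝ)),
      |(futureIncr T ε p s - restr T (localIncr ε k p s)) x| ≤ D + D := fun k s x => by
    rw [hval, abs_mul, abs_of_nonneg (by linarith [(negCut_mem k x).2])]
    refine (mul_le_of_le_one_left (abs_nonneg _) (by linarith [(negCut_mem k x).1])).trans ?_
    exact (abs_sub _ _).trans (add_le_add (hD _) (hD _))
  have hzero : ∀ s : ℝ, rightPart (fderiv ℝ (u s) (windowOf T g s)) s (0 : PathSpace T) = 0 :=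
    fun s => by
      have := abs_rightPart_le (fderiv ℝ (u s) (windowOf T g s)) s 0
      rw [norm_zero, mul_zero] at this
      exact abs_eq_zero.1 (le_antisymm this (abs_nonneg _))
  have := intervalIntegral.tendsto_integral_filter_of_dominated_convergence (μ := volume)
    (a := 0) (b := t) (l := atTop) (F := fun (k : ℕ) s =>
      |rightPart (fderiv ℝ (u s) (windowOf T g s)) s
      (futureIncr T ε p s - restr T (localIncr ε k p s) : PathSpace T)|) (f := fun _ => 0)
    (fun _ => B * (D + D)) (.of_forall fun k => ?_) (.of_forall fun k => .of_forall fun s hs => ?_)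
    intervalIntegrable_const (.of_forall fun s hs => ?_)
  · simpa using this
  · rw [uIoc_of_le ht0]
    have h := (integrableOn_rightPart hL ((continuous_futureIncr (T := T) ε p).sub
      (continuous_restr_localIncr ε k p)).continuousOn).mono_set Ioc_subset_Icc_self
    exact h.abs.aestronglyMeasurable
  · rw [uIoc_of_le ht0] at hs
    rw [Real.norm_eq_abs, abs_abs]
    refine (abs_rightPart_le _ _ _).trans (mul_le_mul (hB s ⟨hs.1.le, hs.2⟩) ?_ (norm_nonneg _) hB0)
    exact (ContinuousMap.norm_le _ (by positivity)).2 fun x => hb k s x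
  · have h0 : (0 : ℝ) = |rightPart (fderiv ℝ (u s) (windowOf T g s)) s (0 : PathSpace T)| := by
      rw [hzero s, abs_zero]
    refine Tendsto.mono_right
      (y := 𝓝 |rightPart (fderiv ℝ (u s) (windowOf T g s)) s (0 : PathSpace T)|) ?_ (by rw [← h0])
    refine (tendsto_rightPart _ s (D + D) (fun k => ContinuousMap.continuous _)
      (fun k x => hb k s x) fun x hx _ => ?_).abs
    simp only [hval]
    simpa using ((tendsto_negCut (neg_of_ne_zeroPt hx)).const_sub 1).mul_const
      (futureIncr T ε p s x)

/-- The increments beyond the right end of the window give a negligible contribution, except at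
the point `0` itself: they are supported in `]-ε, 0]`, and by the quadratic variation of the path
their squares have an integral of order `ε²` over this interval and over time. -/
lemma tendsto_integral_rightPart_futureIncr (hu : IsC12 u)
    (hS : ∀ t ∈ Ico 0 T, ∀ η ∈ qvSpace T (fun t => σ ^ 2 * t) t, ∀ f g : PathSpace T,
      fderiv ℝ (fderiv ℝ (u t)) η f g = (S t η).form f g)
    (hSc : ContinuousOn (fun p : ℝ × PathSpace T => S p.1 p.2)
      {p | p.1 ∈ Ico 0 T ∧ p.2 ∈ qvSpace T (fun t => σ ^ 2 * t) p.1})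
    (hC : ConditionC (fun t => σ ^ 2 * t) u) (hg : HasQV T σ g) (ht : t ∈ Ico 0 T)
    {ε : ℕ → ℝ} (hε : ∀ n, 0 < ε n) (hε0 : Tendsto ε atTop (𝓝 0)) :
    Tendsto (fun n => (ε n)⁻¹ * ∫ s in (0 : ℝ)..t,
      |rightPart (fderiv ℝ (u s) (windowOf T g s)) s (futureIncr T (ε n) g s)|) atTop (𝓝 0) := by
  have ht0 := ht.1
  have hgc := g.continuous
  obtain ⟨A, w, hA0, hgA, hw, hw0, -, hwm⟩ := hg.exists_modulus
  obtain ⟨C, hC0, ε₀, hε₀, hbd⟩ := hg.exists_bounds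
  have hL := continuousOn_fderiv_along hu ht (continuous_windowOf (T := T) g).continuousOn
  obtain ⟨B, hB0, hB⟩ := exists_bound_fderiv_along hu ht
    (continuous_windowOf (T := T) g).continuousOn
  -- condition (C) needs Lipschitz functions; an error of order `ε²` is harmless after division by
  -- `ε`
  have hp : ∀ n, ∃ p : C(ℝ, ℝ), ∃ K : ℝ, 0 ≤ K ∧ (∀ x y, |p x - p y| ≤ K * |x - y|) ∧
      ∀ y, |p y - g y| ≤ ε n ^ 2 := fun n => hg.exists_lipschitz_near (pow_pos (hε n) 2)
  choose p K hK hpK hpg using hp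
  have hpD : ∀ n y, |p n y| ≤ A + ε n ^ 2 := fun n y => by
    have := (abs_add_le (g y) (p n y - g y)).trans (add_le_add (hgA y) (hpg n y))
    rwa [add_sub_cancel] at this
  -- the cutoff near `0`, so sharp that it costs less than `ε / (n + 1)`
  have hk : ∀ n, ∃ k : ℕ, ∫ s in (0 : ℝ)..t, |rightPart (fderiv ℝ (u s) (windowOf T g s)) s
      (futureIncr T (ε n) (p n) s - restr T (localIncr (ε n) k (p n) s) : PathSpace T)| <
        ε n * (1 / ((n : ℝ) + 1)) := fun n =>
    ((tendsto_integral_cutoff (g := g) hu ht (ε n) (hpD n)).eventually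
      (gt_mem_nhds (mul_pos (hε n) (by positivity)))).exists
  choose k hk using hk
  have hε2 : Tendsto (fun n => ε n ^ 2) atTop (𝓝 0) := by simpa using hε0.pow 2
  have hwε : Tendsto (fun n => w (ε n)) atTop (𝓝 0) :=
    hw.comp (tendsto_nhdsWithin_iff.2 ⟨hε0, .of_forall hε⟩)
  have hMlim : Tendsto (fun n => w (ε n) + 2 * ε n ^ 2) atTop (𝓝 0) := by
    simpa using hwε.add (hε2.const_mul 2)
  have hpinc : ∀ n a b, |p n a - p n b| ≤ |g a - g b| + 2 * ε n ^ 2 := fun n a b => by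
    have e : p n a - p n b = (g a - g b) + ((p n a - g a) - (p n b - g b)) := by ring
    rw [e, two_mul]
    exact (abs_add_le _ _).trans (add_le_add le_rfl
      ((abs_sub _ _).trans (add_le_add (hpg n a) (hpg n b))))
  have hloc := tendsto_integral_rightPart_of_local hu hS hSc hC hg ht hε hε0
    (f := fun n s => localIncr (ε n) (k n) (p n) s) (fun n => continuous_localIncr _ _ _)
    (fun n s y hy => localIncr_of_notMem hy) (fun n s => by
      have := (abs_nonneg _).trans (hpD n 0)
      have := hK n
      exact ⟨_, by positivity, lipschitz_localIncr (hpK n) (hK n) (hpD n) _ _ s⟩) hMlim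
    (fun n s y => by
      have := hw0 (ε n)
      refine abs_localIncr_le (by positivity) fun hy => (hpinc n _ _).trans ?_
      refine add_le_add (hwm _ (hε n) _ _ ?_) le_rfl
      rw [add_sub_cancel_left, abs_of_pos (by linarith [hy.1])]
      linarith [hy.2, hε n]) (C := 2 * C ^ 2 + 8 * t) (by
    filter_upwards [hε0.eventually (gt_mem_nhds (lt_min hε₀ one_pos))] with n hn
    have hεn := hε n
    have hn1 : ε n ≤ 1 := hn.le.trans (min_le_right _ _)
    have hi : ∀ δ, IntervalIntegrable (fun s => 2 * (g (s + δ) - g s) ^ 2) volume 0 t :=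
      fun δ => Continuous.intervalIntegrable (by fun_prop) _ _
    have hcont := continuous_localIncr (ε n) (k n) (p n)
    -- for fixed `y`, the integral over time is an approximate quadratic variation
    have hin : ∀ y ∈ Icc (-ε n) 0, ∫ s in (0 : ℝ)..t, localIncr (ε n) (k n) (p n) s y ^ 2 ≤
        2 * (C ^ 2 * ε n) + 8 * ε n ^ 4 * t := by
      intro y hy
      have h1 : ∫ s in (0 : ℝ)..t, localIncr (ε n) (k n) (p n) s y ^ 2 ≤
          ∫ s in (0 : ℝ)..t, (2 * (g (s + (y + ε n)) - g s) ^ 2 + 8 * ε n ^ 4) := by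
        have hc1 : Continuous fun s => localIncr (ε n) (k n) (p n) s y :=
          hcont.comp (f := fun s : ℝ => (s, y)) (by fun_prop)
        refine intervalIntegral.integral_mono_on ht0
          (Continuous.intervalIntegrable (by fun_prop) _ _)
          ((hi _).add intervalIntegrable_const) fun s _ => ?_
        have h2 : |localIncr (ε n) (k n) (p n) s y| ≤ |g (s + (y + ε n)) - g s| + 2 * ε n ^ 2 :=
          abs_localIncr_le (by positivity) fun _ => hpinc n _ _
        have h3 := pow_le_pow_left₀ (abs_nonneg _) h2 2
        rw [sq_abs] at h3
        have h4 := sq_abs (g (s + (y + ε n)) - g s)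
        nlinarith [sq_nonneg (|g (s + (y + ε n)) - g s| - 2 * ε n ^ 2)]
      rw [intervalIntegral.integral_add (hi _) intervalIntegrable_const,
        intervalIntegral.integral_const_mul, intervalIntegral.integral_const, sub_zero,
        smul_eq_mul] at h1
      have h5 : ∫ s in (0 : ℝ)..t, (g (s + (y + ε n)) - g s) ^ 2 ≤ C ^ 2 * ε n := by
        rcases eq_or_lt_of_le (show 0 ≤ y + ε n by linarith [hy.1]) with h | h
        · simp only [← h, add_zero, sub_self]
          simp only [ne_eq, OfNat.ofNat_ne_zero, not_false_eq_true, zero_pow,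
            intervalIntegral.integral_zero]
          positivity
        · refine ((hbd _ h ?_).1 t ⟨ht0, ht.2.le⟩).trans ?_
          · linarith [hy.2, hn.trans_le (min_le_left _ _)]
          · exact mul_le_mul_of_nonneg_left (by linarith [hy.2]) (by positivity)
      linarith
    have hcy : Continuous fun y => ∫ s in (0 : ℝ)..t, localIncr (ε n) (k n) (p n) s y ^ 2 :=
      intervalIntegral.continuous_parametric_intervalIntegral_of_continuous'
        (f := fun y s => localIncr (ε n) (k n) (p n) s y ^ 2)
        (show Continuous fun z : ℝ × ℝ => localIncr (ε n) (k n) (p n) z.2 z.1 ^ 2 from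
          (hcont.comp continuous_swap).pow 2) _ _
    calc ∫ s in (0 : ℝ)..t, ∫ y in (-ε n)..0, localIncr (ε n) (k n) (p n) s y ^ 2
        = ∫ y in (-ε n)..0, ∫ s in (0 : ℝ)..t, localIncr (ε n) (k n) (p n) s y ^ 2 :=
          integral_integral_swap_of_continuous
            (F := fun s y => localIncr (ε n) (k n) (p n) s y ^ 2) (hcont.pow 2) _ _ _ _
      _ ≤ ∫ y in (-ε n)..0, (2 * (C ^ 2 * ε n) + 8 * ε n ^ 4 * t) :=
          intervalIntegral.integral_mono_on (by linarith) (hcy.intervalIntegrable _ _)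
            intervalIntegrable_const hin
      _ = ε n * (2 * (C ^ 2 * ε n) + 8 * ε n ^ 4 * t) := by
          rw [intervalIntegral.integral_const, smul_eq_mul, zero_sub, neg_neg]
      _ = 2 * C ^ 2 * ε n ^ 2 + 8 * t * (ε n ^ 2 * ε n ^ 3) := by ring
      _ ≤ 2 * C ^ 2 * ε n ^ 2 + 8 * t * (ε n ^ 2 * 1) := by
          have := pow_le_one₀ (n := 3) hεn.le hn1
          gcongr
      _ = _ := by ring)
  have hlim := (hloc.add tendsto_one_div_add_atTop_nhds_zero_nat).add
    (hε0.const_mul (2 * B * t))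
  simp only [mul_zero, add_zero] at hlim
  refine squeeze_zero (fun n => mul_nonneg (inv_nonneg.2 (hε n).le)
    (intervalIntegral.integral_nonneg ht0 fun _ _ => abs_nonneg _)) (fun n => ?_) hlim
  have hεn := hε n
  have hint : ∀ F : ℝ → PathSpace T, Continuous F → IntervalIntegrable (fun s =>
      |rightPart (fderiv ℝ (u s) (windowOf T g s)) s (F s)|) volume 0 t := fun F hF => by
    rw [intervalIntegrable_iff_integrableOn_Icc_of_le ht0]
    exact (integrableOn_rightPart hL hF.continuousOn).abs
  have hi1 := hint _ (continuous_restr_localIncr (T := T) (ε n) (k n) (p n))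
  have hi2 := hint (fun s => futureIncr T (ε n) (p n) s - restr T (localIncr (ε n) (k n) (p n) s))
    ((continuous_futureIncr _ _).sub (continuous_restr_localIncr _ _ _))
  have h1 : ∫ s in (0 : ℝ)..t,
      |rightPart (fderiv ℝ (u s) (windowOf T g s)) s (futureIncr T (ε n) g s)| ≤
      ∫ s in (0 : ℝ)..t, (|rightPart (fderiv ℝ (u s) (windowOf T g s)) s
          (restr T (localIncr (ε n) (k n) (p n) s))| +
        |rightPart (fderiv ℝ (u s) (windowOf T g s)) s
          (futureIncr T (ε n) (p n) s - restr T (localIncr (ε n) (k n) (p n) s) : PathSpace T)| +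
        B * (2 * ε n ^ 2)) := by
    refine intervalIntegral.integral_mono_on ht0 (hint _ (continuous_futureIncr _ _))
      ((hi1.add hi2).add intervalIntegrable_const) fun s hs => ?_
    have e : futureIncr T (ε n) g s = (restr T (localIncr (ε n) (k n) (p n) s) +
        (futureIncr T (ε n) (p n) s - restr T (localIncr (ε n) (k n) (p n) s))) +
        (futureIncr T (ε n) g s - futureIncr T (ε n) (p n) s) := by abel
    conv_lhs => rw [e, rightPart_add, rightPart_add]
    refine (abs_add_le _ _).trans (add_le_add (abs_add_le _ _) ((abs_rightPart_le _ _ _).trans ?_))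
    refine mul_le_mul (hB s hs) ?_ (norm_nonneg _) hB0
    refine (ContinuousMap.norm_le _ (by positivity)).2 fun x => ?_
    change |(g (s + max (x + ε n) 0) - g s) - (p n (s + max (x + ε n) 0) - p n s)| ≤ _
    have e2 : (g (s + max (x + ε n) 0) - g s) - (p n (s + max (x + ε n) 0) - p n s) =
        (p n s - g s) - (p n (s + max (x + ε n) 0) - g (s + max (x + ε n) 0)) := by ring
    rw [e2, two_mul]
    exact (abs_sub _ _).trans (add_le_add (hpg n _) (hpg n _))
  rw [intervalIntegral.integral_add (hi1.add hi2) intervalIntegrable_const,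
    intervalIntegral.integral_add hi1 hi2, intervalIntegral.integral_const, smul_eq_mul,
    sub_zero] at h1
  refine (mul_le_mul_of_nonneg_left h1 (inv_nonneg.2 hεn.le)).trans ?_
  rw [mul_add, mul_add]
  refine add_le_add (add_le_add le_rfl ?_) (le_of_eq ?_)
  · rw [inv_mul_le_iff₀ hεn]
    exact (hk n).le
  · field_simp

end Future

/-! ### The contribution of the initial point of the path -/

section Initial

/-- A cutoff equal to `1` on `]-∞, ε]` and to `0` on `[2ε, ∞[`. -/
noncomputable def initCut (ε y : ℝ) : ℝ := max 0 (min 1 (2 - y / ε))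

lemma continuous_initCut (ε : ℝ) : Continuous (initCut ε) := by unfold initCut; fun_prop

lemma initCut_mem (ε y : ℝ) : 0 ≤ initCut ε y ∧ initCut ε y ≤ 1 :=
  ⟨le_max_left _ _, max_le zero_le_one (min_le_left _ _)⟩

lemma initCut_of_le {ε y : ℝ} (hε : 0 < ε) (hy : y ≤ ε) : initCut ε y = 1 := by
  have : y / ε ≤ 1 := (div_le_one hε).2 hy
  unfold initCut
  rw [min_eq_left (by linarith), max_eq_right zero_le_one]

lemma initCut_of_ge {ε y : ℝ} (hε : 0 < ε) (hy : 2 * ε ≤ y) : initCut ε y = 0 := by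
  have : 2 ≤ y / ε := (le_div_iff₀ hε).2 hy
  exact max_eq_left ((min_le_right _ _).trans (by linarith))

lemma abs_initCut_sub_le {ε : ℝ} (hε : 0 < ε) (x y : ℝ) :
    |initCut ε x - initCut ε y| ≤ ε⁻¹ * |x - y| := by
  unfold initCut
  refine (abs_max_sub_max_le_max _ _ _ _).trans ?_
  rw [sub_self, abs_zero]
  refine max_le (by positivity) ((abs_min_sub_min_le_max _ _ _ _).trans ?_)
  rw [sub_self, abs_zero]
  refine max_le (by positivity) (le_of_eq ?_)
  rw [sub_sub_sub_cancel_left, ← sub_div, abs_div, abs_of_pos hε, abs_sub_comm, div_eq_inv_mul]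

/-- The part `y ↦ χ(y) (p(y⁺) - p(0))` of a path near time `0`; here `χ = 1` on `[0, ε]` and
`χ = 0` on `[2ε, ∞[`. -/
noncomputable def initPart (ε : ℝ) (p : C(ℝ, ℝ)) : C(ℝ, ℝ) :=
  ⟨fun y => initCut ε y * (p (max y 0) - p 0), by have := continuous_initCut ε; fun_prop⟩

lemma initPart_apply (ε : ℝ) (p : C(ℝ, ℝ)) (y : ℝ) :
    initPart ε p y = initCut ε y * (p (max y 0) - p 0) := rfl

variable {ε : ℝ} {p : C(ℝ, ℝ)}

lemma initPart_of_notMem (hε : 0 < ε) {y : ℝ} (hy : y ∉ Ioo 0 (2 * ε)) : initPart ε p y = 0 := by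
  rw [initPart_apply]
  rcases le_or_gt y 0 with h | h
  · rw [max_eq_right h, sub_self, mul_zero]
  · rw [initCut_of_ge hε (by by_contra h'; exact hy ⟨h, not_le.1 h'⟩), zero_mul]

lemma abs_initPart_le (hε : 0 < ε) {y M : ℝ} (hM : 0 ≤ M)
    (h : y ∈ Ioo 0 (2 * ε) → |p y - p 0| ≤ M) : |initPart ε p y| ≤ M := by
  by_cases hy : y ∈ Ioo 0 (2 * ε)
  · rw [initPart_apply, abs_mul, abs_of_nonneg (initCut_mem ε y).1, max_eq_left hy.1.le]
    exact (mul_le_of_le_one_left (abs_nonneg _) (initCut_mem ε y).2).trans (h hy)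
  · rwa [initPart_of_notMem hε hy, abs_zero]

lemma lipschitz_initPart (hε : 0 < ε) {K D : ℝ} (hp : ∀ x y, |p x - p y| ≤ K * |x - y|)
    (hK : 0 ≤ K) (hD : ∀ x, |p x| ≤ D) (x y : ℝ) :
    |initPart ε p x - initPart ε p y| ≤ (ε⁻¹ * (D + D) + K) * |x - y| := by
  simp only [initPart_apply]
  have h1 : |p (max x 0) - p (max y 0)| ≤ K * |x - y| :=
    (hp _ _).trans (mul_le_mul_of_nonneg_left (abs_max_sub_max_le_abs _ _ _) hK)
  have h2 : |p (max x 0) - p 0| ≤ D + D := (abs_sub _ _).trans (add_le_add (hD _) (hD _))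
  have e : initCut ε x * (p (max x 0) - p 0) - initCut ε y * (p (max y 0) - p 0) =
      (initCut ε x - initCut ε y) * (p (max x 0) - p 0) +
        initCut ε y * (p (max x 0) - p (max y 0)) := by ring
  rw [e]
  refine (abs_add_le _ _).trans ?_
  rw [abs_mul, abs_mul, abs_of_nonneg (initCut_mem ε y).1]
  have h3 := mul_le_mul (abs_initCut_sub_le hε x y) h2 (abs_nonneg _) (by positivity)
  have h4 := (mul_le_of_le_one_left (abs_nonneg _) (initCut_mem ε y).2).trans h1
  linarith

variable {T : ℝ} [hT : Fact (0 < T)]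

lemma norm_windowOf_le {f : C(ℝ, ℝ)} {M : ℝ} (hM : ∀ y, |f y| ≤ M) (s : ℝ) :
    ‖windowOf T f s‖ ≤ M :=
  (ContinuousMap.norm_le _ ((abs_nonneg _).trans (hM 0))).2 fun _ => hM _

lemma norm_toL2_windowOf_le {f : C(ℝ, ℝ)} {a b M : ℝ} (hab : a ≤ b)
    (hf : ∀ y, y ∉ Ioo a b → f y = 0) (hM : ∀ y, |f y| ≤ M) (s : ℝ) :
    ‖toL2 (windowOf T f s)‖ ≤ M * √(b - a) := by
  have hM0 : 0 ≤ M := (abs_nonneg _).trans (hM 0)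
  have hfc := f.continuous
  refine le_of_sq_le_sq ?_ (by positivity)
  rw [mul_pow, Real.sq_sqrt (sub_nonneg.2 hab), norm_toL2_sq_eq _ (fun x => f (x + s))
    (fun x => by rw [windowOf_apply, add_comm])]
  refine (integral_sq_shift_le hab hf s).trans ?_
  calc ∫ y in a..b, f y ^ 2 ≤ ∫ y in a..b, M ^ 2 :=
        intervalIntegral.integral_mono_on hab (Continuous.intervalIntegrable (by fun_prop) _ _)
          intervalIntegrable_const fun y _ => sq_le_sq.2 ((hM y).trans (le_abs_self M))
    _ = _ := by rw [intervalIntegral.integral_const, smul_eq_mul, mul_comm]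

/-- An integral over `[0, t]` of a function vanishing after `δ` is small. -/
lemma integral_le_of_vanish_right {v : ℝ → ℝ} {t δ M : ℝ} (ht : 0 ≤ t) (hδ : 0 ≤ δ) (hM : 0 ≤ M)
    (hv : ∀ s, δ ≤ s → v s = 0) (hb : ∀ s ∈ Icc 0 t, v s ≤ M)
    (hi : IntervalIntegrable v volume 0 t) : ∫ s in (0 : ℝ)..t, v s ≤ M * δ := by
  rcases le_total t δ with h | h
  · refine (intervalIntegral.integral_mono_on ht hi intervalIntegrable_const hb).trans ?_
    rw [intervalIntegral.integral_const, smul_eq_mul, sub_zero, mul_comm]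
    exact mul_le_mul_of_nonneg_left h hM
  · have hi1 : IntervalIntegrable v volume 0 δ :=
      hi.mono_set (uIcc_subset_uIcc left_mem_uIcc (by rw [uIcc_of_le ht]; exact ⟨hδ, h⟩))
    have hi2 : IntervalIntegrable v volume δ t :=
      hi.mono_set (uIcc_subset_uIcc (by rw [uIcc_of_le ht]; exact ⟨hδ, h⟩) right_mem_uIcc)
    rw [← intervalIntegral.integral_add_adjacent_intervals hi1 hi2,
      intervalIntegral.integral_congr (a := δ) (g := fun _ => 0) fun s hs => by
        rw [uIcc_of_le h] at hs; exact hv s hs.1]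
    rw [intervalIntegral.integral_zero, add_zero]
    refine (intervalIntegral.integral_mono_on hδ hi1 intervalIntegrable_const
      fun s hs => hb s ⟨hs.1, hs.2.trans h⟩).trans ?_
    rw [intervalIntegral.integral_const, smul_eq_mul, sub_zero, mul_comm]

variable {σ : ℝ} {u : ℝ → PathSpace T → ℝ} {S : ℝ → PathSpace T → Chi0 T} {g : C(ℝ, ℝ)} {t : ℝ}

lemma exists_time_increment_near (hu : IsC12 u) (ht : t ∈ Ico 0 T) {κ : ℝ} (hκ : 0 < κ) :
    ∃ ρ > 0, ∀ s ∈ Icc 0 t, ∀ ε ∈ Ioo 0 ρ, ∀ ζ, s + ε < T → ‖ζ - windowOf T g s‖ < ρ →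
      |u (s + ε) ζ - u s ζ - ε * timeDeriv u s (windowOf T g s)| ≤ κ * ε := by
  obtain ⟨ρ, hρ, h⟩ := exists_uniform_near hu.continuousOn_timeDeriv (isCompact_windows g t) (by
    rintro _ ⟨s, hs, rfl⟩; exact ⟨⟨hs.1, hs.2.trans_lt ht.2⟩, mem_univ _⟩) hκ
  refine ⟨ρ, hρ, fun s hs ε hε ζ hsε hζ => ?_⟩
  have hsub : Icc s (s + ε) ⊆ Ico 0 T := fun r hr => ⟨hs.1.trans hr.1, hr.2.trans_lt hsε⟩
  set c := timeDeriv u s (windowOf T g s)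
  have hd : ∀ r ∈ Icc s (s + ε), HasDerivWithinAt (fun r => u r ζ - r * c)
      (timeDeriv u r ζ - 1 * c) (Icc s (s + ε)) r := fun r hr =>
    ((hu.differentiable_time ζ r (hsub hr)).hasDerivWithinAt.mono hsub).sub
      ((hasDerivWithinAt_id r _).mul_const c)
  have hb : ∀ r ∈ Icc s (s + ε), ‖timeDeriv u r ζ - 1 * c‖ ≤ κ := fun r hr => by
    have := h _ ⟨s, hs, rfl⟩ (r, ζ) ⟨hsub hr, mem_univ _⟩ (by
      rw [dist_comm, Prod.dist_eq, Real.dist_eq, dist_eq_norm]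
      refine max_lt ?_ hζ
      rw [abs_of_nonneg (by linarith [hr.1])]
      linarith [hr.2, hε.2])
    rw [dist_comm, Real.dist_eq] at this
    rw [one_mul]
    exact this.le
  have := (convex_Icc s (s + ε)).norm_image_sub_le_of_norm_hasDerivWithin_le hd hb
    ⟨le_rfl, by linarith [hε.1]⟩ ⟨by linarith [hε.1], le_rfl⟩
  rw [Real.norm_eq_abs, Real.norm_eq_abs, add_sub_cancel_left, abs_of_pos hε.1] at this
  refine le_trans (le_of_eq ?_) this
  congr 1
  ring

end Initial

section InitialTerm

variable {T : ℝ} [hT : Fact (0 < T)] {σ : ℝ} {u : ℝ → PathSpace T → ℝ}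
  {S : ℝ → PathSpace T → Chi0 T} {g : C(ℝ, ℝ)} {t : ℝ}

/-- Variation in time of the derivative along the windows. The variation at a fixed path is
estimated through the differences `u(r, ζ + Q) - u(r, ζ)`, which are differentiable in time. -/
lemma exists_fderiv_increment_bound (hu : IsC12 u)
    (hS : ∀ t ∈ Ico 0 T, ∀ η ∈ qvSpace T (fun t => σ ^ 2 * t) t, ∀ f g : PathSpace T,
      fderiv ℝ (fderiv ℝ (u t)) η f g = (S t η).form f g)
    (hSc : ContinuousOn (fun p : ℝ × PathSpace T => S p.1 p.2)
      {p | p.1 ∈ Ico 0 T ∧ p.2 ∈ qvSpace T (fun t => σ ^ 2 * t) p.1})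
    (hg : HasQV T σ g) (ht : t ∈ Ico 0 T) :
    ∃ C > 0, ∀ κ > 0, ∃ ρ > 0, ∀ r ε, 0 ≤ r → ε ∈ Ioo 0 ρ → r + ε ≤ t → ∀ Q : PathSpace T,
      ‖Q‖ < ρ → ‖windowOf T g (r + ε) - windowOf T g r‖ < ρ →
      |fderiv ℝ (u r) (windowOf T g r) Q - fderiv ℝ (u (r + ε)) (windowOf T g (r + ε)) Q| ≤
        C * (hilbertNorm (windowOf T g (r + ε) - windowOf T g r) * hilbertNorm Q) +
          2 * κ * ε + 2 * C * hilbertNorm Q ^ 2 := by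
  obtain ⟨C, hC, ρ₁, hρ₁, h1⟩ := exists_taylor_bounds hu hS hSc hg ht
  refine ⟨C, hC, fun κ hκ => ?_⟩
  obtain ⟨ρ₂, hρ₂, h2⟩ := exists_time_increment_near (g := g) hu ht hκ
  refine ⟨min ρ₁ ρ₂ / 2, by positivity, fun r ε hr hε hrt Q hQ hΔ => ?_⟩
  have hm1 := min_le_left ρ₁ ρ₂
  have hm2 := min_le_right ρ₁ ρ₂
  have hr1 : r ∈ Icc 0 t := ⟨hr, by linarith [hε.1]⟩
  have hr2 : r + ε ∈ Icc 0 t := ⟨by linarith [hε.1], hrt⟩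
  have hε2 : ε ∈ Ioo 0 ρ₂ := ⟨hε.1, by linarith [hε.2]⟩
  set η := windowOf T g r
  set η' := windowOf T g (r + ε)
  have hQ' : ‖η' + Q - η‖ < min ρ₁ ρ₂ := by
    rw [show η' + Q - η = (η' - η) + Q by abel]
    exact (norm_add_le _ _).trans_lt (by linarith)
  -- `a1`: change of the path at fixed time; `a2`, `a3`: the derivatives at both times are finite
  -- differences; `a4`, `a5`: these differences vary little in time
  have a1 := (h1 r hr1 η (η' - η) (by rwa [sub_self, norm_zero])
    (by rw [add_sub_cancel]; linarith)).1 Q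
  rw [add_sub_cancel] at a1
  have a2 := (h1 r hr1 η' Q (by linarith) (by linarith)).2
  have a3 := (h1 (r + ε) hr2 η' Q (by rwa [sub_self, norm_zero])
    (by rw [add_sub_cancel_left]; linarith)).2
  have a4 := h2 r hr1 ε hε2 (η' + Q) (hrt.trans_lt ht.2) (by linarith)
  have a5 := h2 r hr1 ε hε2 η' (hrt.trans_lt ht.2) (by linarith)
  rw [abs_le] at a1 a2 a3 a4 a5 ⊢
  constructor <;> linarith [a1.1, a1.2, a2.1, a2.2, a3.1, a3.2, a4.1, a4.2, a5.1, a5.2]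

/-- Summation by parts, for the integral of a product with an increment. -/
lemma integral_apply_increment {L : ℝ → PathSpace T →L[ℝ] ℝ} {Q : ℝ → PathSpace T} {ε : ℝ}
    (hL : ContinuousOn L (Icc 0 t)) (hQ : Continuous Q) (hε : 0 < ε) (hεt : ε ≤ t) :
    ∫ s in (0 : ℝ)..t, L s (Q (s + ε) - Q s) =
      (∫ s in (0 : ℝ)..(t - ε), (L s - L (s + ε)) (Q (s + ε))) +
        (∫ s in (t - ε)..t, L s (Q (s + ε))) - ∫ s in (0 : ℝ)..ε, L s (Q s) := by
  have hi : ∀ F : ℝ → PathSpace T, Continuous F → ∀ a ∈ Icc 0 t, ∀ b ∈ Icc 0 t,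
      IntervalIntegrable (fun s => L s (F s)) volume a b := fun F hF a ha b hb =>
    ((hL.clm_apply hF.continuousOn).mono (ordConnected_Icc.uIcc_subset ha hb)).intervalIntegrable
  have hQ' : Continuous fun s => Q (s + ε) := by fun_prop
  have m0 : (0 : ℝ) ∈ Icc 0 t := ⟨le_rfl, by linarith⟩
  have mt : t ∈ Icc 0 t := ⟨by linarith, le_rfl⟩
  have me : ε ∈ Icc 0 t := ⟨hε.le, hεt⟩
  have mte : t - ε ∈ Icc 0 t := ⟨by linarith, by linarith⟩
  have hshift : IntervalIntegrable (fun s => L (s + ε) (Q (s + ε))) volume 0 (t - ε) := by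
    have := (hi Q hQ ε me t mt).comp_add_right ε
    rwa [sub_self] at this
  have e1 : ∫ s in (0 : ℝ)..(t - ε), L (s + ε) (Q (s + ε)) = ∫ s in ε..t, L s (Q s) := by
    rw [intervalIntegral.integral_comp_add_right (fun s => L s (Q s)), zero_add, sub_add_cancel]
  simp only [map_sub, _root_.sub_apply]
  rw [intervalIntegral.integral_sub (hi _ hQ' 0 m0 t mt) (hi _ hQ 0 m0 t mt),
    intervalIntegral.integral_sub (hi _ hQ' 0 m0 _ mte) hshift, e1,
    ← intervalIntegral.integral_add_adjacent_intervals (hi _ hQ' 0 m0 _ mte) (hi _ hQ' _ mte t mt),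
    ← intervalIntegral.integral_add_adjacent_intervals (hi _ hQ 0 m0 _ me) (hi _ hQ _ me t mt)]
  ring

/-- The increments of the windows of the initial part give a negligible contribution. As the
path need not have bounded variation, the increments are moved to the derivative by summation by
parts. -/
lemma tendsto_integral_apply_initPart (hu : IsC12 u)
    (hS : ∀ t ∈ Ico 0 T, ∀ η ∈ qvSpace T (fun t => σ ^ 2 * t) t, ∀ f g : PathSpace T,
      fderiv ℝ (fderiv ℝ (u t)) η f g = (S t η).form f g)
    (hSc : ContinuousOn (fun p : ℝ × PathSpace T => S p.1 p.2)
      {p | p.1 ∈ Ico 0 T ∧ p.2 ∈ qvSpace T (fun t => σ ^ 2 * t) p.1})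
    (hg : HasQV T σ g) (ht : t ∈ Ico 0 T)
    {ε : ℕ → ℝ} (hε : ∀ n, 0 < ε n) (hε0 : Tendsto ε atTop (𝓝 0)) :
    Tendsto (fun n => (ε n)⁻¹ * ∫ s in (0 : ℝ)..t, fderiv ℝ (u s) (windowOf T g s)
      (windowOf T (initPart (ε n) g) (s + ε n) - windowOf T (initPart (ε n) g) s))
      atTop (𝓝 0) := by
  rcases eq_or_lt_of_le ht.1 with ht0 | ht0
  · simp [← ht0]
  have hgc := g.continuous
  obtain ⟨A, w, hA0, hgA, hw, hw0, -, hwm⟩ := hg.exists_modulus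
  obtain ⟨C', hC'0, ε₀, hε₀, hbd⟩ := hg.exists_bounds
  have hL := continuousOn_fderiv_along hu ht (continuous_windowOf (T := T) g).continuousOn
  obtain ⟨B, hB0, hB⟩ := exists_bound_fderiv_along hu ht
    (continuous_windowOf (T := T) g).continuousOn
  obtain ⟨C, hC, hinc⟩ := exists_fderiv_increment_bound hu hS hSc hg ht
  have hwε : Tendsto (fun n => w (ε n)) atTop (𝓝 0) :=
    hw.comp (tendsto_nhdsWithin_iff.2 ⟨hε0, .of_forall hε⟩)
  have hsε : Tendsto (fun n => √(ε n)) atTop (𝓝 0) := by simpa using hε0.sqrt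
  -- the final bound, as a function of `w ε` and `√ε`
  let Φ : ℝ × ℝ → ℝ := fun z => (C * (z.1 + C' * z.2) + 4 * C * z.1) * z.1 + C * z.1 * C' ^ 2 +
    t * (C * z.1 + 2 * C * C' * z.1 + 16 * C * z.1 ^ 2) + 2 * B * z.1
  have hΦ : Tendsto (fun n => Φ (w (ε n), √(ε n))) atTop (𝓝 0) := by
    have h1 : Continuous Φ := by fun_prop
    have h2 := (h1.tendsto (0, 0)).comp (hwε.prodMk_nhds hsε)
    have h3 : Φ (0, 0) = 0 := by simp [Φ]
    rwa [h3] at h2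
  rw [Metric.tendsto_nhds]
  intro δ hδ
  have hκ : 0 < δ / (4 * t) := by positivity
  obtain ⟨ρ, hρ, h⟩ := hinc _ hκ
  filter_upwards [hε0.eventually (gt_mem_nhds (lt_min hρ (lt_min hε₀ ht0))),
    hwε.eventually (gt_mem_nhds hρ), hΦ.eventually (gt_mem_nhds (half_pos hδ))] with n hn1 hn2 hn3
  have hεn := hε n
  have hnρ : ε n < ρ := hn1.trans_le (min_le_left _ _)
  have hnε : ε n ≤ ε₀ := (hn1.trans_le ((min_le_right _ _).trans (min_le_left _ _))).le
  have hnt : ε n < t := hn1.trans_le ((min_le_right _ _).trans (min_le_right _ _))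
  set W := w (ε n) with hW
  set e := √(ε n) with he
  have he0 : 0 ≤ e := Real.sqrt_nonneg _
  have he2 : e ^ 2 = ε n := Real.sq_sqrt hεn.le
  have hW0 : 0 ≤ W := hw0 _
  set q := initPart (ε n) g with hq
  set L : ℝ → PathSpace T →L[ℝ] ℝ := fun s => fderiv ℝ (u s) (windowOf T g s) with hLdef
  have hqW : ∀ y, |q y| ≤ W := fun y => abs_initPart_le hεn hW0 fun hy => hwm _ hεn _ _ (by
    rw [sub_zero, abs_of_pos hy.1]; exact hy.2.le)
  have hqv : ∀ y, y ∉ Ioo 0 (2 * ε n) → q y = 0 := fun y hy => initPart_of_notMem hεn hy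
  have hQn : ∀ s, ‖windowOf T q s‖ ≤ W := fun s => norm_windowOf_le hqW s
  have hQN : ∀ s, hilbertNorm (windowOf T q s) ≤ |q s| + 2 * (W * e) := fun s => by
    unfold hilbertNorm
    refine add_le_add (by rw [windowOf_apply, coe_zeroPt, add_zero]) ?_
    refine (norm_toL2_windowOf_le (by linarith) hqv hqW s).trans ?_
    rw [sub_zero, Real.sqrt_mul (by norm_num), ← he]
    have : √2 ≤ 2 := by rw [Real.sqrt_le_left (by norm_num)]; norm_num
    nlinarith [mul_nonneg hW0 he0]
  set D := C * W + 2 * C * C' * W + 2 * (δ / (4 * t)) + 16 * C * W ^ 2 with hD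
  have hD0 : 0 ≤ D := by positivity
  have hpt : ∀ s ∈ Icc 0 (t - ε n), |(L s - L (s + ε n)) (windowOf T q (s + ε n))| ≤
      (C * (W + C' * e) + 4 * C * W) * |q (s + ε n)| + C * W * (g (s + ε n) - g s) ^ 2 +
        D * ε n := by
    intro s hs
    have hst : s ∈ Icc 0 T := ⟨hs.1, by linarith [hs.2, ht.2]⟩
    have hd : |g (s + ε n) - g s| ≤ W := hwm _ hεn _ _ (by
      rw [add_sub_cancel_left, abs_of_pos hεn]; linarith)
    have h1 := h s (ε n) hs.1 ⟨hεn, hnρ⟩ (by linarith [hs.2]) (windowOf T q (s + ε n))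
      ((hQn _).trans_lt hn2) (by
        refine lt_of_le_of_lt ?_ hn2
        refine (ContinuousMap.norm_le _ hW0).2 fun x => hwm _ hεn _ _ ?_
        rw [add_sub_add_right_eq_sub, add_sub_cancel_left, abs_of_pos hεn]; linarith)
    have h2 : hilbertNorm (windowOf T g (s + ε n) - windowOf T g s) ≤
        |g (s + ε n) - g s| + C' * e := by
      unfold hilbertNorm
      refine add_le_add (le_of_eq ?_) ((hbd _ hεn hnε).2 s hst).1
      simp only [ContinuousMap.sub_apply, windowOf_apply, coe_zeroPt, add_zero]
    have h3 := hQN (s + ε n)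
    have h4 := hqW (s + ε n)
    have h5 := hilbertNorm_nonneg (windowOf T q (s + ε n))
    have h6 := hilbertNorm_nonneg (windowOf T g (s + ε n) - windowOf T g s)
    rw [_root_.sub_apply]
    refine h1.trans ?_
    rw [← sq_abs (g (s + ε n) - g s)]
    set a := |q (s + ε n)|
    set d := |g (s + ε n) - g s|
    have ha : 0 ≤ a := abs_nonneg _
    have hd0 : 0 ≤ d := abs_nonneg _
    have h7 : hilbertNorm (windowOf T g (s + ε n) - windowOf T g s) *
        hilbertNorm (windowOf T q (s + ε n)) ≤ (W + C' * e) * a + W * (d ^ 2 + ε n) +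
          2 * C' * W * ε n := by
      refine (mul_le_mul h2 h3 h5 (by positivity)).trans ?_
      have e1 : (d + C' * e) * (a + 2 * (W * e)) =
          (d + C' * e) * a + W * (2 * d * e) + 2 * C' * W * e ^ 2 := by ring
      rw [e1, he2]
      have e2 : 2 * d * e ≤ d ^ 2 + ε n := by rw [← he2]; nlinarith [sq_nonneg (d - e)]
      gcongr
    have h8 : hilbertNorm (windowOf T q (s + ε n)) ^ 2 ≤ 2 * W * a + 8 * W ^ 2 * ε n := by
      refine (pow_le_pow_left₀ h5 h3 2).trans ?_
      rw [← he2]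
      nlinarith [sq_nonneg (a - 2 * (W * e)), mul_le_mul_of_nonneg_left h4 ha]
    have h9 := mul_le_mul_of_nonneg_left h7 hC.le
    have h10 := mul_le_mul_of_nonneg_left h8 hC.le
    rw [hD]
    linarith
  have hqc := q.continuous
  have hia : ∀ c a b, IntervalIntegrable (fun s => c * |q (s + ε n)|) volume a b :=
    fun c a b => Continuous.intervalIntegrable (by fun_prop) _ _
  have hid : ∀ c a b, IntervalIntegrable (fun s => c * (g (s + ε n) - g s) ^ 2) volume a b :=
    fun c a b => Continuous.intervalIntegrable (by fun_prop) _ _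
  have b1 : |∫ s in (0 : ℝ)..(t - ε n), (L s - L (s + ε n)) (windowOf T q (s + ε n))| ≤
      (C * (W + C' * e) + 4 * C * W) * W * ε n + C * W * (C' ^ 2 * ε n) + t * (D * ε n) := by
    have k1 := intervalIntegral.norm_integral_le_of_norm_le (μ := volume)
      (f := fun s => (L s - L (s + ε n)) (windowOf T q (s + ε n))) (by linarith : 0 ≤ t - ε n)
      (.of_forall fun s hs => hpt s ⟨hs.1.le, hs.2⟩)
      (((hia _ _ _).add (hid _ _ _)).add intervalIntegrable_const)
    rw [intervalIntegral.integral_add ((hia _ _ _).add (hid _ _ _)) intervalIntegrable_const,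
      intervalIntegral.integral_add (hia _ _ _) (hid _ _ _), intervalIntegral.integral_const_mul
        (C * W), intervalIntegral.integral_const, smul_eq_mul, sub_zero] at k1
    refine k1.trans (add_le_add (add_le_add ?_ ?_) ?_)
    · refine integral_le_of_vanish_right (by linarith) hεn.le (by positivity) (fun s hs => ?_)
        (fun s _ => mul_le_mul_of_nonneg_left (hqW _) (by positivity)) (hia _ _ _)
      rw [hqv _ fun hy => by linarith [hy.2], abs_zero, mul_zero]
    · exact mul_le_mul_of_nonneg_left ((hbd _ hεn hnε).1 _ ⟨by linarith, by linarith [ht.2]⟩)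
        (by positivity)
    · exact mul_le_mul_of_nonneg_right (by linarith) (by positivity)
  have hbdry : ∀ a b : ℝ, 0 ≤ a → a ≤ b → b ≤ t → ∀ F : ℝ → PathSpace T, (∀ s, ‖F s‖ ≤ W) →
      |∫ s in a..b, L s (F s)| ≤ B * W * (b - a) := by
    intro a b ha hab hb F hF
    have := intervalIntegral.norm_integral_le_of_norm_le_const (f := fun s => L s (F s))
      (a := a) (b := b) (C := B * W) fun s hs => by
        rw [uIoc_of_le hab] at hs
        refine ((L s).le_opNorm _).trans (mul_le_mul (hB s ⟨ha.trans hs.1.le, hs.2.trans hb⟩)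
          (hF s) (norm_nonneg _) hB0)
    rwa [abs_of_nonneg (sub_nonneg.2 hab)] at this
  have b2 := hbdry (t - ε n) t (by linarith) (by linarith) le_rfl (fun s => windowOf T q (s + ε n))
    fun s => hQn _
  have b3 := hbdry 0 (ε n) le_rfl hεn.le hnt.le (fun s => windowOf T q s) fun s => hQn _
  rw [sub_sub_cancel] at b2
  rw [sub_zero] at b3
  rw [Real.dist_eq, sub_zero, abs_mul, abs_of_pos (inv_pos.2 hεn), inv_mul_lt_iff₀ hεn,
    integral_apply_increment hL (continuous_windowOf q) hεn hnt.le]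
  refine ((abs_sub _ _).trans (add_le_add ((abs_add_le _ _).trans (add_le_add b1 b2)) b3)).trans_lt
    ?_
  have e1 : (C * (W + C' * e) + 4 * C * W) * W * ε n + C * W * (C' ^ 2 * ε n) + t * (D * ε n) +
      B * W * ε n + B * W * ε n = ε n * (Φ (W, e) + δ / 2) := by
    simp only [Φ, hD]
    field_simp
    ring
  rw [e1]
  exact mul_lt_mul_of_pos_left (by linarith) hεn

end InitialTerm

section FirstOrder

lemma tendsto_inv_mul_integral_of_abs {ε : ℕ → ℝ} (hε : ∀ n, 0 < ε n) {F : ℕ → ℝ → ℝ} {t : ℝ}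
    (ht : 0 ≤ t)
    (h : Tendsto (fun n => (ε n)⁻¹ * ∫ s in (0 : ℝ)..t, |F n s|) atTop (𝓝 0)) :
    Tendsto (fun n => (ε n)⁻¹ * ∫ s in (0 : ℝ)..t, F n s) atTop (𝓝 0) := by
  refine squeeze_zero_norm (fun n => ?_) h
  rw [norm_mul, norm_inv, Real.norm_eq_abs, abs_of_pos (hε n)]
  exact mul_le_mul_of_nonneg_left (intervalIntegral.abs_integral_le_integral_abs ht)
    (inv_nonneg.2 (hε n).le)

lemma tendsto_inv_mul_integral_of_vanish {ε c : ℕ → ℝ} (hε : ∀ n, 0 < ε n) {F : ℕ → ℝ → ℝ} {t : ℝ}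
    (ht : 0 ≤ t) (hF : ∀ n, IntervalIntegrable (F n) volume 0 t)
    (hv : ∀ n s, 2 * ε n ≤ s → F n s = 0) (hb : ∀ n, ∀ s ∈ Icc 0 t, |F n s| ≤ c n)
    (hc : Tendsto c atTop (𝓝 0)) :
    Tendsto (fun n => (ε n)⁻¹ * ∫ s in (0 : ℝ)..t, F n s) atTop (𝓝 0) := by
  refine tendsto_inv_mul_integral_of_abs hε ht ?_
  have hlim := hc.mul_const 2
  rw [zero_mul] at hlim
  refine squeeze_zero (fun n => mul_nonneg (inv_nonneg.2 (hε n).le)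
    (intervalIntegral.integral_nonneg ht fun _ _ => abs_nonneg _)) (fun n => ?_) hlim
  have hεn := hε n
  have h := integral_le_of_vanish_right (v := fun s => |F n s|) (δ := 2 * ε n) (M := c n) ht
    (by linarith) ((abs_nonneg _).trans (hb n 0 ⟨le_rfl, ht⟩))
    (fun s hs => by rw [hv n s hs, abs_zero]) (hb n) (hF n).abs
  refine (mul_le_mul_of_nonneg_left h (inv_nonneg.2 hεn.le)).trans (le_of_eq ?_)
  field_simp

variable {T : ℝ} [hT : Fact (0 < T)] {σ : ℝ} {u : ℝ → PathSpace T → ℝ}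
  {S : ℝ → PathSpace T → Chi0 T} {g : C(ℝ, ℝ)} {t : ℝ}

/-- The approximate forward integrals of the initial part are negligible: it is uniformly small, and
at the point `0` of the window it is seen for a time of order `ε` only. -/
lemma tendsto_integral_rightPart_initPart (hu : IsC12 u)
    (hS : ∀ t ∈ Ico 0 T, ∀ η ∈ qvSpace T (fun t => σ ^ 2 * t) t, ∀ f g : PathSpace T,
      fderiv ℝ (fderiv ℝ (u t)) η f g = (S t η).form f g)
    (hSc : ContinuousOn (fun p : ℝ × PathSpace T => S p.1 p.2)
      {p | p.1 ∈ Ico 0 T ∧ p.2 ∈ qvSpace T (fun t => σ ^ 2 * t) p.1})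
    (hC : ConditionC (fun t => σ ^ 2 * t) u) (hg : HasQV T σ g) (ht : t ∈ Ico 0 T)
    {ε : ℕ → ℝ} (hε : ∀ n, 0 < ε n) (hε0 : Tendsto ε atTop (𝓝 0)) :
    Tendsto (fun n => (ε n)⁻¹ * ∫ s in (0 : ℝ)..t,
      rightPart (fderiv ℝ (u s) (windowOf T g s)) s
        (extIncr (ε n) (windowOf T (initPart (ε n) g) s))) atTop (𝓝 0) := by
  have ht0 := ht.1
  have hgc := g.continuous
  obtain ⟨A, w, hA0, hgA, hw, hw0, -, hwm⟩ := hg.exists_modulus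
  have hL := continuousOn_fderiv_along hu ht (continuous_windowOf (T := T) g).continuousOn
  obtain ⟨B, hB0, hB⟩ := exists_bound_fderiv_along hu ht
    (continuous_windowOf (T := T) g).continuousOn
  -- condition (C) needs Lipschitz functions; an error of order `ε²` is harmless after division by
  -- `ε`
  have hp : ∀ n, ∃ p : C(ℝ, ℝ), ∃ K : ℝ, 0 ≤ K ∧ (∀ x y, |p x - p y| ≤ K * |x - y|) ∧
      ∀ y, |p y - g y| ≤ ε n ^ 2 := fun n => hg.exists_lipschitz_near (pow_pos (hε n) 2)
  choose p K hK hpK hpg using hp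
  have hpD : ∀ n y, |p n y| ≤ A + ε n ^ 2 := fun n y => by
    have := (abs_add_le (g y) (p n y - g y)).trans (add_le_add (hgA y) (hpg n y))
    rwa [add_sub_cancel] at this
  have hε2 : Tendsto (fun n => ε n ^ 2) atTop (𝓝 0) := by simpa using hε0.pow 2
  have hwε : Tendsto (fun n => w (ε n)) atTop (𝓝 0) :=
    hw.comp (tendsto_nhdsWithin_iff.2 ⟨hε0, .of_forall hε⟩)
  set M : ℕ → ℝ := fun n => w (ε n) + 2 * ε n ^ 2 with hM
  have hMlim : Tendsto M atTop (𝓝 0) := by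
    simpa using hwε.add (hε2.const_mul 2)
  have hM0 : ∀ n, 0 ≤ M n := fun n => add_nonneg (hw0 _) (by positivity)
  set q : ℕ → C(ℝ, ℝ) := fun n => initPart (ε n) (p n) with hq
  have hqM : ∀ n y, |q n y| ≤ M n := fun n y => abs_initPart_le (hε n) (hM0 n) fun hy => by
    have e : p n y - p n 0 = (g y - g 0) + ((p n y - g y) - (p n 0 - g 0)) := by ring
    rw [e]
    refine (abs_add_le _ _).trans (add_le_add (hwm _ (hε n) _ _ ?_) ?_)
    · rw [sub_zero, abs_of_pos hy.1]; exact hy.2.le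
    · rw [two_mul]
      exact (abs_sub _ _).trans (add_le_add (hpg n _) (hpg n _))
  have hqv : ∀ n y, y ∉ Ioo 0 (2 * ε n) → q n y = 0 := fun n y hy => initPart_of_notMem (hε n) hy
  have hdiff : ∀ n y, |initPart (ε n) g y - q n y| ≤ 2 * ε n ^ 2 := fun n y => by
    simp only [hq, initPart_apply]
    rw [← mul_sub, abs_mul, abs_of_nonneg (initCut_mem _ y).1]
    refine (mul_le_of_le_one_left (abs_nonneg _) (initCut_mem _ y).2).trans ?_
    have e : g (max y 0) - g 0 - (p n (max y 0) - p n 0) =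
        (p n 0 - g 0) - (p n (max y 0) - g (max y 0)) := by ring
    rw [e, two_mul]
    exact (abs_sub _ _).trans (add_le_add (hpg n _) (hpg n _))
  have hN : Tendsto (fun n => (ε n)⁻¹ * ∫ s in (0 : ℝ)..t, hilbertNorm (windowOf T (q n) s) ^ 2)
      atTop (𝓝 0) := by
    have hlim : Tendsto (fun n => M n ^ 2 * (4 + 4 * t)) atTop (𝓝 0) := by
      simpa using (hMlim.pow 2).mul_const (4 + 4 * t)
    refine squeeze_zero (fun n => mul_nonneg (inv_nonneg.2 (hε n).le)
      (intervalIntegral.integral_nonneg ht0 fun _ _ => sq_nonneg _)) (fun n => ?_) hlim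
    have hεn := hε n
    have hqc := (q n).continuous
    have hi : IntervalIntegrable (fun s => 2 * q n s ^ 2) volume 0 t :=
      Continuous.intervalIntegrable (by fun_prop) _ _
    have h1 : ∫ s in (0 : ℝ)..t, hilbertNorm (windowOf T (q n) s) ^ 2 ≤
        ∫ s in (0 : ℝ)..t, (2 * q n s ^ 2 + 4 * M n ^ 2 * ε n) := by
      refine intervalIntegral.integral_mono_on ht0 (Continuous.intervalIntegrable
        ((continuous_hilbertNorm.comp (continuous_windowOf (q n))).pow 2) _ _)
        (hi.add intervalIntegrable_const) fun s _ => ?_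
      have h2 := norm_toL2_windowOf_le (T := T) (by linarith) (hqv n) (hqM n) s
      rw [sub_zero] at h2
      have h3 := pow_le_pow_left₀ (norm_nonneg _) h2 2
      rw [mul_pow, Real.sq_sqrt (by linarith)] at h3
      unfold hilbertNorm
      rw [windowOf_apply, coe_zeroPt, add_zero, ← sq_abs (q n s)]
      nlinarith [sq_nonneg (|q n s| - ‖toL2 (windowOf T (q n) s)‖)]
    have h4 := integral_le_of_vanish_right (v := fun s => 2 * q n s ^ 2) (δ := 2 * ε n)
      (M := 2 * M n ^ 2) ht0 (by linarith) (by positivity)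
      (fun s hs => by rw [hqv n s fun hy => by linarith [hy.2]]; simp)
      (fun s _ => mul_le_mul_of_nonneg_left
        (sq_le_sq.2 ((hqM n s).trans (le_abs_self _))) zero_le_two) hi
    rw [intervalIntegral.integral_add hi intervalIntegrable_const, intervalIntegral.integral_const,
      smul_eq_mul, sub_zero] at h1
    rw [inv_mul_le_iff₀ hεn]
    linarith
  have hJ := tendsto_integral_rightPart_extIncr hu hS hSc hC hg ht hε hε0
    (φ := fun n s => windowOf T (q n) s) (fun n => (continuous_windowOf (q n)).continuousOn)
    (fun n s _ => by
      have := (abs_nonneg _).trans (hpD n 0)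
      have := hK n
      have := hε n
      refine ⟨(ε n)⁻¹ * (A + ε n ^ 2 + (A + ε n ^ 2)) + K n, by positivity, fun x y =>
        (lipschitz_initPart (hε n) (hpK n) (hK n) (hpD n) (s + x) (s + y)).trans (le_of_eq ?_)⟩
      rw [add_sub_add_left_eq_sub]) hMlim
    (fun n s _ => norm_windowOf_le (hqM n) s) hN
  refine tendsto_inv_mul_integral_of_abs hε ht0 ?_
  have hlim := hJ.add (hε0.const_mul (4 * B * t))
  rw [mul_zero, add_zero] at hlim
  refine squeeze_zero (fun n => mul_nonneg (inv_nonneg.2 (hε n).le)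
    (intervalIntegral.integral_nonneg ht0 fun _ _ => abs_nonneg _)) (fun n => ?_) hlim
  have hεn := hε n
  have hint : ∀ f : C(ℝ, ℝ), IntervalIntegrable (fun s =>
      |rightPart (fderiv ℝ (u s) (windowOf T g s)) s (extIncr (ε n) (windowOf T f s))|)
      volume 0 t := fun f => by
    rw [intervalIntegrable_iff_integrableOn_Icc_of_le ht0]
    exact (integrableOn_rightPart hL
      ((continuous_extIncr _).comp (continuous_windowOf f)).continuousOn).abs
  have h1 : ∫ s in (0 : ℝ)..t, |rightPart (fderiv ℝ (u s) (windowOf T g s)) s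
        (extIncr (ε n) (windowOf T (initPart (ε n) g) s))| ≤
      ∫ s in (0 : ℝ)..t, (|rightPart (fderiv ℝ (u s) (windowOf T g s)) s
        (extIncr (ε n) (windowOf T (q n) s))| + B * (2 * (2 * ε n ^ 2))) := by
    refine intervalIntegral.integral_mono_on ht0 (hint _)
      ((hint _).add intervalIntegrable_const) fun s hs => ?_
    have e : extIncr (ε n) (windowOf T (initPart (ε n) g) s) =
        extIncr (ε n) (windowOf T (q n) s) +
          extIncr (ε n) (windowOf T (initPart (ε n) g) s - windowOf T (q n) s) := by
      rw [← extIncr_add, add_sub_cancel]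
    rw [e, rightPart_add]
    refine (abs_add_le _ _).trans (add_le_add le_rfl ((abs_rightPart_le _ _ _).trans ?_))
    refine mul_le_mul (hB s hs) ((norm_extIncr_le _ _).trans ?_) (norm_nonneg _) hB0
    refine mul_le_mul_of_nonneg_left ?_ zero_le_two
    exact (ContinuousMap.norm_le _ (by positivity)).2 fun x => hdiff n _
  rw [intervalIntegral.integral_add (hint _) intervalIntegrable_const,
    intervalIntegral.integral_const, smul_eq_mul, sub_zero] at h1
  refine (mul_le_mul_of_nonneg_left h1 (inv_nonneg.2 hεn.le)).trans ?_
  rw [mul_add]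
  refine add_le_add le_rfl (le_of_eq ?_)
  field_simp
  ring

/-- Splitting of the first order term. Subtracting the increments of the initial part of the path
makes the increments of the windows vanish on `[-T, -s]`. -/
lemma apply_windowOf_sub (L : PathSpace T →L[ℝ] ℝ) (hg : HasQV T σ g) {ε s : ℝ} (hε : 0 < ε) :
    L (windowOf T g (s + ε) - windowOf T g s) - deltaPart L * (g (s + ε) - g s) =
      rightPart L s (extIncr ε (windowOf T g s)) + rightPart L s (futureIncr T ε g s) +
      L (windowOf T (initPart ε g) (s + ε) - windowOf T (initPart ε g) s) -
      deltaPart L * (initPart ε g (s + ε) - initPart ε g s) -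
      rightPart L s (extIncr ε (windowOf T (initPart ε g) s)) -
      rightPart L s (futureIncr T ε (initPart ε g) s) := by
  have h := apply_eq_of_vanish L (s := s) ((windowOf T g (s + ε) - windowOf T g s) -
    (windowOf T (initPart ε g) (s + ε) - windowOf T (initPart ε g) s)) fun x hx => by
      simp only [ContinuousMap.sub_apply, windowOf_apply, initPart_apply]
      rw [initCut_of_le hε (by linarith), initCut_of_le hε (by linarith),
        max_eq_right (by linarith : s + (x : ℝ) ≤ 0), hg.left (s + x) (by linarith)]
      rcases le_total (s + ε + (x : ℝ)) 0 with h | h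
      · rw [max_eq_right h, hg.left _ h]; ring
      · rw [max_eq_left h]; ring
  have h2 : ∀ f : C(ℝ, ℝ), (windowOf T f (s + ε) - windowOf T f s) zeroPt = f (s + ε) - f s :=
    fun f => by simp only [ContinuousMap.sub_apply, windowOf_apply, coe_zeroPt, add_zero]
  rw [map_sub, ContinuousMap.sub_apply, h2, h2, rightPart_sub, windowOf_sub hε.le,
    windowOf_sub hε.le, rightPart_add, rightPart_add] at h
  rw [windowOf_sub hε.le, windowOf_sub hε.le]
  linear_combination h

/-- The first order term of the expansion: what remains beside `D^{δ₀} u` converges to the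
deterministic forward integrals. -/
lemma tendsto_integral_first_order (hu : IsC12 u)
    (hS : ∀ t ∈ Ico 0 T, ∀ η ∈ qvSpace T (fun t => σ ^ 2 * t) t, ∀ f g : PathSpace T,
      fderiv ℝ (fderiv ℝ (u t)) η f g = (S t η).form f g)
    (hSc : ContinuousOn (fun p : ℝ × PathSpace T => S p.1 p.2)
      {p | p.1 ∈ Ico 0 T ∧ p.2 ∈ qvSpace T (fun t => σ ^ 2 * t) p.1})
    (hC : ConditionC (fun t => σ ^ 2 * t) u) (hg : HasQV T σ g) (ht : t ∈ Ico 0 T)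
    {ε : ℕ → ℝ} (hε : ∀ n, 0 < ε n) (hε0 : Tendsto ε atTop (𝓝 0)) :
    Tendsto (fun n => (ε n)⁻¹ * ∫ s in (0 : ℝ)..t,
      (fderiv ℝ (u s) (windowOf T g s) (windowOf T g (s + ε n) - windowOf T g s) -
        gradDelta u s (windowOf T g s) * (g (s + ε n) - g s)))
      atTop (𝓝 (∫ s in (0 : ℝ)..t, horizontalTerm u s (windowOf T g s))) := by
  have ht0 := ht.1
  have hgc := g.continuous
  obtain ⟨A, w, hA0, hgA, hw, hw0, -, hwm⟩ := hg.exists_modulus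
  have hL := continuousOn_fderiv_along hu ht (continuous_windowOf (T := T) g).continuousOn
  obtain ⟨B, hB0, hB⟩ := exists_bound_fderiv_along hu ht
    (continuous_windowOf (T := T) g).continuousOn
  set L : ℝ → PathSpace T →L[ℝ] ℝ := fun s => fderiv ℝ (u s) (windowOf T g s) with hLdef
  have hwε : Tendsto (fun n => w (ε n)) atTop (𝓝 0) :=
    hw.comp (tendsto_nhdsWithin_iff.2 ⟨hε0, .of_forall hε⟩)
  set q : ℕ → C(ℝ, ℝ) := fun n => initPart (ε n) g with hq
  have hqW : ∀ n y, |q n y| ≤ w (ε n) := fun n y =>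
    abs_initPart_le (hε n) (hw0 _) fun hy => hwm _ (hε n) _ _ (by
      rw [sub_zero, abs_of_pos hy.1]; exact hy.2.le)
  have hqv : ∀ n y, 2 * ε n ≤ y → q n y = 0 := fun n y hy =>
    initPart_of_notMem (hε n) fun h => by linarith [h.2]
  have hqd : ∀ n a b, |q n a - q n b| ≤ 2 * w (ε n) := fun n a b => by
    rw [two_mul]; exact (abs_sub _ _).trans (add_le_add (hqW n a) (hqW n b))
  have hR : ∀ F : ℝ → PathSpace T, Continuous F →
      IntervalIntegrable (fun s => rightPart (L s) s (F s)) volume 0 t := fun F hF => by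
    rw [intervalIntegrable_iff_integrableOn_Icc_of_le ht0]
    exact integrableOn_rightPart hL hF.continuousOn
  have hext : ∀ n (f : C(ℝ, ℝ)), Continuous fun s => extIncr (ε n) (windowOf T f s) := fun n f =>
    (continuous_extIncr _).comp (continuous_windowOf f)
  have hcB : Tendsto (fun n => B * (2 * w (ε n))) atTop (𝓝 0) := by
    simpa using (hwε.const_mul 2).const_mul B
  have hδc : ∀ n, ContinuousOn (fun s => deltaPart (L s) * (q n (s + ε n) - q n s)) (Icc 0 t) :=
    fun n => by
      have := (q n).continuous
      exact (continuous_deltaPart.comp_continuousOn hL).mul (by fun_prop)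
  have hδi : ∀ n, IntervalIntegrable (fun s => deltaPart (L s) * (q n (s + ε n) - q n s))
      volume 0 t := fun n => by
    refine ContinuousOn.intervalIntegrable ?_
    rw [uIcc_of_le ht0]
    exact hδc n
  have hLi : ∀ n, IntervalIntegrable (fun s =>
      L s (windowOf T (q n) (s + ε n) - windowOf T (q n) s)) volume 0 t := fun n => by
    refine ContinuousOn.intervalIntegrable ?_
    rw [uIcc_of_le ht0]
    have := continuous_windowOf (T := T) (q n)
    exact hL.clm_apply (by fun_prop)
  -- the six terms of `apply_windowOf_sub`
  have c1 := tendsto_integral_detForward hu hC hg ht hε hε0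
  have c2 := tendsto_inv_mul_integral_of_abs hε ht0
    (tendsto_integral_rightPart_futureIncr hu hS hSc hC hg ht hε hε0)
  have c3 := tendsto_integral_apply_initPart hu hS hSc hg ht hε hε0
  have c4 := tendsto_inv_mul_integral_of_vanish hε ht0 hδi (fun n s hs => by
      have := hε n
      rw [hqv n s hs, hqv n (s + ε n) (by linarith), sub_self, mul_zero]) (fun n s hs => by
      rw [abs_mul]
      exact mul_le_mul ((abs_deltaPart_le _).trans (hB s hs)) (hqd n _ _) (abs_nonneg _) hB0) hcB
  have c5 := tendsto_integral_rightPart_initPart hu hS hSc hC hg ht hε hε0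
  have hzero : ∀ s : ℝ, rightPart (L s) s (0 : PathSpace T) = 0 := fun s => by
    have := abs_rightPart_le (L s) s 0
    rw [norm_zero, mul_zero] at this
    exact abs_eq_zero.1 (le_antisymm this (abs_nonneg _))
  have c6 := tendsto_inv_mul_integral_of_vanish hε ht0
    (fun n => hR _ (continuous_futureIncr (T := T) (ε n) (q n))) (fun n s hs => by
      have : futureIncr T (ε n) (q n) s = 0 := by
        ext x
        change q n (s + max (x + ε n) 0) - q n s = 0
        rw [hqv n s hs, hqv n _ (by linarith [le_max_right ((x : ℝ) + ε n) 0]), sub_self]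
      rw [this, hzero]) (fun n s hs => by
      refine (abs_rightPart_le _ _ _).trans (mul_le_mul (hB s hs) ?_ (norm_nonneg _) hB0)
      exact (ContinuousMap.norm_le _ (by have := hw0 (ε n); positivity)).2 fun x => hqd n _ _) hcB
  have hall := ((((c1.add c2).add c3).sub c4).sub c5).sub c6
  simp only [add_zero, sub_zero] at hall
  refine hall.congr fun n => ?_
  have hεn := hε n
  have i1 := hR _ (hext n g)
  have i2 := hR _ (continuous_futureIncr (T := T) (ε n) g)
  have i3 := hLi n
  have i4 := hδi n
  have i5 := hR _ (hext n (q n))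
  have i6 := hR _ (continuous_futureIncr (T := T) (ε n) (q n))
  rw [intervalIntegral.integral_const_mul, ← mul_add, ← mul_add, ← mul_sub, ← mul_sub, ← mul_sub,
    ← intervalIntegral.integral_add i1 i2, ← intervalIntegral.integral_add (i1.add i2) i3,
    ← intervalIntegral.integral_sub ((i1.add i2).add i3) i4,
    ← intervalIntegral.integral_sub (((i1.add i2).add i3).sub i4) i5,
    ← intervalIntegral.integral_sub ((((i1.add i2).add i3).sub i4).sub i5) i6]
  congr 1
  refine intervalIntegral.integral_congr fun s _ => ?_
  exact (apply_windowOf_sub (L s) hg hεn).symm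

end FirstOrder

/-! ### The second order term -/

section Diagonal

variable {T : ℝ} [hT : Fact (0 < T)]

instance nullSingletonClass_leb : NullSingletonClass (leb T) where
  measure_singleton x := by
    rw [(MeasurableEmbedding.subtype_coe measurableSet_Icc).comap_apply, image_singleton]
    exact measure_singleton _

/-- The indicator function of `[-s, 0]`. -/
noncomputable def step (s : ℝ) (x : Icc (-T) (0 : ℝ)) : ℝ := if -s ≤ (x : ℝ) then 1 else 0

lemma diagIndicator_of_ne {s : ℝ} {x y : Icc (-T) (0 : ℝ)} (h : x ≠ y) :
    diagIndicator T s x y = 0 := by simp [diagIndicator, h]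

lemma diagIndicator_self (s : ℝ) (x : Icc (-T) (0 : ℝ)) : diagIndicator T s x x = step s x := by
  by_cases h : -s ≤ (x : ℝ) <;> simp [diagIndicator, step, h]

/-- The pairing of an element of `χ₀` with the diagonal of `[-s, 0]²`: only the atom at `(0, 0)`
and the density on the diagonal contribute. -/
lemma pair_diagIndicator (c : Chi0 T) {s : ℝ} (hs : 0 ≤ s) :
    c.pair (diagIndicator T s) =
      c.1 + ∫ x, c.2.2.2.2 x * step s x ∂leb T := by
  have hne : ∀ᵐ x ∂leb T, x ≠ zeroPt := compl_mem_ae_iff.2 (measure_singleton _)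
  have h0 : diagIndicator T s zeroPt zeroPt = 1 := by
    rw [diagIndicator_self, step, if_pos (by rw [coe_zeroPt]; linarith)]
  have h1 : ∫ x, c.2.1 x * diagIndicator T s x zeroPt ∂leb T = 0 := by
    refine integral_eq_zero_of_ae ?_
    filter_upwards [hne] with x hx
    rw [diagIndicator_of_ne hx, mul_zero]; rfl
  have h2 : ∫ y, c.2.2.1 y * diagIndicator T s zeroPt y ∂leb T = 0 := by
    refine integral_eq_zero_of_ae ?_
    filter_upwards [hne] with x hx
    rw [diagIndicator_of_ne hx.symm, mul_zero]; rfl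
  have h3 : ∫ z, c.2.2.2.1 z * diagIndicator T s z.1 z.2 ∂(leb T).prod (leb T) = 0 := by
    refine integral_eq_zero_of_ae ?_
    have : ∀ᵐ z ∂(leb T).prod (leb T), z.1 ≠ z.2 := by
      refine (Measure.ae_prod_iff_ae_ae (measurableSet_eq_fun measurable_fst
        measurable_snd).compl).2 (.of_forall fun x => ?_)
      have h : ∀ᵐ y ∂leb T, y ≠ x := compl_mem_ae_iff.2 (measure_singleton _)
      filter_upwards [h] with y hy using hy.symm
    filter_upwards [this] with z hz
    rw [diagIndicator_of_ne hz, mul_zero]; rfl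
  unfold Chi0.pair
  rw [h0, h1, h2, h3, mul_one, add_zero, add_zero, add_zero]
  simp only [diagIndicator_self]

lemma measurable_step (s : ℝ) :
    Measurable (step s : Icc (-T) (0 : ℝ) → ℝ) :=
  Measurable.ite (measurableSet_le measurable_const measurable_subtype_coe) measurable_const
    measurable_const

lemma abs_step_le (s : ℝ) (x : Icc (-T) (0 : ℝ)) : |step s x| ≤ 1 := by
  unfold step; split_ifs <;> simp

lemma integrable_step (s : ℝ) : Integrable (step s) (leb T) :=
  Integrable.of_bound (measurable_step s).aestronglyMeasurable 1 (.of_forall (abs_step_le s))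

lemma integral_abs_step_sub_le {s s' : ℝ} (h : s ≤ s') :
    ∫ x, |step s' x - step s x| ∂leb T ≤ s' - s := by
  have hT' := hT.out
  unfold step
  rw [integral_leb (fun x : ℝ => |(if -s' ≤ x then (1 : ℝ) else 0) - if -s ≤ x then 1 else 0|),
    intervalIntegral.integral_of_le (by linarith)]
  have e : (fun x : ℝ => |(if -s' ≤ x then (1 : ℝ) else 0) - if -s ≤ x then 1 else 0|) =
      (Ico (-s') (-s)).indicator fun _ => 1 := by
    ext x
    by_cases h1 : -s' ≤ x <;> by_cases h2 : -s ≤ x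
    · rw [indicator_of_notMem fun h => absurd h.2 (not_lt.2 h2)]; simp [h1, h2]
    · rw [indicator_of_mem (show x ∈ Ico (-s') (-s) from ⟨h1, not_le.1 h2⟩)]; simp [h1, h2]
    · exact absurd (by linarith : -s' ≤ x) h1
    · rw [indicator_of_notMem fun h => h1 h.1]; simp [h1, h2]
  rw [e]
  have hi : Integrable ((Ico (-s') (-s)).indicator fun _ => (1 : ℝ)) := by
    rw [integrable_indicator_iff measurableSet_Ico]
    exact integrableOn_const (by simp)
  refine (setIntegral_le_integral hi (.of_forall
    (indicator_nonneg fun _ _ => zero_le_one))).trans (le_of_eq ?_)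
  rw [integral_indicator measurableSet_Ico, setIntegral_const, smul_eq_mul, mul_one,
    Real.volume_real_Ico_of_le (by linarith)]
  ring

lemma abs_integral_linfty_le (γ : Lp ℝ ∞ (leb T)) {f : Icc (-T) (0 : ℝ) → ℝ}
    (hf : Integrable f (leb T)) : |∫ x, γ x * f x ∂leb T| ≤ ‖γ‖ * ∫ x, |f x| ∂leb T := by
  rw [← integral_const_mul]
  refine MeasureTheory.norm_integral_le_of_norm_le (f := fun x => γ x * f x) (hf.abs.const_mul _) ?_
  filter_upwards [ae_abs_le_norm γ] with x hx
  rw [norm_mul, Real.norm_eq_abs, Real.norm_eq_abs]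
  exact mul_le_mul_of_nonneg_right hx (abs_nonneg _)

lemma abs_pair_diagIndicator_sub_le (c c' : Chi0 T) {s s' : ℝ} (hs : 0 ≤ s) (hss : s ≤ s') :
    |c'.pair (diagIndicator T s') - c.pair (diagIndicator T s)| ≤
      (1 + T) * ‖c' - c‖ + (s' - s) * ‖c‖ := by
  have hT' := hT.out
  rw [pair_diagIndicator _ hs, pair_diagIndicator _ (hs.trans hss)]
  set γ := c.2.2.2.2
  set γ' := c'.2.2.2.2
  have hst : Integrable (fun x => step s' x - step s x) (leb T) :=
    (integrable_step s').sub (integrable_step s)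
  have e1 : ∫ x, γ' x * step s' x ∂leb T -
      ∫ x, γ x * step s x ∂leb T =
      ∫ x, (γ' - γ) x * step s' x ∂leb T +
      ∫ x, γ x * (step s' x - step s x) ∂leb T := by
    rw [← integral_sub (integrable_linfty_mul _ (integrable_step _))
      (integrable_linfty_mul _ (integrable_step _)),
      ← integral_add (integrable_linfty_mul _ (integrable_step _))
      (integrable_linfty_mul _ hst)]
    refine integral_congr_ae ?_
    filter_upwards [Lp.coeFn_sub γ' γ] with x hx
    rw [hx, Pi.sub_apply]
    ring
  have b1 : |∫ x, (γ' - γ) x * step s' x ∂leb T| ≤ ‖γ' - γ‖ * T := by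
    refine (abs_integral_linfty_le _ (integrable_step _)).trans ?_
    refine mul_le_mul_of_nonneg_left ?_ (norm_nonneg _)
    calc ∫ x, |step s' x| ∂leb T ≤ ∫ x, 1 ∂leb T :=
          integral_mono (integrable_step _).abs (integrable_const _) (abs_step_le s')
      _ = T := by
          rw [integral_leb (fun _ => (1 : ℝ))]; simp
  have b2 := (abs_integral_linfty_le γ hst).trans
    (mul_le_mul_of_nonneg_left (integral_abs_step_sub_le hss) (norm_nonneg _))
  obtain ⟨n1, -, -, -, n2⟩ := norm_components_le (c' - c)
  obtain ⟨-, -, -, -, n3⟩ := norm_components_le c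
  have n1 : |c'.1 - c.1| ≤ ‖c' - c‖ := n1
  have n2 : ‖γ' - γ‖ ≤ ‖c' - c‖ := n2
  have n3 : ‖γ‖ ≤ ‖c‖ := n3
  rw [add_sub_add_comm, e1]
  refine (abs_add_le _ _).trans ((add_le_add n1 ((abs_add_le _ _).trans
    (add_le_add b1 b2))).trans ?_)
  have n4 := mul_le_mul_of_nonneg_right n2 hT'.le
  have n5 := mul_le_mul_of_nonneg_left n3 (sub_nonneg.2 hss)
  linarith

lemma ContinuousOn.pair_diagIndicator {c : ℝ → Chi0 T} {t : ℝ} (hc : ContinuousOn c (Icc 0 t)) :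
    ContinuousOn (fun s => (c s).pair (diagIndicator T s)) (Icc 0 t) := by
  have hT' := hT.out
  obtain ⟨M, hM⟩ := isCompact_Icc.exists_bound_of_continuousOn hc
  intro s hs
  have h1 : Tendsto (fun r => (1 + T) * ‖c r - c s‖ + |r - s| * M) (𝓝[Icc 0 t] s) (𝓝 0) := by
    have h2 := ((hc s hs).sub_const (c s)).norm.const_mul (1 + T)
    have h3 : Tendsto (fun r : ℝ => |r - s| * M) (𝓝[Icc 0 t] s) (𝓝 (|s - s| * M)) :=
      (Continuous.tendsto (by fun_prop) s).mono_left nhdsWithin_le_nhds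
    have := h2.add h3
    simpa using this
  rw [ContinuousWithinAt, tendsto_iff_dist_tendsto_zero]
  refine squeeze_zero' (.of_forall fun _ => dist_nonneg) ?_ h1
  filter_upwards [self_mem_nhdsWithin] with r hr
  rw [Real.dist_eq]
  rcases le_total s r with h | h
  · refine (abs_pair_diagIndicator_sub_le (c s) (c r) hs.1 h).trans ?_
    rw [abs_of_nonneg (sub_nonneg.2 h)]
    exact add_le_add le_rfl (mul_le_mul_of_nonneg_left (hM s hs) (sub_nonneg.2 h))
  · rw [abs_sub_comm, norm_sub_rev, abs_sub_comm r]
    refine (abs_pair_diagIndicator_sub_le (c r) (c s) hr.1 h).trans ?_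
    rw [abs_of_nonneg (sub_nonneg.2 h)]
    exact add_le_add le_rfl (mul_le_mul_of_nonneg_left (hM r hr) (sub_nonneg.2 h))

end Diagonal

section Weak

variable {T : ℝ} [hT : Fact (0 < T)] {g : C(ℝ, ℝ)} {σ : ℝ}

/-- The increments of windows are of order `ε` against Lipschitz functions, the shift being moved to
the latter by a change of variables. -/
lemma abs_integral_increment_mul_le {A : ℝ} (hA : ∀ y, |g y| ≤ A) {f : PathSpace T} {M : ℝ}
    (hM : 0 ≤ M) (hf : ∀ x y, |f x - f y| ≤ M * |(x : ℝ) - y|) {ε : ℝ} (hε : 0 < ε) (s : ℝ) :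
    |∫ x, f x * (windowOf T g (s + ε) - windowOf T g s) x ∂leb T| ≤
      (A * M * T + 2 * (A * ‖f‖)) * ε := by
  have hT' := hT.out
  have hA0 : 0 ≤ A := (abs_nonneg _).trans (hA 0)
  have hgc := g.continuous
  have hfc := continuous_extend f
  set H : ℝ → ℝ := fun y => extend f (y - ε) * g (s + y) with hH
  have hHc : Continuous H := by fun_prop
  have hHi : ∀ a b, IntervalIntegrable H volume a b := fun a b => hHc.intervalIntegrable _ _
  have hHb : ∀ y, |H y| ≤ A * ‖f‖ := fun y => by
    rw [abs_mul, mul_comm]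
    exact mul_le_mul (hA _) (abs_extend_le f _) (abs_nonneg _) hA0
  have e0 : ∫ x, f x * (windowOf T g (s + ε) - windowOf T g s) x ∂leb T =
      ∫ x in (-T)..0, (H (x + ε) - extend f x * g (s + x)) := by
    rw [← integral_leb (fun x => H (x + ε) - extend f x * g (s + x))]
    congr 1
    ext x
    simp only [hH, ContinuousMap.sub_apply, windowOf_apply, add_sub_cancel_right, extend_coe]
    rw [show s + ((x : ℝ) + ε) = s + ε + x by ring]
    ring
  have e1 : ∫ x in (-T)..0, (H (x + ε) - extend f x * g (s + x)) =
      (∫ x in (-T)..0, (H x - extend f x * g (s + x))) + (∫ x in (0 : ℝ)..ε, H x) -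
        ∫ x in (-T)..(-T + ε), H x := by
    rw [intervalIntegral.integral_sub (Continuous.intervalIntegrable (by fun_prop) _ _)
      (Continuous.intervalIntegrable (by fun_prop) _ _),
      intervalIntegral.integral_sub (hHi _ _) (Continuous.intervalIntegrable (by fun_prop) _ _),
      intervalIntegral.integral_comp_add_right, zero_add]
    have := intervalIntegral.integral_add_adjacent_intervals (hHi (-T) (-T + ε)) (hHi (-T + ε) ε)
    have := intervalIntegral.integral_add_adjacent_intervals (hHi (-T) 0) (hHi 0 ε)
    linarith
  have b1 : |∫ x in (-T)..0, (H x - extend f x * g (s + x))| ≤ A * M * T * ε := by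
    have := intervalIntegral.norm_integral_le_of_norm_le_const
      (f := fun x => H x - extend f x * g (s + x)) (a := -T) (b := 0) (C := A * (M * ε))
      fun x _ => by
        simp only [hH]
        rw [← sub_mul, Real.norm_eq_abs, abs_mul, mul_comm]
        have h := abs_extend_sub_le hf hM (x - ε) x
        rw [sub_sub_cancel_left, abs_neg, abs_of_pos hε] at h
        exact mul_le_mul (hA _) h (abs_nonneg _) hA0
    rw [zero_sub, neg_neg, abs_of_pos hT'] at this
    exact this.trans (le_of_eq (by ring))
  have b2 : |∫ x in (0 : ℝ)..ε, H x| ≤ A * ‖f‖ * ε := by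
    have := intervalIntegral.norm_integral_le_of_norm_le_const (f := H) (a := 0) (b := ε)
      fun x _ => hHb x
    rwa [sub_zero, abs_of_pos hε] at this
  have b3 : |∫ x in (-T)..(-T + ε), H x| ≤ A * ‖f‖ * ε := by
    have := intervalIntegral.norm_integral_le_of_norm_le_const (f := H) (a := -T) (b := -T + ε)
      fun x _ => hHb x
    rwa [add_sub_cancel_left, abs_of_pos hε] at this
  rw [e0, e1]
  refine (abs_sub _ _).trans ((add_le_add ((abs_add_le _ _).trans (add_le_add b1 b2)) b3).trans
    (le_of_eq ?_))
  ring

lemma exists_lipschitz_toL2_near (a : Lp ℝ 2 (leb T)) {κ : ℝ} (hκ : 0 < κ) :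
    ∃ f : PathSpace T, (∃ M, 0 ≤ M ∧ ∀ x y, |f x - f y| ≤ M * |(x : ℝ) - y|) ∧
      ‖a - toL2 f‖ < κ := by
  have hd : DenseRange (toL2 : PathSpace T → Lp ℝ 2 (leb T)) :=
    ContinuousMap.toLp_denseRange ℝ (leb T) ℝ (by simp)
  obtain ⟨f, hf⟩ := hd.exists_dist_lt a (half_pos hκ)
  set N := ‖(toL2 : PathSpace T →L[ℝ] Lp ℝ 2 (leb T))‖ with hN
  have hN0 : 0 ≤ N := ContinuousLinearMap.opNorm_nonneg _
  obtain ⟨p, M, hM, hp, hpf⟩ := exists_lipschitz_near f (δ := κ / (2 * (N + 1))) (by positivity)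
  refine ⟨p, ⟨M, hM, hp⟩, ?_⟩
  rw [dist_eq_norm] at hf
  have e : a - toL2 p = (a - toL2 f) - toL2 (p - f) := by rw [map_sub]; abel
  have h1 : ‖toL2 (p - f)‖ ≤ N * (κ / (2 * (N + 1))) :=
    ((toL2 : PathSpace T →L[ℝ] Lp ℝ 2 (leb T)).le_opNorm _).trans
      (mul_le_mul_of_nonneg_left hpf.le hN0)
  have h2 : N * (κ / (2 * (N + 1))) ≤ κ / 2 := by
    rw [mul_div_assoc', div_le_div_iff₀ (by positivity) (by positivity)]
    nlinarith
  rw [e]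
  refine (norm_sub_le _ _).trans_lt ?_
  linarith

/-- Divided by `√ε`, the increments of windows converge weakly to `0`. -/
lemma HasQV.inner_increment_le (hg : HasQV T σ g) (a : Lp ℝ 2 (leb T)) {κ : ℝ} (hκ : 0 < κ) :
    ∀ᶠ ε : ℝ in 𝓝[>] 0, ∀ s ∈ Icc 0 T,
      |inner ℝ (toL2 (windowOf T g (s + ε) - windowOf T g s)) a| ≤ κ * √ε := by
  have hT' := hT.out
  obtain ⟨A, -, hA0, hgA, -⟩ := hg.exists_modulus
  obtain ⟨C, hC, ε₀, hε₀, hbd⟩ := hg.exists_bounds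
  obtain ⟨f, ⟨M, hM, hf⟩, hfa⟩ := exists_lipschitz_toL2_near a (κ := κ / (2 * C)) (by positivity)
  set D := A * M * T + 2 * (A * ‖f‖) with hD
  have hD0 : 0 ≤ D := by positivity
  have hmin : 0 < min ε₀ ((κ / (2 * (D + 1))) ^ 2) := by positivity
  filter_upwards [Ioc_mem_nhdsGT hmin] with ε ⟨hε, hεε⟩ s hs
  set Δ := windowOf T g (s + ε) - windowOf T g s
  have h1 : ‖toL2 Δ‖ ≤ C * √ε := ((hbd ε hε (hεε.trans (min_le_left _ _))).2 s hs).1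
  have e1 : inner ℝ (toL2 Δ) (toL2 f) = ∫ x, f x * Δ x ∂leb T := by
    rw [inner_toL2]
    refine integral_congr_ae ?_
    filter_upwards [coeFn_toL2 f] with x hx
    rw [hx]
  have h2 : |inner ℝ (toL2 Δ) (toL2 f)| ≤ D * ε := by
    rw [e1]; exact abs_integral_increment_mul_le hgA hM hf hε s
  have h3 : |inner ℝ (toL2 Δ) (a - toL2 f)| ≤ C * √ε * (κ / (2 * C)) :=
    (abs_real_inner_le_norm _ _).trans (mul_le_mul h1 hfa.le (norm_nonneg _) (by positivity))
  have h4 : √ε ≤ κ / (2 * (D + 1)) := by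
    rw [Real.sqrt_le_left (by positivity)]; exact hεε.trans (min_le_right _ _)
  have h5 : D * ε ≤ κ / 2 * √ε := by
    have h6 : D * √ε ≤ κ / 2 := by
      rw [le_div_iff₀ (by positivity)] at h4
      have := Real.sqrt_nonneg ε
      nlinarith
    calc D * ε = D * √ε * √ε := by rw [mul_assoc, Real.mul_self_sqrt hε.le]
      _ ≤ _ := mul_le_mul_of_nonneg_right h6 (Real.sqrt_nonneg _)
  have e2 : inner ℝ (toL2 Δ) a = inner ℝ (toL2 Δ) (toL2 f) + inner ℝ (toL2 Δ) (a - toL2 f) := by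
    rw [← inner_add_right, add_sub_cancel]
  rw [e2]
  refine (abs_add_le _ _).trans ((add_le_add (h2.trans h5) h3).trans (le_of_eq ?_))
  field_simp
  ring

/-- The algebra of continuous functions on the square that are Lipschitz in the first variable. -/
def lipschitzFirst (T : ℝ) : Subalgebra ℝ C(Icc (-T) (0 : ℝ) × Icc (-T) (0 : ℝ), ℝ) where
  carrier := {K | ∃ M, 0 ≤ M ∧ ∀ x x' y, |K (x, y) - K (x', y)| ≤ M * |(x : ℝ) - x'|}
  mul_mem' := by
    rintro K K' ⟨M, hM, h⟩ ⟨M', hM', h'⟩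
    refine ⟨M * ‖K'‖ + ‖K‖ * M', by positivity, fun x x' y => ?_⟩
    have e : (K * K') (x, y) - (K * K') (x', y) =
        (K (x, y) - K (x', y)) * K' (x, y) + K (x', y) * (K' (x, y) - K' (x', y)) := by
      simp only [ContinuousMap.mul_apply]; ring
    rw [e]
    refine (abs_add_le _ _).trans ?_
    rw [abs_mul, abs_mul]
    have h1 := mul_le_mul (h x x' y) (K'.norm_coe_le_norm (x, y)) (abs_nonneg _) (by positivity)
    have h2 := mul_le_mul (K.norm_coe_le_norm (x', y)) (h' x x' y) (abs_nonneg _) (norm_nonneg _)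
    rw [Real.norm_eq_abs] at h1 h2
    linarith
  add_mem' := by
    rintro K K' ⟨M, hM, h⟩ ⟨M', hM', h'⟩
    refine ⟨M + M', by positivity, fun x x' y => ?_⟩
    simp only [ContinuousMap.add_apply]
    rw [add_sub_add_comm, add_mul]
    exact (abs_add_le _ _).trans (add_le_add (h x x' y) (h' x x' y))
  algebraMap_mem' r := ⟨0, le_rfl, fun x x' y => by
    simp [Algebra.algebraMap_eq_smul_one]⟩

lemma exists_lipschitzFirst_near (K : C(Icc (-T) (0 : ℝ) × Icc (-T) (0 : ℝ), ℝ)) {κ : ℝ}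
    (hκ : 0 < κ) : ∃ K' ∈ lipschitzFirst T, ‖K' - K‖ < κ := by
  have hsep : (lipschitzFirst T).SeparatesPoints := by
    rintro ⟨x, y⟩ ⟨x', y'⟩ hne
    by_cases hx : x = x'
    · refine ⟨_, ⟨⟨fun z => (z.2 : ℝ), by fun_prop⟩, ⟨0, le_rfl, fun _ _ _ => by simp⟩, rfl⟩, ?_⟩
      intro h
      exact hne (Prod.ext hx (Subtype.ext h))
    · refine ⟨_, ⟨⟨fun z => (z.1 : ℝ), by fun_prop⟩,
        ⟨1, zero_le_one, fun _ _ _ => by simp⟩, rfl⟩, ?_⟩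
      intro h
      exact hx (Subtype.ext h)
  obtain ⟨K', h⟩ := ContinuousMap.exists_mem_subalgebra_near_continuousMap_of_separatesPoints _
    hsep K κ hκ
  exact ⟨K', K'.2, h⟩

lemma exists_lipschitzFirst_toLp_near (k : Lp ℝ 2 ((leb T).prod (leb T))) {κ : ℝ} (hκ : 0 < κ) :
    ∃ K ∈ lipschitzFirst T, ‖k - ContinuousMap.toLp 2 ((leb T).prod (leb T)) ℝ K‖ < κ := by
  set Θ : C(Icc (-T) (0 : ℝ) × Icc (-T) (0 : ℝ), ℝ) →L[ℝ] Lp ℝ 2 ((leb T).prod (leb T)) :=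
    ContinuousMap.toLp 2 ((leb T).prod (leb T)) ℝ with hΘ
  have hd : DenseRange Θ := ContinuousMap.toLp_denseRange ℝ _ ℝ (by simp)
  obtain ⟨f, hf⟩ := hd.exists_dist_lt k (half_pos hκ)
  set N := ‖Θ‖ with hN
  have hN0 : 0 ≤ N := ContinuousLinearMap.opNorm_nonneg _
  obtain ⟨p, hp, hpf⟩ := exists_lipschitzFirst_near f (κ := κ / (2 * (N + 1))) (by positivity)
  refine ⟨p, hp, ?_⟩
  rw [dist_eq_norm] at hf
  have e : k - Θ p = (k - Θ f) - Θ (p - f) := by rw [map_sub]; abel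
  have h1 : ‖Θ (p - f)‖ ≤ N * (κ / (2 * (N + 1))) :=
    (Θ.le_opNorm _).trans (mul_le_mul_of_nonneg_left hpf.le hN0)
  have h2 : N * (κ / (2 * (N + 1))) ≤ κ / 2 := by
    rw [mul_div_assoc', div_le_div_iff₀ (by positivity) (by positivity)]
    nlinarith
  rw [e]
  refine (norm_sub_le _ _).trans_lt ?_
  linarith

/-- Divided by `ε`, the tensor squares of the increments of windows converge weakly to `0`. -/
lemma HasQV.inner_tensor_increment_le (hg : HasQV T σ g) (k : Lp ℝ 2 ((leb T).prod (leb T)))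
    {κ : ℝ} (hκ : 0 < κ) : ∀ᶠ ε : ℝ in 𝓝[>] 0, ∀ s ∈ Icc 0 T,
      |inner ℝ (tensorL2 (windowOf T g (s + ε) - windowOf T g s)
        (windowOf T g (s + ε) - windowOf T g s)) k| ≤ κ * ε := by
  have hT' := hT.out
  obtain ⟨A, w, hA0, hgA, hw, hw0, -, hwm⟩ := hg.exists_modulus
  obtain ⟨C, hC, ε₀, hε₀, hbd⟩ := hg.exists_bounds
  obtain ⟨K, ⟨M, hM, hK⟩, hKk⟩ := exists_lipschitzFirst_toLp_near k (κ := κ / (2 * C ^ 2))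
    (by positivity)
  set D := A * M * T + 2 * (A * ‖K‖) with hD
  have hD0 : 0 ≤ D := by positivity
  have hsmall : ∀ᶠ ε : ℝ in 𝓝[>] 0, D * T * w ε < κ / 2 := by
    have := hw.const_mul (D * T)
    rw [mul_zero] at this
    exact this.eventually (gt_mem_nhds (half_pos hκ))
  have hle : ∀ᶠ ε : ℝ in 𝓝[>] 0, ε < ε₀ :=
    (eventually_lt_nhds hε₀).filter_mono nhdsWithin_le_nhds
  filter_upwards [hsmall, hle, self_mem_nhdsWithin] with ε h1 h2 hε s hs
  have hε : 0 < ε := hε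
  set Δ := windowOf T g (s + ε) - windowOf T g s with hΔ
  have h3 : ‖toL2 Δ‖ ≤ C * √ε := ((hbd ε hε h2.le).2 s hs).1
  have hΔw : ∀ x, |Δ x| ≤ w ε := fun x => hwm _ hε _ _ (by
    rw [add_sub_add_right_eq_sub, add_sub_cancel_left, abs_of_pos hε]; linarith)
  set Θ := ContinuousMap.toLp 2 ((leb T).prod (leb T)) ℝ K
  have e1 : inner ℝ (tensorL2 Δ Δ) Θ = ∫ y, (∫ x, K (x, y) * Δ x ∂leb T) * Δ y ∂leb T := by
    rw [inner_tensorL2]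
    have e2 : ∫ z, Θ z * (Δ z.1 * Δ z.2) ∂(leb T).prod (leb T) =
        ∫ z, K z * (Δ z.1 * Δ z.2) ∂(leb T).prod (leb T) := by
      refine integral_congr_ae ?_
      filter_upwards [ContinuousMap.coeFn_toLp (p := 2) ((leb T).prod (leb T)) (𝕜 := ℝ) K] with z hz
      rw [hz]
    rw [e2, integral_prod_symm]
    · congr 1
      ext y
      rw [← integral_mul_const]
      congr 1
      ext x
      ring
    · exact Continuous.integrable_of_hasCompactSupport (by fun_prop)
        (HasCompactSupport.of_compactSpace _)
  have h4 : |inner ℝ (tensorL2 Δ Δ) Θ| ≤ D * ε * w ε * T := by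
    rw [e1]
    have h5 : ∀ y, ‖(∫ x, K (x, y) * Δ x ∂leb T) * Δ y‖ ≤ D * ε * w ε := fun y => by
      rw [norm_mul]
      let f : PathSpace T := ⟨fun x => K (x, y), by fun_prop⟩
      have h6 := abs_integral_increment_mul_le hgA (f := f) hM (fun x x' => hK x x' y) hε s
      have h7 : ‖f‖ ≤ ‖K‖ := (ContinuousMap.norm_le _ (norm_nonneg _)).2 fun x =>
        K.norm_coe_le_norm (x, y)
      refine mul_le_mul (h6.trans ?_) (hΔw y) (norm_nonneg _) (by positivity)
      rw [hD]
      gcongr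
    have h8 := norm_integral_le_of_norm_le_const (μ := leb T) (.of_forall h5)
    have h9 : (leb T).real univ = T := by
      have := integral_leb (T := T) (fun _ => (1 : ℝ))
      simpa using this
    rwa [h9] at h8
  have h10 : |inner ℝ (tensorL2 Δ Δ) (k - Θ)| ≤ C ^ 2 * ε * (κ / (2 * C ^ 2)) := by
    refine (abs_real_inner_le_norm _ _).trans (mul_le_mul ?_ hKk.le (norm_nonneg _) (by positivity))
    rw [norm_tensorL2]
    calc ‖toL2 Δ‖ * ‖toL2 Δ‖ ≤ (C * √ε) * (C * √ε) :=
          mul_le_mul h3 h3 (norm_nonneg _) (by positivity)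
      _ = C ^ 2 * (√ε * √ε) := by ring
      _ = _ := by rw [Real.mul_self_sqrt hε.le]
  have e3 : inner ℝ (tensorL2 Δ Δ) k =
      inner ℝ (tensorL2 Δ Δ) Θ + inner ℝ (tensorL2 Δ Δ) (k - Θ) := by
    rw [← inner_add_right, add_sub_cancel]
  rw [e3]
  refine (abs_add_le _ _).trans ((add_le_add h4 h10).trans ?_)
  have e4 : C ^ 2 * ε * (κ / (2 * C ^ 2)) = κ / 2 * ε := by field_simp
  rw [e4]
  nlinarith

end Weak

section SecondOrder

variable {T : ℝ} [hT : Fact (0 < T)] {g : C(ℝ, ℝ)} {σ : ℝ}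

lemma integral_linfty_swap (γ : Lp ℝ ∞ (leb T)) {h : ℝ → Icc (-T) (0 : ℝ) → ℝ}
    (hm : Measurable (Function.uncurry h)) {M : ℝ} (hb : ∀ s x, |h s x| ≤ M) (τ : ℝ) :
    ∫ s in (0 : ℝ)..τ, ∫ x, γ x * h s x ∂leb T = ∫ x, γ x * (∫ s in (0 : ℝ)..τ, h s x) ∂leb T := by
  have : IsFiniteMeasure (volume.restrict (uIoc 0 τ)) :=
    isFiniteMeasure_restrict.2 measure_Ioc_lt_top.ne
  rw [intervalIntegral_integral_swap]
  · simp only [intervalIntegral.integral_const_mul]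
  · refine Integrable.of_bound ((Lp.aestronglyMeasurable γ).comp_snd.mul
      hm.aestronglyMeasurable) (‖γ‖ * M) ?_
    have := Measure.quasiMeasurePreserving_snd (μ := volume.restrict (uIoc 0 τ)) (ν := leb T)
      |>.ae (ae_abs_le_norm γ)
    filter_upwards [this] with z hz
    rw [Function.uncurry, norm_mul]
    exact mul_le_mul hz (hb _ _) (norm_nonneg _) (norm_nonneg _)

lemma integral_step {τ : ℝ} (hτ : 0 ≤ τ) (x : Icc (-T) (0 : ℝ)) :
    ∫ s in (0 : ℝ)..τ, step s x = max (τ + x) 0 := by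
  have e : (fun s : ℝ => step s x) = (Ici (-(x : ℝ))).indicator fun _ => 1 := by
    ext s
    unfold step
    by_cases h : -s ≤ (x : ℝ)
    · rw [if_pos h, indicator_of_mem (show s ∈ Ici (-(x : ℝ)) from neg_le.1 h)]
    · rw [if_neg h, indicator_of_notMem (show s ∉ Ici (-(x : ℝ)) from fun h' => h (neg_le.1 h'))]
  have e' : volume.real (Ioc 0 τ ∩ Ici (-(x : ℝ))) = volume.real (Ioc 0 τ ∩ Ioi (-(x : ℝ))) :=
    measureReal_congr (ae_eq_set_inter (ae_eq_refl _) Ioi_ae_eq_Ici.symm)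
  rw [e, intervalIntegral.integral_of_le hτ, setIntegral_indicator measurableSet_Ici,
    setIntegral_const, smul_eq_mul, mul_one,
    e', Ioc_inter_Ioi, Real.volume_real_Ioc, max_eq_right (neg_nonneg.2 x.2.2), sub_neg_eq_add]

lemma measurable_uncurry_step :
    Measurable (Function.uncurry (step : ℝ → Icc (-T) (0 : ℝ) → ℝ)) :=
  Measurable.ite (measurableSet_le measurable_fst.neg
    (measurable_subtype_coe.comp measurable_snd)) measurable_const measurable_const

/-- The quadratic variation of a path on the parts of a translated interval. -/
lemma HasQV.integral_sq_shift (hg : HasQV T σ g) :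
    ∃ M, (∀ᶠ ε : ℝ in 𝓝[>] 0, ∀ τ ∈ Icc 0 T, ∀ x ∈ Icc (-T) 0,
      |ε⁻¹ * ∫ s in (0 : ℝ)..τ, (g (s + ε + x) - g (s + x)) ^ 2| ≤ M) ∧
    ∀ τ ∈ Icc 0 T, ∀ x ∈ Icc (-T) 0, Tendsto
      (fun ε : ℝ => ε⁻¹ * ∫ s in (0 : ℝ)..τ, (g (s + ε + x) - g (s + x)) ^ 2) (𝓝[>] 0)
      (𝓝 (σ ^ 2 * max (τ + x) 0)) := by
  have hT' := hT.out
  have hgc := g.continuous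
  obtain ⟨B, w, hB, hgB, hw, hw0, hwB, hwm⟩ := hg.exists_modulus
  obtain ⟨C, hC, ε₀, hε₀, hbd⟩ := hg.exists_bounds
  have hi : ∀ ε a b, IntervalIntegrable (fun y => (g (y + ε) - g y) ^ 2) volume a b :=
    fun ε a b => Continuous.intervalIntegrable (by fun_prop) _ _
  -- the path is constant before `0`, so that the increment at `y < 0` vanishes unless `-ε < y`
  have hneg : ∀ ε > 0, ∀ x ≤ 0, |ε⁻¹ * ∫ y in x..0, (g (y + ε) - g y) ^ 2| ≤ w ε ^ 2 := by
    intro ε hε x hx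
    have := abs_integral_le_of_vanish (D := fun y => (g (y + ε) - g y) ^ 2) (a := x) (s := 0)
      (ε := ε) (M := w ε ^ 2) hx hε.le (sq_nonneg _)
      (fun r hr => by rw [hg.left r (by linarith), hg.left (r + ε) (by linarith)]; simp)
      (fun r => by
        rw [abs_of_nonneg (sq_nonneg _)]
        refine sq_le_sq.2 ((hwm ε hε _ _ ?_).trans (le_abs_self _))
        rw [add_sub_cancel_left, abs_of_pos hε]; linarith)
      (by fun_prop)
    rw [abs_mul, abs_of_pos (inv_pos.2 hε), inv_mul_le_iff₀ hε, mul_comm]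
    exact this
  have hsplit : ∀ ε τ x, ε⁻¹ * ∫ s in (0 : ℝ)..τ, (g (s + ε + x) - g (s + x)) ^ 2 =
      (ε⁻¹ * ∫ y in x..0, (g (y + ε) - g y) ^ 2) +
        ε⁻¹ * ∫ y in (0 : ℝ)..(τ + x), (g (y + ε) - g y) ^ 2 := by
    intro ε τ x
    rw [← mul_add, intervalIntegral.integral_add_adjacent_intervals (hi _ _ _) (hi _ _ _)]
    have := intervalIntegral.integral_comp_add_right (a := 0) (b := τ)
      (fun y => (g (y + ε) - g y) ^ 2) x
    rw [zero_add] at this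
    rw [← this]
    simp only [add_right_comm]
  have hsym : ∀ ε r : ℝ, ε⁻¹ * ∫ y in (0 : ℝ)..r, (g (y + ε) - g y) ^ 2 =
      -(ε⁻¹ * ∫ y in r..0, (g (y + ε) - g y) ^ 2) := fun ε r => by
    rw [intervalIntegral.integral_symm, mul_neg]
  have hw2 : Tendsto (fun ε => w ε ^ 2) (𝓝[>] 0) (𝓝 0) := by simpa using hw.pow 2
  refine ⟨(2 * B) ^ 2 + ((2 * B) ^ 2 + C ^ 2), ?_, fun τ hτ x hx => ?_⟩
  · filter_upwards [Ioc_mem_nhdsGT hε₀] with ε hε τ hτ x hx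
    have hwε : w ε ^ 2 ≤ (2 * B) ^ 2 := pow_le_pow_left₀ (hw0 ε) (hwB ε) 2
    rw [hsplit]
    refine (abs_add_le _ _).trans (add_le_add ((hneg ε hε.1 x hx.2).trans hwε) ?_)
    rcases le_total (τ + x) 0 with h | h
    · rw [hsym, abs_neg]
      exact ((hneg ε hε.1 _ h).trans hwε).trans (le_add_of_nonneg_right (sq_nonneg _))
    · rw [abs_of_nonneg (mul_nonneg (inv_nonneg.2 hε.1.le)
        (intervalIntegral.integral_nonneg h fun _ _ => sq_nonneg _)), inv_mul_le_iff₀ hε.1]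
      refine ((hbd ε hε.1 hε.2).1 (τ + x) ⟨h, by linarith [hτ.2, hx.2]⟩).trans ?_
      rw [mul_comm]
      exact mul_le_mul_of_nonneg_left (le_add_of_nonneg_left (sq_nonneg _)) hε.1.le
  · simp only [hsplit]
    have h0 : ∀ y ≤ 0, Tendsto (fun ε : ℝ => ε⁻¹ * ∫ y in y..0, (g (y + ε) - g y) ^ 2) (𝓝[>] 0)
        (𝓝 0) := fun y hy => by
      refine squeeze_zero_norm' ?_ hw2
      filter_upwards [self_mem_nhdsWithin] with ε hε using hneg ε hε y hy
    have h1 : Tendsto (fun ε : ℝ => ε⁻¹ * ∫ y in (0 : ℝ)..(τ + x), (g (y + ε) - g y) ^ 2) (𝓝[>] 0)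
        (𝓝 (σ ^ 2 * max (τ + x) 0)) := by
      rcases le_total (τ + x) 0 with h | h
      · rw [max_eq_right h, mul_zero]
        simp only [hsym]
        simpa using (h0 _ h).neg
      · rw [max_eq_left h]
        refine (hg.qv (τ + x) ⟨h, by linarith [hτ.2, hx.2]⟩).congr fun ε => ?_
        rw [intervalIntegral.integral_div, div_eq_inv_mul]
    simpa using (h0 x hx.2).add h1

lemma form_linfty (γ : Lp ℝ ∞ (leb T)) (f : PathSpace T) :
    Chi0.form ((0, 0, 0, 0, γ) : Chi0 T) f f = ∫ x, γ x * (f x * f x) ∂leb T := by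
  rw [form_eq]; simp

lemma continuous_increment (ε : ℝ) :
    Continuous fun s => windowOf T g (s + ε) - windowOf T g s := by
  have := continuous_windowOf (T := T) g
  fun_prop

lemma continuous_form_increment (c : Chi0 T) (ε : ℝ) : Continuous fun s =>
    c.form (windowOf T g (s + ε) - windowOf T g s) (windowOf T g (s + ε) - windowOf T g s) := by
  rw [← continuousOn_univ]
  exact ContinuousOn.form_self continuousOn_const (continuous_increment ε).continuousOn

/-- The diagonal part: by Fubini's theorem it is a mean of quadratic variations of translates of the
path. -/
lemma HasQV.tendsto_integral_linfty (hg : HasQV T σ g) (γ : Lp ℝ ∞ (leb T)) {τ : ℝ}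
    (hτ : τ ∈ Icc 0 T) {ε : ℕ → ℝ} (hε : Tendsto ε atTop (𝓝[>] 0)) :
    Tendsto (fun n => (ε n)⁻¹ * ∫ s in (0 : ℝ)..τ, Chi0.form ((0, 0, 0, 0, γ) : Chi0 T)
        (windowOf T g (s + ε n) - windowOf T g s) (windowOf T g (s + ε n) - windowOf T g s))
      atTop (𝓝 (∫ s in (0 : ℝ)..τ, σ ^ 2 * ∫ x, γ x * step s x ∂leb T)) := by
  have hgc := g.continuous
  obtain ⟨B, -, hB, hgB, -⟩ := hg.exists_modulus
  obtain ⟨M, hM, hlim⟩ := hg.integral_sq_shift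
  have e1 : ∫ s in (0 : ℝ)..τ, σ ^ 2 * ∫ x, γ x * step s x ∂leb T =
      ∫ x, γ x * (σ ^ 2 * max (τ + x) 0) ∂leb T := by
    rw [intervalIntegral.integral_const_mul, integral_linfty_swap γ measurable_uncurry_step
      abs_step_le, ← integral_const_mul]
    congr 1
    ext x
    rw [integral_step hτ.1]
    ring
  have e2 : ∀ n, (ε n)⁻¹ * ∫ s in (0 : ℝ)..τ, Chi0.form ((0, 0, 0, 0, γ) : Chi0 T)
        (windowOf T g (s + ε n) - windowOf T g s) (windowOf T g (s + ε n) - windowOf T g s) =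
      ∫ x : Icc (-T) (0 : ℝ), γ x *
        ((ε n)⁻¹ * ∫ s in (0 : ℝ)..τ, (g (s + ε n + x) - g (s + x)) ^ 2) ∂leb T := by
    intro n
    simp only [form_linfty]
    rw [integral_linfty_swap γ (h := fun s x => (windowOf T g (s + ε n) - windowOf T g s) x *
      (windowOf T g (s + ε n) - windowOf T g s) x) (M := (B + B) * (B + B)), ← integral_const_mul]
    · congr 1
      ext x
      simp only [ContinuousMap.sub_apply, windowOf_apply, sq]
      ring
    · have : Continuous fun p : ℝ × Icc (-T) (0 : ℝ) =>
          (g (p.1 + ε n + p.2) - g (p.1 + p.2)) * (g (p.1 + ε n + p.2) - g (p.1 + p.2)) := by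
        fun_prop
      exact this.measurable
    · intro s x
      have : |(windowOf T g (s + ε n) - windowOf T g s) x| ≤ B + B :=
        (abs_sub _ _).trans (add_le_add (hgB _) (hgB _))
      rw [abs_mul]
      exact mul_le_mul this this (abs_nonneg _) (by positivity)
  rw [e1]
  simp only [e2]
  have hcont : ∀ n, Continuous fun x : Icc (-T) (0 : ℝ) =>
      (ε n)⁻¹ * ∫ s in (0 : ℝ)..τ, (g (s + ε n + x) - g (s + x)) ^ 2 := fun n =>
    continuous_const.mul (intervalIntegral.continuous_parametric_intervalIntegral_of_continuous'
      (f := fun (x : Icc (-T) (0 : ℝ)) s => (g (s + ε n + x) - g (s + x)) ^ 2)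
      (show Continuous fun z : Icc (-T) (0 : ℝ) × ℝ =>
        (g (z.2 + ε n + z.1) - g (z.2 + z.1)) ^ 2 by fun_prop) _ _)
  refine tendsto_integral_filter_of_dominated_convergence (fun _ => ‖γ‖ * M)
    (.of_forall fun n => (Lp.aestronglyMeasurable γ).mul (hcont n).aestronglyMeasurable) ?_
    (integrable_const _) (.of_forall fun x => ?_)
  · filter_upwards [hε.eventually hM] with n hn
    filter_upwards [ae_abs_le_norm γ] with x hx
    rw [norm_mul]
    exact mul_le_mul hx (hn τ hτ x x.2) (norm_nonneg _) (norm_nonneg _)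
  · exact ((hlim τ hτ x x.2).comp hε).const_mul _

/-- The second order term for a constant element of `χ₀`. -/
lemma HasQV.tendsto_integral_form_const (hg : HasQV T σ g) (c : Chi0 T) {τ : ℝ}
    (hτ : τ ∈ Icc 0 T) {ε : ℕ → ℝ} (hε : Tendsto ε atTop (𝓝[>] 0)) :
    Tendsto (fun n => (ε n)⁻¹ * ∫ s in (0 : ℝ)..τ, c.form
        (windowOf T g (s + ε n) - windowOf T g s) (windowOf T g (s + ε n) - windowOf T g s))
      atTop (𝓝 (∫ s in (0 : ℝ)..τ, σ ^ 2 * c.pair (diagIndicator T s))) := by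
  have hgc := g.continuous
  obtain ⟨C, hC, ε₀, hε₀, hbd⟩ := hg.exists_bounds
  set γ := c.2.2.2.2 with hγ
  set Δ : ℕ → ℝ → PathSpace T := fun n s => windowOf T g (s + ε n) - windowOf T g s with hΔ
  have hΔ0 : ∀ n s, Δ n s zeroPt = g (s + ε n) - g s := fun n s => by
    simp only [hΔ, ContinuousMap.sub_apply, windowOf_apply, coe_zeroPt, add_zero]
  -- the three components that do not contribute
  set r : ℕ → ℝ → ℝ := fun n s => c.form (Δ n s) (Δ n s) - c.1 * (g (s + ε n) - g s) ^ 2 -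
    Chi0.form ((0, 0, 0, 0, γ) : Chi0 T) (Δ n s) (Δ n s) with hr
  have hi1 : ∀ n, IntervalIntegrable (fun s => c.form (Δ n s) (Δ n s)) volume 0 τ := fun n =>
    (continuous_form_increment c (ε n)).intervalIntegrable _ _
  have hi2 : ∀ n, IntervalIntegrable (fun s => c.1 * (g (s + ε n) - g s) ^ 2) volume 0 τ :=
    fun n => Continuous.intervalIntegrable (by fun_prop) _ _
  have hi2' : ∀ n, IntervalIntegrable (fun s => (g (s + ε n) - g s) ^ 2) volume 0 τ :=
    fun n => Continuous.intervalIntegrable (by fun_prop) _ _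
  have hi3 : ∀ n, IntervalIntegrable (fun s => Chi0.form ((0, 0, 0, 0, γ) : Chi0 T)
      (Δ n s) (Δ n s)) volume 0 τ := fun n =>
    (continuous_form_increment _ (ε n)).intervalIntegrable _ _
  have hrlim : Tendsto (fun n => (ε n)⁻¹ * ∫ s in (0 : ℝ)..τ, r n s) atTop (𝓝 0) := by
    rw [Metric.tendsto_nhds]
    intro δ hδ
    have hκ : 0 < δ / (C ^ 2 + 3 * τ + 1) := by have := hτ.1; positivity
    set κ := δ / (C ^ 2 + 3 * τ + 1) / 2 with hκd
    have hκ2 : 0 < κ := half_pos hκ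
    filter_upwards [hε.eventually (hg.inner_increment_le c.2.1 hκ2),
      hε.eventually (hg.inner_increment_le c.2.2.1 hκ2),
      hε.eventually (hg.inner_tensor_increment_le c.2.2.2.1 hκ2),
      hε.eventually (Ioc_mem_nhdsGT hε₀)] with n h1 h2 h3 hn
    have hεn : 0 < ε n := hn.1
    have hpt : ∀ s ∈ Ioc 0 τ, ‖r n s‖ ≤ κ * ((g (s + ε n) - g s) ^ 2 + 3 * ε n) := by
      intro s hs
      have hsT : s ∈ Icc 0 T := ⟨hs.1.le, hs.2.trans hτ.2⟩
      have e : r n s = inner ℝ (toL2 (Δ n s)) c.2.1 * (g (s + ε n) - g s) +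
          (g (s + ε n) - g s) * inner ℝ (toL2 (Δ n s)) c.2.2.1 +
          inner ℝ (tensorL2 (Δ n s) (Δ n s)) c.2.2.2.1 := by
        simp only [hr]
        rw [form_linfty, form_eq, hΔ0]
        ring
      have k1 := h1 s hsT
      have k2 := h2 s hsT
      have k3 := h3 s hsT
      set d := g (s + ε n) - g s
      have hs0 := Real.sqrt_nonneg (ε n)
      have hs2 := Real.sq_sqrt hεn.le
      rw [e, Real.norm_eq_abs]
      refine (abs_add_le _ _).trans (le_trans (add_le_add ((abs_add_le _ _).trans
        (add_le_add (le_of_eq (abs_mul _ _)) (le_of_eq (abs_mul _ _)))) k3) ?_)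
      have k4 := mul_le_mul_of_nonneg_right k1 (abs_nonneg d)
      have k5 := mul_le_mul_of_nonneg_left k2 (abs_nonneg d)
      have k6 : 2 * (√(ε n) * |d|) ≤ d ^ 2 + ε n := by
        nlinarith [sq_nonneg (√(ε n) - |d|), sq_abs d]
      have k7 := mul_le_mul_of_nonneg_left k6 hκ2.le
      nlinarith
    have hb := intervalIntegral.norm_integral_le_of_norm_le (μ := volume) hτ.1
      (.of_forall hpt) (((hi2' n).add intervalIntegrable_const).const_mul κ)
    rw [intervalIntegral.integral_const_mul, intervalIntegral.integral_add (hi2' n)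
      intervalIntegrable_const, intervalIntegral.integral_const, smul_eq_mul, sub_zero,
      Real.norm_eq_abs] at hb
    have hb2 := (hbd (ε n) hεn hn.2).1 τ hτ
    rw [Real.dist_eq, sub_zero, abs_mul, abs_of_pos (inv_pos.2 hεn), inv_mul_lt_iff₀ hεn]
    refine hb.trans_lt ?_
    have hτ0 := hτ.1
    have e3 : κ * (C ^ 2 + 3 * τ + 1) = δ / 2 := by rw [hκd]; field_simp
    calc κ * ((∫ s in (0 : ℝ)..τ, (g (s + ε n) - g s) ^ 2) + τ * (3 * ε n))
        ≤ κ * (C ^ 2 * ε n + τ * (3 * ε n)) := by gcongr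
      _ = ε n * (κ * (C ^ 2 + 3 * τ + 1) - κ) := by ring
      _ < ε n * δ := mul_lt_mul_of_pos_left (by rw [e3]; linarith) hεn
  have hlam : Tendsto (fun n => (ε n)⁻¹ * ∫ s in (0 : ℝ)..τ, c.1 * (g (s + ε n) - g s) ^ 2) atTop
      (𝓝 (∫ _s in (0 : ℝ)..τ, σ ^ 2 * c.1)) := by
    have h := ((hg.qv τ hτ).comp hε).const_mul c.1
    have e : ∫ _s in (0 : ℝ)..τ, σ ^ 2 * c.1 = c.1 * (σ ^ 2 * τ) := by
      rw [intervalIntegral.integral_const, smul_eq_mul, sub_zero]; ring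
    rw [e]
    refine h.congr fun n => ?_
    simp only [Function.comp_apply, intervalIntegral.integral_div,
      intervalIntegral.integral_const_mul]
    ring
  have hall := (hlam.add (hg.tendsto_integral_linfty γ hτ hε)).add hrlim
  have hstep : IntervalIntegrable (fun s => σ ^ 2 * ∫ x, γ x * step s x ∂leb T) volume 0 τ := by
    have h := ContinuousOn.pair_diagIndicator (t := τ)
      (c := fun _ => ((0, 0, 0, 0, γ) : Chi0 T)) continuousOn_const
    refine ContinuousOn.intervalIntegrable ?_
    rw [uIcc_of_le hτ.1]
    refine continuousOn_const.mul (h.congr fun s hs => ?_)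
    change _ = Chi0.pair _ _
    rw [WindowCalculus.pair_diagIndicator _ hs.1, zero_add]
  have e4 : ∫ s in (0 : ℝ)..τ, σ ^ 2 * c.pair (diagIndicator T s) =
      (∫ _s in (0 : ℝ)..τ, σ ^ 2 * c.1) +
        ∫ s in (0 : ℝ)..τ, σ ^ 2 * ∫ x, γ x * step s x ∂leb T := by
    rw [← intervalIntegral.integral_add intervalIntegrable_const hstep]
    refine intervalIntegral.integral_congr fun s hs => ?_
    rw [uIcc_of_le hτ.1] at hs
    simp only [_root_.WindowCalculus.pair_diagIndicator _ hs.1, ← mul_add, hγ]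
  rw [e4, ← add_zero (_ + _)]
  refine hall.congr fun n => ?_
  rw [← mul_add, ← mul_add, ← intervalIntegral.integral_add (hi2 n) (hi3 n),
    ← intervalIntegral.integral_add ((hi2 n).add (hi3 n)) (((hi1 n).sub (hi2 n)).sub (hi3 n))]
  congr 1
  refine intervalIntegral.integral_congr fun s _ => ?_
  change c.1 * (g (s + ε n) - g s) ^ 2 + Chi0.form ((0, 0, 0, 0, γ) : Chi0 T) (Δ n s) (Δ n s) +
    (c.form (Δ n s) (Δ n s) - c.1 * (g (s + ε n) - g s) ^ 2 -
      Chi0.form ((0, 0, 0, 0, γ) : Chi0 T) (Δ n s) (Δ n s)) = c.form (Δ n s) (Δ n s)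
  ring

end SecondOrder

section SecondOrderLimit

/-- Convergence of integrals `∫ d n s c` for constant `c` passes to continuous `c`, by a
partition of the interval, if `d n s` is Lipschitz with integrable constant. -/
lemma tendsto_integral_of_const {X : Type*} [NormedAddCommGroup X] {t : ℝ} (ht : 0 ≤ t)
    {d : ℕ → ℝ → X → ℝ} {ρ : ℕ → ℝ → ℝ} {C : ℝ}
    (hd : ∀ n, ∀ s ∈ Icc 0 t, ∀ c c', |d n s c - d n s c'| ≤ ‖c - c'‖ * ρ n s)
    (hρi : ∀ n a b, IntervalIntegrable (ρ n) volume a b) (hρ0 : ∀ n s, 0 ≤ ρ n s)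
    (hρ : ∀ᶠ n in atTop, ∫ s in (0 : ℝ)..t, ρ n s ≤ C)
    (hi : ∀ n, ∀ c : ℝ → X, ContinuousOn c (Icc 0 t) →
      IntervalIntegrable (fun s => d n s (c s)) volume 0 t)
    (hlim : ∀ c, ∀ τ ∈ Icc 0 t, Tendsto (fun n => ∫ s in (0 : ℝ)..τ, d n s c) atTop (𝓝 0))
    {c : ℝ → X} (hc : ContinuousOn c (Icc 0 t)) :
    Tendsto (fun n => ∫ s in (0 : ℝ)..t, d n s (c s)) atTop (𝓝 0) := by
  rw [Metric.tendsto_nhds]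
  intro κ hκ
  set κ' := κ / 2 / (|C| + 1) with hκ'
  have hκ'0 : 0 < κ' := by positivity
  obtain ⟨δ, hδ, hunif⟩ := Metric.uniformContinuousOn_iff.1
    (isCompact_Icc.uniformContinuousOn_of_continuous hc) κ' hκ'0
  obtain ⟨m, hm⟩ := exists_nat_gt (t / δ)
  have hm0 : (0 : ℝ) < m := (div_nonneg ht hδ.le).trans_lt hm
  -- the points of the partition
  set a : ℕ → ℝ := fun i => i * (t / m) with ha
  have ha0 : a 0 = 0 := by simp [ha]
  have ham : a m = t := by simp only [ha]; field_simp
  have hstep : ∀ i, a (i + 1) - a i = t / m := fun i => by simp only [ha]; push_cast; ring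
  have hstep0 : 0 ≤ t / m := div_nonneg ht hm0.le
  have hstepδ : t / m < δ := by rwa [div_lt_comm₀ hm0 hδ]
  have hmono : Monotone a := monotone_nat_of_le_succ fun i => by linarith [hstep i]
  have haI : ∀ i ≤ m, a i ∈ Icc 0 t := fun i hi' =>
    ⟨ha0 ▸ hmono (Nat.zero_le i), ham ▸ hmono hi'⟩
  have hsub : ∀ i < m, Icc (a i) (a (i + 1)) ⊆ Icc 0 t := fun i hi' =>
    Icc_subset_Icc (haI i hi'.le).1 (haI (i + 1) hi').2
  have hres : ∀ (f : ℝ → ℝ), IntervalIntegrable f volume 0 t → ∀ i < m,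
      IntervalIntegrable f volume (a i) (a (i + 1)) := fun f hf i hi' =>
    hf.mono_set (by rw [uIcc_of_le ht, uIcc_of_le (hmono i.le_succ)]; exact hsub i hi')
  have hE : Tendsto (fun n => ∑ i ∈ Finset.range m, ∫ s in (a i)..(a (i + 1)), d n s (c (a i)))
      atTop (𝓝 0) := by
    rw [← Finset.sum_const_zero (s := Finset.range m) (ι := ℕ)]
    refine tendsto_finsetSum _ fun i hi' => ?_
    have hi' := Finset.mem_range.1 hi'
    have h := (hlim (c (a i)) _ (haI (i + 1) hi')).sub (hlim (c (a i)) _ (haI i hi'.le))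
    rw [sub_zero] at h
    refine h.congr fun n => ?_
    have hI := hi n (fun _ => c (a i)) continuousOn_const
    refine intervalIntegral.integral_interval_sub_left ?_ ?_ <;>
      refine hI.mono_set ?_ <;> rw [uIcc_of_le ht, uIcc_of_le (haI _ (by omega)).1] <;>
      exact Icc_subset_Icc_right (haI _ (by omega)).2
  filter_upwards [hρ, Metric.tendsto_nhds.1 hE (κ / 2) (half_pos hκ)] with n hn hEn
  have hsum : ∀ f : ℝ → ℝ, IntervalIntegrable f volume 0 t →
      ∫ s in (0 : ℝ)..t, f s = ∑ i ∈ Finset.range m, ∫ s in (a i)..(a (i + 1)), f s :=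
      fun f hf => by
    rw [intervalIntegral.sum_integral_adjacent_intervals fun i hi' => hres f hf i hi', ha0, ham]
  have hI := hi n c hc
  have hdiff : |(∫ s in (0 : ℝ)..t, d n s (c s)) -
      ∑ i ∈ Finset.range m, ∫ s in (a i)..(a (i + 1)), d n s (c (a i))| ≤
      κ' * ∫ s in (0 : ℝ)..t, ρ n s := by
    rw [hsum _ hI, hsum _ (hρi n 0 t), ← Finset.sum_sub_distrib, Finset.mul_sum]
    refine (Finset.abs_sum_le_sum_abs _ _).trans (Finset.sum_le_sum fun i hi' => ?_)
    have hi' := Finset.mem_range.1 hi'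
    rw [← intervalIntegral.integral_sub (hres _ hI i hi')
      (hres _ (hi n (fun _ => c (a i)) continuousOn_const) i hi'),
      ← intervalIntegral.integral_const_mul, ← Real.norm_eq_abs]
    refine intervalIntegral.norm_integral_le_of_norm_le (hmono i.le_succ)
      (.of_forall fun s hs => ?_) ((hρi n _ _).const_mul κ')
    have hsI := hsub i hi' ⟨hs.1.le, hs.2⟩
    refine (hd n s hsI _ _).trans (mul_le_mul_of_nonneg_right ?_ (hρ0 n s))
    rw [← dist_eq_norm]
    refine (hunif s hsI _ (haI i hi'.le) ?_).le
    rw [Real.dist_eq, abs_of_pos (sub_pos.2 hs.1)]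
    linarith [hs.2, hstep i]
  rw [Real.dist_eq, sub_zero] at hEn ⊢
  have h1 : κ' * ∫ s in (0 : ℝ)..t, ρ n s ≤ κ / 2 := by
    calc κ' * ∫ s in (0 : ℝ)..t, ρ n s ≤ κ' * (|C| + 1) :=
          mul_le_mul_of_nonneg_left (by linarith [le_abs_self C]) hκ'0.le
      _ = κ / 2 := by rw [hκ']; field_simp
  have := abs_sub_abs_le_abs_sub (∫ s in (0 : ℝ)..t, d n s (c s))
    (∑ i ∈ Finset.range m, ∫ s in (a i)..(a (i + 1)), d n s (c (a i)))
  linarith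

variable {T : ℝ} [hT : Fact (0 < T)] {g : C(ℝ, ℝ)} {σ : ℝ}

lemma continuous_hilbertNorm_increment_sq (ε : ℝ) :
    Continuous fun s => hilbertNorm (windowOf T g (s + ε) - windowOf T g s) ^ 2 :=
  (continuous_hilbertNorm.comp (continuous_increment ε)).pow 2

lemma HasQV.exists_hilbertNorm_sq_bound (hg : HasQV T σ g) :
    ∃ C, 0 ≤ C ∧ ∀ᶠ ε : ℝ in 𝓝[>] 0, ∀ t ∈ Icc 0 T,
      ε⁻¹ * ∫ s in (0 : ℝ)..t, hilbertNorm (windowOf T g (s + ε) - windowOf T g s) ^ 2 ≤ C := by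
  have hT' := hT.out
  have hgc := g.continuous
  obtain ⟨C, hC, ε₀, hε₀, hbd⟩ := hg.exists_bounds
  refine ⟨2 * C ^ 2 * (1 + T), by positivity, ?_⟩
  filter_upwards [Ioc_mem_nhdsGT hε₀] with ε hε t ht
  obtain ⟨h1, h2⟩ := hbd ε hε.1 hε.2
  have hi : IntervalIntegrable (fun s => (g (s + ε) - g s) ^ 2) volume 0 t :=
    Continuous.intervalIntegrable (by fun_prop) _ _
  rw [inv_mul_le_iff₀ hε.1]
  calc ∫ s in (0 : ℝ)..t, hilbertNorm (windowOf T g (s + ε) - windowOf T g s) ^ 2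
      ≤ ∫ s in (0 : ℝ)..t, (2 * (g (s + ε) - g s) ^ 2 + 2 * (C ^ 2 * ε)) := by
        refine intervalIntegral.integral_mono_on ht.1
          ((continuous_hilbertNorm_increment_sq ε).intervalIntegrable _ _)
          ((hi.const_mul 2).add intervalIntegrable_const) fun s hs => ?_
        have h3 := (h2 s ⟨hs.1, hs.2.trans ht.2⟩).1
        have h4 : ‖toL2 (windowOf T g (s + ε) - windowOf T g s)‖ ^ 2 ≤ C ^ 2 * ε := by
          calc _ ≤ (C * √ε) ^ 2 := pow_le_pow_left₀ (norm_nonneg _) h3 2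
            _ = C ^ 2 * ε := by rw [mul_pow, Real.sq_sqrt hε.1.le]
        have h5 : (windowOf T g (s + ε) - windowOf T g s) zeroPt = g (s + ε) - g s := by
          simp only [ContinuousMap.sub_apply, windowOf_apply, coe_zeroPt, add_zero]
        unfold hilbertNorm
        rw [h5]
        nlinarith [sq_nonneg (|g (s + ε) - g s| - ‖toL2 (windowOf T g (s + ε) - windowOf T g s)‖),
          sq_abs (g (s + ε) - g s)]
    _ = 2 * (∫ s in (0 : ℝ)..t, (g (s + ε) - g s) ^ 2) + t * (2 * (C ^ 2 * ε)) := by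
        rw [intervalIntegral.integral_add (hi.const_mul 2) intervalIntegrable_const,
          intervalIntegral.integral_const_mul, intervalIntegral.integral_const, smul_eq_mul,
          sub_zero]
    _ ≤ 2 * (C ^ 2 * ε) + T * (2 * (C ^ 2 * ε)) := by
        have := h1 t ht
        have := hε.1
        gcongr
        exact ht.2
    _ = ε * (2 * C ^ 2 * (1 + T)) := by ring

/-- The second order term: for a continuous curve in `χ₀`, only the atom at the origin and the
diagonal part are seen by the quadratic variation of the window. -/
lemma HasQV.tendsto_integral_form (hg : HasQV T σ g) {t : ℝ} (ht : t ∈ Icc 0 T) {c : ℝ → Chi0 T}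
    (hc : ContinuousOn c (Icc 0 t)) {ε : ℕ → ℝ} (hε : ∀ n, 0 < ε n)
    (hε0 : Tendsto ε atTop (𝓝 0)) :
    Tendsto (fun n => (ε n)⁻¹ * ∫ s in (0 : ℝ)..t, (c s).form
        (windowOf T g (s + ε n) - windowOf T g s) (windowOf T g (s + ε n) - windowOf T g s))
      atTop (𝓝 (∫ s in (0 : ℝ)..t, σ ^ 2 * (c s).pair (diagIndicator T s))) := by
  have hT' := hT.out
  have hεr : Tendsto ε atTop (𝓝[>] 0) :=
    tendsto_nhdsWithin_iff.2 ⟨hε0, .of_forall hε⟩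
  obtain ⟨C, hC, hbd⟩ := hg.exists_hilbertNorm_sq_bound
  have hi1 : ∀ n, ∀ c : ℝ → Chi0 T, ∀ τ ∈ Icc 0 t, ContinuousOn c (Icc 0 τ) →
      IntervalIntegrable (fun s => (c s).form (windowOf T g (s + ε n) - windowOf T g s)
        (windowOf T g (s + ε n) - windowOf T g s)) volume 0 τ := fun n c τ hτ hc => by
    refine ContinuousOn.intervalIntegrable ?_
    rw [uIcc_of_le hτ.1]
    exact ContinuousOn.form_self hc (continuous_increment (ε n)).continuousOn
  have hi2 : ∀ c : ℝ → Chi0 T, ∀ τ ∈ Icc 0 t, ContinuousOn c (Icc 0 τ) →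
      IntervalIntegrable (fun s => σ ^ 2 * (c s).pair (diagIndicator T s)) volume 0 τ :=
    fun c τ hτ hc => by
      refine ContinuousOn.intervalIntegrable ?_
      rw [uIcc_of_le hτ.1]
      exact continuousOn_const.mul (ContinuousOn.pair_diagIndicator hc)
  have key := tendsto_integral_of_const (X := Chi0 T) ht.1
    (d := fun n s c => (ε n)⁻¹ * c.form (windowOf T g (s + ε n) - windowOf T g s)
      (windowOf T g (s + ε n) - windowOf T g s) - σ ^ 2 * c.pair (diagIndicator T s))
    (ρ := fun n s => 2 * ((ε n)⁻¹ * hilbertNorm (windowOf T g (s + ε n) - windowOf T g s) ^ 2) +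
      σ ^ 2 * (1 + T)) (C := 2 * C + t * (σ ^ 2 * (1 + T)))
    (fun n s hs c c' => ?_) (fun n a b => ?_) (fun n s => ?_) ?_ (fun n c hc => ?_)
    (fun c τ hτ => ?_) hc
  · have h := key.add_const (∫ s in (0 : ℝ)..t, σ ^ 2 * (c s).pair (diagIndicator T s))
    rw [zero_add] at h
    refine h.congr fun n => ?_
    have htt : t ∈ Icc 0 t := ⟨ht.1, le_rfl⟩
    rw [intervalIntegral.integral_sub ((hi1 n c t htt hc).const_mul _) (hi2 c t htt hc),
      sub_add_cancel, intervalIntegral.integral_const_mul]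
  · have h1 := abs_form_le (c - c') (windowOf T g (s + ε n) - windowOf T g s)
      (windowOf T g (s + ε n) - windowOf T g s)
    have h2 := abs_pair_diagIndicator_sub_le c' c hs.1 (le_refl s)
    rw [form_sub] at h1
    rw [sub_self, zero_mul, add_zero] at h2
    have e : ∀ x y p q : ℝ, (ε n)⁻¹ * x - σ ^ 2 * p - ((ε n)⁻¹ * y - σ ^ 2 * q) =
        (ε n)⁻¹ * (x - y) - σ ^ 2 * (p - q) := fun x y p q => by ring
    rw [e]
    refine (abs_sub _ _).trans ?_
    rw [abs_mul, abs_mul, abs_of_pos (inv_pos.2 (hε n)), abs_of_nonneg (sq_nonneg σ)]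
    have h3 := mul_le_mul_of_nonneg_left h1 (inv_nonneg.2 (hε n).le)
    have h4 := mul_le_mul_of_nonneg_left h2 (sq_nonneg σ)
    linarith
  · exact (((continuous_hilbertNorm_increment_sq (ε n)).const_mul _).const_mul _ |>.add
      continuous_const).intervalIntegrable _ _
  · have := (inv_pos.2 (hε n)).le
    positivity
  · filter_upwards [hεr.eventually hbd] with n hn
    have hI := ((continuous_hilbertNorm_increment_sq (T := T) (g := g) (ε n)).intervalIntegrable
      (μ := volume) 0 t).const_mul (ε n)⁻¹
    rw [intervalIntegral.integral_add (hI.const_mul 2) intervalIntegrable_const,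
      intervalIntegral.integral_const_mul, intervalIntegral.integral_const_mul,
      intervalIntegral.integral_const, smul_eq_mul, sub_zero]
    have := hn t ht
    linarith
  · have htt : t ∈ Icc 0 t := ⟨ht.1, le_rfl⟩
    exact ((hi1 n c t htt hc).const_mul _).sub (hi2 c t htt hc)
  · have hτT : τ ∈ Icc 0 T := ⟨hτ.1, hτ.2.trans ht.2⟩
    have h := (hg.tendsto_integral_form_const c hτT hεr).sub_const
      (∫ s in (0 : ℝ)..τ, σ ^ 2 * c.pair (diagIndicator T s))
    rw [sub_self] at h
    refine h.congr fun n => ?_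
    rw [intervalIntegral.integral_sub
      ((hi1 n (fun _ => c) τ hτ continuousOn_const).const_mul _)
      (hi2 (fun _ => c) τ hτ continuousOn_const),
      intervalIntegral.integral_const_mul (ε n)⁻¹]

end SecondOrderLimit

/-! ### The Itô formula along a single path -/

section Ito

/-- The averages of the increments of a continuous function over shrinking shifts. -/
lemma tendsto_integral_increment {v : ℝ → ℝ} {T t : ℝ} (hv : ContinuousOn v (Icc 0 T))
    (ht : t ∈ Ico 0 T) {ε : ℕ → ℝ} (hε : ∀ n, 0 < ε n) (hε0 : Tendsto ε atTop (𝓝 0)) :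
    Tendsto (fun n => (ε n)⁻¹ * ∫ s in (0 : ℝ)..t, (v (s + ε n) - v s)) atTop
      (𝓝 (v t - v 0)) := by
  have hT0 : 0 ≤ T := ht.1.trans ht.2.le
  set w : ℝ → ℝ := IccExtend hT0 ((Icc 0 T).domRestrict v) with hw
  have hwc : Continuous w := hv.domRestrict.Icc_extend'
  have hwv : ∀ s ∈ Icc 0 T, w s = v s := fun s hs => by
    rw [hw, IccExtend_of_mem _ _ hs]; rfl
  have hi : ∀ a b, IntervalIntegrable w volume a b := fun a b => hwc.intervalIntegrable a b
  have hslope : ∀ r, Tendsto (fun n => (ε n)⁻¹ * ∫ s in r..(r + ε n), w s) atTop (𝓝 (w r)) := by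
    intro r
    have hd : HasDerivAt (fun y => ∫ s in (0 : ℝ)..y, w s) (w r) r :=
      intervalIntegral.integral_hasDerivAt_right (hi _ _)
        (hwc.stronglyMeasurableAtFilter _ _) hwc.continuousAt
    have h := (hasDerivAt_iff_tendsto_slope_zero.1 hd).comp (tendsto_nhdsWithin_iff.2
      ⟨hε0, .of_forall fun n => (hε n).ne'⟩)
    refine h.congr fun n => ?_
    simp only [Function.comp_apply, smul_eq_mul]
    rw [intervalIntegral.integral_interval_sub_left (hi _ _) (hi _ _)]
  rw [← hwv t ⟨ht.1, ht.2.le⟩, ← hwv 0 ⟨le_rfl, hT0⟩]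
  refine ((hslope t).sub (by simpa using hslope 0)).congr' ?_
  filter_upwards [hε0.eventually (gt_mem_nhds (sub_pos.2 ht.2))] with n hn
  have e : ∫ s in (0 : ℝ)..t, (v (s + ε n) - v s) = ∫ s in (0 : ℝ)..t, (w (s + ε n) - w s) := by
    refine intervalIntegral.integral_congr fun s hs => ?_
    rw [uIcc_of_le ht.1] at hs
    have := hε n
    change v (s + ε n) - v s = w (s + ε n) - w s
    rw [hwv s ⟨hs.1, hs.2.trans ht.2.le⟩, hwv (s + ε n) ⟨by linarith [hs.1], by linarith [hs.2]⟩]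
  rw [e, intervalIntegral.integral_sub (Continuous.intervalIntegrable (by fun_prop) _ _) (hi _ _),
    intervalIntegral.integral_comp_add_right, zero_add, ← mul_sub]
  congr 1
  have h1 := intervalIntegral.integral_add_adjacent_intervals (hi 0 t) (hi t (t + ε n))
  have h2 := intervalIntegral.integral_add_adjacent_intervals (hi 0 (ε n)) (hi (ε n) (t + ε n))
  linarith

variable {T : ℝ} [hT : Fact (0 < T)] {σ : ℝ} {u : ℝ → PathSpace T → ℝ}
  {S : ℝ → PathSpace T → Chi0 T} {g : C(ℝ, ℝ)} {t : ℝ}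

lemma IsC12.continuousOn_along (hu : IsC12 u) (g : C(ℝ, ℝ)) :
    ContinuousOn (fun s => u s (windowOf T g s)) (Icc 0 T) :=
  hu.continuousOn.comp (f := fun s => (s, windowOf T g s))
    (continuousOn_id.prodMk (continuous_windowOf g).continuousOn) fun _ hs => ⟨hs, mem_univ _⟩

lemma IsC12.continuousOn_timeDeriv_along (hu : IsC12 u) (g : C(ℝ, ℝ)) (ht : t ∈ Ico 0 T) :
    ContinuousOn (fun s => timeDeriv u s (windowOf T g s)) (Icc 0 t) :=
  hu.continuousOn_timeDeriv.comp (f := fun s => (s, windowOf T g s))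
    (continuousOn_id.prodMk (continuous_windowOf g).continuousOn)
    fun _ hs => ⟨⟨hs.1, hs.2.trans_lt ht.2⟩, mem_univ _⟩

lemma IsC12.continuousOn_gradDelta_along (hu : IsC12 u) (g : C(ℝ, ℝ)) (ht : t ∈ Ico 0 T) :
    ContinuousOn (fun s => gradDelta u s (windowOf T g s)) (Icc 0 t) :=
  continuous_deltaPart.comp_continuousOn
    (continuousOn_fderiv_along hu ht (continuous_windowOf (T := T) g).continuousOn)

/-- The remainder of the joint expansion of `u` in time and space along the window of a path. -/
noncomputable def itoRemainder (u : ℝ → PathSpace T → ℝ) (S : ℝ → PathSpace T → Chi0 T)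
    (g : C(ℝ, ℝ)) (ε s : ℝ) : ℝ :=
  u (s + ε) (windowOf T g (s + ε)) - u s (windowOf T g s) -
    ε * timeDeriv u s (windowOf T g s) -
    fderiv ℝ (u s) (windowOf T g s) (windowOf T g (s + ε) - windowOf T g s) -
    (S s (windowOf T g s)).form (windowOf T g (s + ε) - windowOf T g s)
      (windowOf T g (s + ε) - windowOf T g s) / 2

/-- The remainder is uniformly `o(ε + hilbertNorm Δ ^ 2)`, where `Δ` is the increment of the window,
and the integral of `hilbertNorm Δ ^ 2` is of order `ε`. -/
lemma HasQV.tendsto_integral_itoRemainder (hu : IsC12 u)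
    (hS : ∀ t ∈ Ico 0 T, ∀ η ∈ qvSpace T (fun t => σ ^ 2 * t) t, ∀ f g : PathSpace T,
      fderiv ℝ (fderiv ℝ (u t)) η f g = (S t η).form f g)
    (hSc : ContinuousOn (fun p : ℝ × PathSpace T => S p.1 p.2)
      {p | p.1 ∈ Ico 0 T ∧ p.2 ∈ qvSpace T (fun t => σ ^ 2 * t) p.1})
    (hg : HasQV T σ g) (ht : t ∈ Ico 0 T)
    {ε : ℕ → ℝ} (hε : ∀ n, 0 < ε n) (hε0 : Tendsto ε atTop (𝓝 0)) :
    Tendsto (fun n => (ε n)⁻¹ * ∫ s in (0 : ℝ)..t, itoRemainder u S g (ε n) s) atTop (𝓝 0) := by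
  have hεr : Tendsto ε atTop (𝓝[>] 0) :=
    tendsto_nhdsWithin_iff.2 ⟨hε0, .of_forall hε⟩
  obtain ⟨C, hC, hbd⟩ := hg.exists_hilbertNorm_sq_bound
  obtain ⟨B, w, hB, hgB, hw, hw0, -, hwm⟩ := hg.exists_modulus
  rw [Metric.tendsto_nhds]
  intro κ hκ
  have ht0 := ht.1
  set κ' := κ / 2 / (t + C + 1) with hκ'
  have hκ'0 : 0 < κ' := by positivity
  obtain ⟨ρ₁, hρ₁, h1⟩ := exists_time_increment_near (g := g) hu ht hκ'0
  obtain ⟨ρ₂, hρ₂, h2⟩ := exists_taylor_second hu hS hSc hg ht hκ'0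
  filter_upwards [hε0.eventually (gt_mem_nhds (sub_pos.2 ht.2)), hε0.eventually (gt_mem_nhds hρ₁),
    (hw.comp hεr).eventually (gt_mem_nhds hρ₁), (hw.comp hεr).eventually (gt_mem_nhds hρ₂),
    hεr.eventually hbd] with n hn hn1 hw1 hw2 hnb
  have hεn := hε n
  have hΔ : ∀ s, ‖windowOf T g (s + ε n) - windowOf T g s‖ ≤ w (ε n) := fun s => by
    refine (ContinuousMap.norm_le _ (hw0 _)).2 fun x => ?_
    refine hwm _ hεn _ _ ?_
    rw [show s + ε n + (x : ℝ) - (s + x) = ε n by ring, abs_of_pos hεn]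
    linarith
  have hpt : ∀ s ∈ Ioc 0 t, ‖itoRemainder u S g (ε n) s‖ ≤
      κ' * (ε n + hilbertNorm (windowOf T g (s + ε n) - windowOf T g s) ^ 2) := by
    intro s hs
    have k1 := h1 s ⟨hs.1.le, hs.2⟩ (ε n) ⟨hεn, hn1⟩ (windowOf T g (s + ε n))
      (by linarith [hs.2]) ((hΔ s).trans_lt hw1)
    have k2 := h2 s ⟨hs.1.le, hs.2⟩ _ ((hΔ s).trans_lt hw2)
    rw [add_sub_cancel] at k2
    rw [mul_add, Real.norm_eq_abs]
    refine le_trans (le_of_eq ?_) ((abs_add_le _ _).trans (add_le_add k1 k2))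
    unfold itoRemainder
    congr 1
    ring
  have hNi := (continuous_hilbertNorm_increment_sq (T := T) (g := g) (ε n)).intervalIntegrable
      (μ := volume) 0 t
  have hb := intervalIntegral.norm_integral_le_of_norm_le (μ := volume) ht0
    (.of_forall hpt) ((intervalIntegrable_const.add hNi).const_mul κ')
  rw [intervalIntegral.integral_const_mul, intervalIntegral.integral_add intervalIntegrable_const
    hNi, intervalIntegral.integral_const, smul_eq_mul, sub_zero, Real.norm_eq_abs] at hb
  have hb2 := hnb t ⟨ht.1, ht.2.le⟩
  rw [inv_mul_le_iff₀ hεn] at hb2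
  rw [Real.dist_eq, sub_zero, abs_mul, abs_of_pos (inv_pos.2 hεn), inv_mul_lt_iff₀ hεn]
  refine hb.trans_lt ?_
  have e3 : κ' * (t + C + 1) = κ / 2 := by rw [hκ']; field_simp
  calc κ' * (t * ε n + ∫ s in (0 : ℝ)..t,
        hilbertNorm (windowOf T g (s + ε n) - windowOf T g s) ^ 2)
      ≤ κ' * (t * ε n + ε n * C) := by gcongr
    _ = ε n * (κ' * (t + C + 1) - κ') := by ring
    _ < ε n * κ := mul_lt_mul_of_pos_left (by rw [e3]; linarith) hεn

/-- The Itô formula along a path with quadratic variation: `D^{δ₀} u` is integrable forward along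
the path, and its forward integral is the increment of `u`. -/
theorem HasQV.tendsto_forwardIntegral (hu : IsC12 u)
    (hS : ∀ t ∈ Ico 0 T, ∀ η ∈ qvSpace T (fun t => σ ^ 2 * t) t, ∀ f g : PathSpace T,
      fderiv ℝ (fderiv ℝ (u t)) η f g = (S t η).form f g)
    (hSc : ContinuousOn (fun p : ℝ × PathSpace T => S p.1 p.2)
      {p | p.1 ∈ Ico 0 T ∧ p.2 ∈ qvSpace T (fun t => σ ^ 2 * t) p.1})
    (hC : ConditionC (fun t => σ ^ 2 * t) u)
    (hpde : ∀ t ∈ Ico 0 T, ∀ η ∈ qvSpace T (fun t => σ ^ 2 * t) t,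
      timeDeriv u t η + horizontalTerm u t η +
        σ ^ 2 / 2 * Chi0.pair (S t η) (diagIndicator T t) = 0)
    (hg : HasQV T σ g) (ht : t ∈ Ico 0 T) :
    Tendsto (fun ε : ℝ => ∫ s in (0 : ℝ)..t,
        gradDelta u s (windowOf T g s) * ((g (s + ε) - g s) / ε)) (𝓝[>] 0)
      (𝓝 (u t (windowOf T g t) - u 0 (windowOf T g 0))) := by
  have htT : t ∈ Icc 0 T := ⟨ht.1, ht.2.le⟩
  have hgc := g.continuous
  have hWc := continuous_windowOf (T := T) g
  have hξ := hu.continuousOn_gradDelta_along g ht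
  have hτ := hu.continuousOn_timeDeriv_along g ht
  have hv := hu.continuousOn_along g
  have hL := continuousOn_fderiv_along hu ht hWc.continuousOn
  have hSη : ContinuousOn (fun s => S s (windowOf T g s)) (Icc 0 t) :=
    hSc.comp (f := fun s => (s, windowOf T g s))
      (continuousOn_id.prodMk hWc.continuousOn) fun s hs =>
        ⟨⟨hs.1, hs.2.trans_lt ht.2⟩, hg.windowOf_mem ⟨hs.1, hs.2.trans ht.2.le⟩⟩
  have hint : ∀ {f : ℝ → ℝ}, ContinuousOn f (Icc 0 t) → IntervalIntegrable f volume 0 t :=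
    fun hf => ContinuousOn.intervalIntegrable (by rwa [uIcc_of_le ht.1])
  have hpair := ContinuousOn.pair_diagIndicator hSη
  have hτi : IntervalIntegrable (fun s => -timeDeriv u s (windowOf T g s)) volume 0 t :=
    (hint hτ).neg
  have hpi : IntervalIntegrable (fun s => σ ^ 2 * (S s (windowOf T g s)).pair (diagIndicator T s))
    volume 0 t := hint (continuousOn_const.mul hpair)
  -- by the equation, the horizontal term is continuous in time, in particular integrable
  have hhor : ∫ s in (0 : ℝ)..t, horizontalTerm u s (windowOf T g s) =
      -(∫ s in (0 : ℝ)..t, timeDeriv u s (windowOf T g s)) -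
        (∫ s in (0 : ℝ)..t, σ ^ 2 * (S s (windowOf T g s)).pair (diagIndicator T s)) / 2 := by
    rw [← intervalIntegral.integral_neg, ← intervalIntegral.integral_div,
      ← intervalIntegral.integral_sub hτi (hpi.div_const 2)]
    refine intervalIntegral.integral_congr fun s hs => ?_
    rw [uIcc_of_le ht.1] at hs
    have := hpde s ⟨hs.1, hs.2.trans_lt ht.2⟩ _ (hg.windowOf_mem ⟨hs.1, hs.2.trans ht.2.le⟩)
    change horizontalTerm u s (windowOf T g s) = -timeDeriv u s (windowOf T g s) -
      σ ^ 2 * (S s (windowOf T g s)).pair (diagIndicator T s) / 2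
    linarith
  have main : ∀ ε : ℕ → ℝ, (∀ n, 0 < ε n) → Tendsto ε atTop (𝓝 0) →
      Tendsto (fun n => ∫ s in (0 : ℝ)..t,
        gradDelta u s (windowOf T g s) * ((g (s + ε n) - g s) / ε n)) atTop
        (𝓝 (u t (windowOf T g t) - u 0 (windowOf T g 0))) := by
    intro ε hε hε0
    have l1 := tendsto_integral_increment hv ht hε hε0
    have l2 := tendsto_integral_first_order hu hS hSc hC hg ht hε hε0
    have l3 := hg.tendsto_integral_form htT hSη hε hε0
    have l4 := hg.tendsto_integral_itoRemainder hu hS hSc ht hε hε0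
    have l := (((l1.sub l2).sub (l3.div_const 2)).sub l4).sub_const
      (∫ s in (0 : ℝ)..t, timeDeriv u s (windowOf T g s))
    rw [hhor] at l
    have e : ∀ a b p q : ℝ, a - b - (-p - q / 2) - q / 2 - 0 - p = a - b := fun a b p q => by ring
    rw [e] at l
    refine l.congr' ?_
    filter_upwards [hε0.eventually (gt_mem_nhds (sub_pos.2 ht.2))] with n hn
    have hεn := hε n
    set Δ : ℝ → PathSpace T := fun s => windowOf T g (s + ε n) - windowOf T g s with hΔ
    have hΔc : ContinuousOn Δ (Icc 0 t) := (continuous_increment (ε n)).continuousOn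
    have i1 : ContinuousOn (fun s => u (s + ε n) (windowOf T g (s + ε n)) -
        u s (windowOf T g s)) (Icc 0 t) := by
      refine ContinuousOn.sub (hv.comp (f := fun s => s + ε n) (by fun_prop) fun s hs =>
        ⟨by linarith [hs.1], by linarith [hs.2]⟩) (hv.mono (Icc_subset_Icc_right ht.2.le))
    have i2 : ContinuousOn (fun s => fderiv ℝ (u s) (windowOf T g s) (Δ s)) (Icc 0 t) :=
      hL.clm_apply hΔc
    have i3 : ContinuousOn (fun s => gradDelta u s (windowOf T g s) * (g (s + ε n) - g s))
        (Icc 0 t) := hξ.mul (by fun_prop)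
    have i4 : ContinuousOn (fun s => (S s (windowOf T g s)).form (Δ s) (Δ s)) (Icc 0 t) :=
      ContinuousOn.form_self hSη hΔc
    have hR : ∫ s in (0 : ℝ)..t, itoRemainder u S g (ε n) s =
        (∫ s in (0 : ℝ)..t, (u (s + ε n) (windowOf T g (s + ε n)) - u s (windowOf T g s))) -
        ε n * (∫ s in (0 : ℝ)..t, timeDeriv u s (windowOf T g s)) -
        (∫ s in (0 : ℝ)..t, fderiv ℝ (u s) (windowOf T g s) (Δ s)) -
        (∫ s in (0 : ℝ)..t, (S s (windowOf T g s)).form (Δ s) (Δ s)) / 2 := by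
      rw [← intervalIntegral.integral_const_mul, ← intervalIntegral.integral_div,
        ← intervalIntegral.integral_sub (hint i1) ((hint hτ).const_mul _),
        ← intervalIntegral.integral_sub ((hint i1).sub ((hint hτ).const_mul _)) (hint i2),
        ← intervalIntegral.integral_sub (((hint i1).sub ((hint hτ).const_mul _)).sub (hint i2))
          ((hint i4).div_const 2)]
      rfl
    have hX : ∫ s in (0 : ℝ)..t, gradDelta u s (windowOf T g s) * ((g (s + ε n) - g s) / ε n) =
        (ε n)⁻¹ * ∫ s in (0 : ℝ)..t, gradDelta u s (windowOf T g s) * (g (s + ε n) - g s) := by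
      rw [← intervalIntegral.integral_const_mul]
      congr 1
      ext s
      ring
    rw [hR, hX, intervalIntegral.integral_sub (hint i2) (hint i3)]
    field_simp
    ring
  refine tendsto_of_seq_tendsto fun ε hε => ?_
  obtain ⟨hε0, hεp⟩ := tendsto_nhdsWithin_iff.1 hε
  obtain ⟨N, hN⟩ := eventually_atTop.1 hεp
  refine (tendsto_add_atTop_iff_nat N).1 (main (fun n => ε (n + N)) (fun n => hN _ (by omega))
    ((tendsto_add_atTop_iff_nat N).2 hε0))

end Ito

/-! ### Measurability of functionals of the window, and convergence in probability -/

section Measurability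

/-- A map into `C(K, ℝ)` whose evaluations are measurable pulls open sets back to measurable sets:
an open set is a countable union of closed balls, and a closed ball is cut out by countably many
evaluations. -/
lemma measurableSet_preimage_of_eval {Ω K : Type*} {m : MeasurableSpace Ω} [MetricSpace K]
    [CompactSpace K] {Y : Ω → C(K, ℝ)} (hY : ∀ x, Measurable[m] fun ω => Y ω x)
    {U : Set C(K, ℝ)} (hU : IsOpen U) : MeasurableSet[m] (Y ⁻¹' U) := by
  obtain ⟨A, hAc, hAd⟩ := TopologicalSpace.exists_countable_dense K
  obtain ⟨D, hDc, hDd⟩ := TopologicalSpace.exists_countable_dense C(K, ℝ)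
  have hball : ∀ f : C(K, ℝ), ∀ r : ℝ, 0 ≤ r →
      MeasurableSet[m] (Y ⁻¹' Metric.closedBall f r) := by
    intro f r hr
    have e : Y ⁻¹' Metric.closedBall f r = ⋂ x ∈ A, {ω | |Y ω x - f x| ≤ r} := by
      ext ω
      simp only [mem_preimage, mem_iInter, mem_ofPred_eq]
      rw [Metric.mem_closedBall, dist_eq_norm, ContinuousMap.norm_le _ hr]
      refine ⟨fun h x _ => h x, fun h => ?_⟩
      have hc : IsClosed {x | ‖(Y ω - f) x‖ ≤ r} :=
        isClosed_le (by fun_prop) continuous_const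
      exact fun x => hc.closure_subset_iff.2 (fun x hx => h x hx) (hAd x)
    rw [e]
    exact MeasurableSet.biInter hAc fun x _ =>
      measurableSet_le ((hY x).sub_const _).abs measurable_const
  have e : Y ⁻¹' U = ⋃ f ∈ D, ⋃ n ∈ {n : ℕ | Metric.closedBall f (1 / ((n : ℝ) + 1)) ⊆ U},
      Y ⁻¹' Metric.closedBall f (1 / ((n : ℝ) + 1)) := by
    ext ω
    simp only [mem_preimage, mem_iUnion, exists_prop, mem_ofPred_eq]
    refine ⟨fun h => ?_, fun ⟨f, _, n, hn, h⟩ => hn h⟩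
    obtain ⟨r, hr, hrU⟩ := Metric.isOpen_iff.1 hU _ h
    obtain ⟨n, hn⟩ := exists_nat_one_div_lt (half_pos hr)
    obtain ⟨f, hf, hfD⟩ := hDd.exists_dist_lt (Y ω) (Nat.one_div_pos_of_nat (n := n) (α := ℝ))
    refine ⟨f, hf, n, fun φ hφ => hrU ?_, hfD.le⟩
    rw [Metric.mem_closedBall] at hφ
    rw [Metric.mem_ball]
    calc dist φ (Y ω) ≤ dist φ f + dist f (Y ω) := dist_triangle _ _ _
      _ < r := by rw [dist_comm f]; linarith
  rw [e]
  exact MeasurableSet.biUnion hDc fun f _ => MeasurableSet.biUnion (to_countable _) fun n _ =>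
    hball f _ (Nat.one_div_pos_of_nat).le

lemma measurable_comp_of_eval {Ω K : Type*} {m : MeasurableSpace Ω} [MetricSpace K]
    [CompactSpace K] {Y : Ω → C(K, ℝ)} (hY : ∀ x, Measurable[m] fun ω => Y ω x)
    {φ : C(K, ℝ) → ℝ} (hφ : Continuous φ) : Measurable[m] fun ω => φ (Y ω) :=
  measurable_of_isOpen fun _ hs => measurableSet_preimage_of_eval hY (hs.preimage hφ)

/-- Almost sure convergence implies convergence in probability, along a countably generated
filter. -/
lemma tendstoInMeasure_of_tendsto_ae_filter {Ω ι : Type*} [MeasurableSpace Ω] {P : Measure Ω}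
    [IsFiniteMeasure P] {l : Filter ι} [l.IsCountablyGenerated] {f : ι → Ω → ℝ} {g : Ω → ℝ}
    (hf : ∀ i, AEStronglyMeasurable (f i) P)
    (h : ∀ᵐ ω ∂P, Tendsto (fun i => f i ω) l (𝓝 (g ω))) : TendstoInMeasure P f l g :=
  fun ε hε => tendsto_of_seq_tendsto fun v hv =>
    tendstoInMeasure_of_tendsto_ae (fun n => hf (v n)) (h.mono fun _ h => h.comp hv) ε hε

/-- Measurability of parametric integrals of functions continuous in the integration variable, hence
jointly measurable. -/
lemma measurable_intervalIntegral {Ω : Type*} [MeasurableSpace Ω] {f : ℝ → Ω → ℝ} {t : ℝ}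
    (ht : 0 ≤ t) (hc : ∀ ω, ContinuousOn (fun s => f s ω) (Icc 0 t))
    (hm : ∀ s ∈ Icc 0 t, Measurable (f s)) : Measurable fun ω => ∫ s in (0 : ℝ)..t, f s ω := by
  set F : ℝ → Ω → ℝ := fun s ω => f (projIcc 0 t ht s) ω with hF
  have hFc : ∀ ω, Continuous fun s => F s ω := fun ω =>
    (hc ω).comp_continuous (f := fun s => (projIcc 0 t ht s : ℝ))
      (continuous_subtype_val.comp continuous_projIcc) fun s => (projIcc 0 t ht s).2
  have h := stronglyMeasurable_uncurry_of_continuous_of_stronglyMeasurable hFc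
    fun s => (hm _ (projIcc 0 t ht s).2).stronglyMeasurable
  have e : (fun ω => ∫ s in (0 : ℝ)..t, f s ω) = fun ω => ∫ s in Ioc 0 t, F s ω := by
    ext ω
    rw [intervalIntegral.integral_of_le ht]
    refine setIntegral_congr_fun measurableSet_Ioc fun s hs => ?_
    simp only [hF]
    rw [projIcc_of_mem ht (Ioc_subset_Icc_self hs)]
  rw [e]
  exact (StronglyMeasurable.integral_prod_left (μ := volume.restrict (Ioc 0 t)) h).measurable

variable {T : ℝ} [hT : Fact (0 < T)] {Ω : Type*}

lemma measurable_window_canonicalSigma (X : Ω → C(Icc (0 : ℝ) T, ℝ)) {s : ℝ} (hs : 0 ≤ s)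
    (x : Icc (-T) (0 : ℝ)) : Measurable[canonicalSigma X s] fun ω => window (X ω) s x := by
  have hle : (projIcc 0 T hT.out.le (s + x) : ℝ) ≤ s := by
    rw [coe_projIcc]
    exact max_le hs ((min_le_right _ _).trans (by linarith [x.2.2]))
  exact Measurable.mono (comap_measurable _)
    (le_iSup₂_of_le (projIcc 0 T hT.out.le (s + x)) hle le_rfl) le_rfl

lemma measurable_window [MeasurableSpace Ω] {X : Ω → C(Icc (0 : ℝ) T, ℝ)}
    (hX : ∀ s, Measurable fun ω => X ω s) (s : ℝ) (x : Icc (-T) (0 : ℝ)) :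
    Measurable fun ω => window (X ω) s x := hX _

lemma IsC12.continuous_gradDelta {u : ℝ → PathSpace T → ℝ} (hu : IsC12 u) {s : ℝ}
    (hs : s ∈ Ico 0 T) : Continuous (gradDelta u s) :=
  continuous_deltaPart.comp (hu.differentiable_fderiv s hs).continuous

lemma IsC12.continuous {u : ℝ → PathSpace T → ℝ} (hu : IsC12 u) {s : ℝ}
    (hs : s ∈ Icc 0 T) : Continuous (u s) :=
  hu.continuousOn.comp_continuous (f := fun η => (s, η)) (by fun_prop) fun _ => ⟨hs, mem_univ _⟩

end Measurability

end WindowCalculus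

theorem mainTheorem6 {Ω : Type*} [MeasurableSpace Ω] (P : Measure Ω) [IsProbabilityMeasure P]
    (T : ℝ) [Fact (0 < T)] (σ : ℝ) (hσ : 0 ≤ σ)
    -- a real continuous process `X` on `[0, T]`
    (X : Ω → C(Icc (0 : ℝ) T, ℝ)) (hX : ∀ s, Measurable fun ω => X ω s)
    -- almost every path has quadratic variation `σ² t`
    (hqv : ∀ᵐ ω ∂P, ∀ t ∈ Icc 0 T, Tendsto
      (fun ε : ℝ => ∫ s in (0 : ℝ)..t, (prolong (X ω) (s + ε) - prolong (X ω) s) ^ 2 / ε)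
      (𝓝[>] 0) (𝓝 (σ ^ 2 * t)))
    (u : ℝ → PathSpace T → ℝ) (G : PathSpace T → ℝ)
    (hu : IsC12 u)
    (hC : ConditionC (fun t => σ ^ 2 * t) u)
    -- `D²u` takes its values in `χ₀`, continuously; `S t η` is `D²u(t, η)` as an element of `χ₀`
    (S : ℝ → PathSpace T → Chi0 T)
    (hS : ∀ t ∈ Ico 0 T, ∀ η ∈ qvSpace T (fun t => σ ^ 2 * t) t, ∀ f g : PathSpace T,
      fderiv ℝ (fderiv ℝ (u t)) η f g = Chi0.pair (S t η) fun x y => f x * g y)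
    (hS_cont : ContinuousOn (fun p : ℝ × PathSpace T => S p.1 p.2)
      {p | p.1 ∈ Ico 0 T ∧ p.2 ∈ qvSpace T (fun t => σ ^ 2 * t) p.1})
    -- the path-dependent PDE with terminal condition `G`
    (hpde : ∀ t ∈ Ico 0 T, ∀ η ∈ qvSpace T (fun t => σ ^ 2 * t) t,
      timeDeriv u t η + horizontalTerm u t η +
        σ ^ 2 / 2 * Chi0.pair (S t η) (diagIndicator T t) = 0)
    (hG : u T = G) :
    (∀ s ∈ Ico 0 T, Measurable[canonicalSigma X s] fun ω => gradDelta u s (window (X ω) s)) ∧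
    ∃ Z : Ω → ℝ,
      IsImproperForwardIntegral P T (fun s ω => gradDelta u s (window (X ω) s))
        (fun s ω => prolong (X ω) s) Z ∧
      ∀ᵐ ω ∂P, G (window (X ω) T) = u 0 (window (X ω) 0) + Z ω := by
  have hT : (0 : ℝ) < T := Fact.out
  have hW := measurable_window hX
  have hξm : ∀ s ∈ Ico 0 T, Measurable fun ω => gradDelta u s (window (X ω) s) := fun s hs =>
    measurable_comp_of_eval (hW s) (hu.continuous_gradDelta hs)
  have hξc : ∀ ω, ∀ t ∈ Ico 0 T,
      ContinuousOn (fun s => gradDelta u s (window (X ω) s)) (Icc 0 t) := fun ω t ht =>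
    hu.continuousOn_gradDelta_along (prolongC (X ω)) ht
  have h0 : (0 : ℝ) ∈ Icc 0 T := ⟨le_rfl, hT.le⟩
  -- the increment of `u` along the window, with time stopped at the ends of `[0, T]`
  set F : ℝ → Ω → ℝ := fun t ω => u (projIcc 0 T hT.le t) (window (X ω) (projIcc 0 T hT.le t)) -
    u 0 (window (X ω) 0) with hF
  have hFt : ∀ t ∈ Icc 0 T, ∀ ω, F t ω = u t (window (X ω) t) - u 0 (window (X ω) 0) :=
    fun t ht ω => by simp only [hF]; rw [projIcc_of_mem hT.le ht]
  have hFc : ∀ ω, Continuous fun t => F t ω := fun ω =>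
    ((hu.continuousOn_along (prolongC (X ω))).comp_continuous
      (f := fun t => (projIcc 0 T hT.le t : ℝ)) (continuous_subtype_val.comp continuous_projIcc)
      fun t => (projIcc 0 T hT.le t).2).sub continuous_const
  have hFm : ∀ t, Measurable (F t) := fun t =>
    (measurable_comp_of_eval (hW _) (hu.continuous (projIcc 0 T hT.le t).2)).sub
      (measurable_comp_of_eval (hW 0) (hu.continuous h0))
  refine ⟨fun s hs => measurable_comp_of_eval (measurable_window_canonicalSigma X hs.1)
    (hu.continuous_gradDelta hs), F T, ⟨F, fun t ht => ⟨.of_forall fun ω => ?_, ?_⟩,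
    fun ω => (hFc ω).continuousOn, ?_⟩, .of_forall fun ω => ?_⟩
  · exact ContinuousOn.intervalIntegrable (by rw [uIcc_of_le ht.1]; exact hξc ω t ht)
  · refine tendstoInMeasure_of_tendsto_ae_filter (fun ε => ?_) (hqv.mono fun ω hω => ?_)
    · refine (measurable_intervalIntegral ht.1 (fun ω => ?_) fun s hs => ?_).aestronglyMeasurable
      · have hc : Continuous (prolong (X ω)) := (prolongC (X ω)).continuous
        exact (hξc ω t ht).mul (by fun_prop)
      · exact (hξm s ⟨hs.1, hs.2.trans_lt ht.2⟩).mul (((hX _).sub (hX _)).div_const _)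
    · rw [hFt t ⟨ht.1, ht.2.le⟩]
      have hg : HasQV T σ (prolongC (X ω)) := hasQV_prolongC hω
      have h := HasQV.tendsto_forwardIntegral (S := S) hu hS hS_cont hC hpde hg ht
      exact h
  · exact tendstoInMeasure_of_tendsto_ae_filter (fun t => (hFm t).aestronglyMeasurable)
      (.of_forall fun ω => (hFc ω).continuousAt.tendsto.mono_left nhdsWithin_le_nhds)
  · rw [hFt T ⟨hT.le, le_rfl⟩, ← hG]
    ring
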